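/- **Model.** Let $0\le\underline\theta<\bar\theta$. An agent has a private type $\theta$ drawn from a distribution $F$ on $\Theta=[\underline\theta,\bar\theta]$ with continuous density $f>0$ on $\Theta$. He chooses a quality $q\in Q=[0,q_{\max}]$ at cost $c(q)/\theta$, where $c\in C^2(Q)$, $c(0)=c'(0)=0$, $c'(q)>0$ and $c''(q)>0$ for $q\in(0,q_{\max}]$, and $c(q_{\max})\ge\bar\theta\,q_{\max}$ (so $Q$ contains every quality that some type would produce for a wage equal to that quality). A *rating scheme* is a Markov kernel $\pi:Q\to\Delta(S)$ from qualities to scores in a Polish space $S$. After $\pi$ is announced, each type chooses a quality $q(\theta)$ and whether to take the test. The market observes a score $s\sim\pi(q)$ if the test is taken and a null score $\varnothing$ otherwise, forms a belief $\mu_s$ (or $\mu_\varnothing$) about quality, and pays the posterior mean $\omega(s)=\mathbb E_{\mu_s}[q]$ (or $\omega(\varnothing)=\mathbb E_{\mu_\varnothing}[q]$). With the interim wage $\hat w(q)=\int\omega(s)\,\pi(ds\mid q)$, type $\theta$ maximizes $\theta\hat w(q)-c(q)$ if he takes the test and $\theta\,\omega(\varnothing)-c(q)$ if he does not (this is $\theta$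 times wage minus cost). An *equilibrium* of $\pi$ consists of measurable strategies that are optimal for every type $\theta\in\Theta$ and beliefs that (i) obey Bayes' rule on the equilibrium path, (ii) after every score $s$ that lies in the support of $\pi(q)$ for some $q\in Q$ are concentrated on the qualities $q$ with $s\in\operatorname{supp}\pi(q)$, and (iii) satisfy $\mu_\varnothing=\delta_0$ if almost every type takes the test. The principal's payoff is expected quality $\mathbb E[q(\theta)]=\int_\Theta q\,dF$ (that is, $v(q,\theta)=q$). A rating scheme is *optimal* if it has an equilibrium whose expected quality is at least that of every equilibrium of every (deterministic or stochastic) rating scheme. A *pass/fail test* with minimum standard $q_0\in Q$ gives the score "pass" if $q\ge q_0$ and "fail" otherwise. The *fully revealing test* has $S=Q$ and score $q$ for quality $q$. "Increasing" and "decreasing" are meant weakly. **Corollary.** 1. If $f$ is increasing on $\Theta$, then for some $q_0\in Q$ the pass/fail test with minimum standard $q_0$ is optimal. 2. Suppose that $f$ is differentiable on $(\underline\theta,\bar\theta)$. The fully revealing test is optimal if and only if $f$ is decreasing on $\Theta$, $\theta f'(\theta)/f(\theta)$ is decreasing on $(\underline\theta,\bar\theta)$, and $\underline\theta=0$. -/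

import Mathlib

open MeasureTheory ProbabilityTheory Set

noncomputable section

/-- The environment: types `θ ∈ [θl, θh]` with a continuous positive density `f`, qualities
`q ∈ [0, qmax]`, and cost `c q / θ`, where `c` is `C²` with `c' > 0`, `c'' > 0` for `q > 0` and
`c 0 = c' 0 = 0`. The condition `θh * qmax ≤ c qmax` says that the quality range contains every
quality that some type is willing to produce for a wage equal to that quality. -/
structure RatingModel where
  θl : ℝ
  θh : ℝ
  qmax : ℝ
  f : ℝ → ℝ
  c : ℝ → ℝ
  θl_nonneg : 0 ≤ θl
  θl_lt_θh : θl < θh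
  f_cont : ContinuousOn f (Icc θl θh)
  f_pos : ∀ θ ∈ Icc θl θh, 0 < f θ
  f_density : ∫ θ in Icc θl θh, f θ = 1
  qmax_pos : 0 < qmax
  c_smooth : ContDiffOn ℝ 2 c (Icc 0 qmax)
  c_zero : c 0 = 0
  c_deriv_zero : derivWithin c (Icc 0 qmax) 0 = 0
  c_deriv_pos : ∀ q ∈ Ioc 0 qmax, 0 < derivWithin c (Icc 0 qmax) q
  c_deriv2_pos : ∀ q ∈ Ioc 0 qmax, 0 < iteratedDerivWithin 2 c (Icc 0 qmax) q
  qmax_large : θh * qmax ≤ c qmax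

namespace RatingModel

/-- The set of types. -/
abbrev types (M : RatingModel) : Set ℝ := Icc M.θl M.θh

/-- The set of qualities `[0, qmax]`. -/
abbrev Quality (M : RatingModel) : Type := Icc (0 : ℝ) M.qmax

/-- The distribution of types. -/
def prior (M : RatingModel) : Measure ℝ :=
  (volume.restrict M.types).withDensity (fun θ => ENNReal.ofReal (M.f θ))

/-- Quality zero. -/
def zeroQuality (M : RatingModel) : M.Quality := ⟨0, le_refl 0, M.qmax_pos.le⟩

/-- A (possibly stochastic) rating scheme: a Blackwell experiment `q ↦ π(q) ∈ Δ(Score)` from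
qualities to scores in a Polish space. -/
structure RatingScheme (M : RatingModel) where
  Score : Type
  [topScore : TopologicalSpace Score]
  [polishScore : PolishSpace Score]
  [measScore : MeasurableSpace Score]
  [borelScore : BorelSpace Score]
  kernel : Kernel M.Quality Score
  [markov : IsMarkovKernel kernel]

attribute [instance] RatingScheme.topScore RatingScheme.polishScore RatingScheme.measScore
  RatingScheme.borelScore RatingScheme.markov

/-- What the agent and the market do once a rating scheme has been announced. -/
structure Assessment (M : RatingModel) (R : M.RatingScheme) where
  /-- the quality chosen by each type -/
  quality : ℝ → M.Quality
  /-- the set of types that take the test -/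
  takers : Set ℝ
  /-- the market's belief about quality after each score of the test -/
  belief : Kernel R.Score M.Quality
  /-- the market's belief about quality when the test is not taken (the null score) -/
  nullBelief : Measure M.Quality

namespace Assessment

variable {M : RatingModel} {R : M.RatingScheme}

/-- The wage `ω(s)` after score `s`: the posterior mean of quality. -/
def wage (A : M.Assessment R) (s : R.Score) : ℝ := ∫ x, (x : ℝ) ∂(A.belief s)

/-- The wage `ω(∅)` after the null score. -/
def nullWage (A : M.Assessment R) : ℝ := ∫ x, (x : ℝ) ∂A.nullBelief

/-- The interim wage `ŵ(x) = E_{s ∼ π(x)} ω(s)` of an agent who takes the test with quality `x`. -/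
def interimWage (A : M.Assessment R) (x : M.Quality) : ℝ := ∫ s, A.wage s ∂(R.kernel x)

/-- Payoff of type `θ` from taking the test with quality `x`. Payoffs are multiplied by the type
(`θ * wage - c x` instead of `wage - c x / θ`), so that type `0` has the right preferences:
investing is prohibitively costly. -/
def payoffTake (A : M.Assessment R) (θ : ℝ) (x : M.Quality) : ℝ :=
  θ * A.interimWage x - M.c x

/-- Payoff of type `θ` from not taking the test, with quality `x`. -/
def payoffDecline (A : M.Assessment R) (θ : ℝ) (x : M.Quality) : ℝ :=
  θ * A.nullWage - M.c x

open Classical in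
/-- Payoff of type `θ` from its prescribed strategy. -/
def payoff (A : M.Assessment R) (θ : ℝ) : ℝ :=
  if θ ∈ A.takers then A.payoffTake θ (A.quality θ) else A.payoffDecline θ (A.quality θ)

/-- The distribution of quality among test takers (of total mass the share of takers). -/
def takerQuality (A : M.Assessment R) : Measure M.Quality :=
  (M.prior.restrict A.takers).map A.quality

/-- The assessment is an equilibrium under the rating scheme. -/
structure IsEquilibrium (A : M.Assessment R) : Prop where
  measurable_quality : Measurable A.quality
  measurable_takers : MeasurableSet A.takers
  belief_markov : IsMarkovKernel A.belief
  nullBelief_prob : IsProbabilityMeasure A.nullBelief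
  /-- every type's choices of quality and participation are optimal -/
  optimal_take : ∀ θ ∈ M.types, ∀ x : M.Quality, A.payoffTake θ x ≤ A.payoff θ
  optimal_decline : ∀ θ ∈ M.types, ∀ x : M.Quality, A.payoffDecline θ x ≤ A.payoff θ
  /-- Bayes' rule after scores: the joint law of (score, quality) among test takers is the law of
  the score followed by the belief -/
  bayes : (A.takerQuality ⊗ₘ R.kernel).map Prod.swap = (R.kernel ∘ₘ A.takerQuality) ⊗ₘ A.belief
  /-- after any score, also an unexpected one, the market excludes qualities that cannot produce
  that score -/
  consistent : ∀ s : R.Score, (∃ x, s ∈ (R.kernel x).support) →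
    ∀ᵐ x ∂(A.belief s), s ∈ (R.kernel x).support
  /-- Bayes' rule after the null score -/
  bayes_null : (M.prior.restrict A.takersᶜ).map A.quality = M.prior A.takersᶜ • A.nullBelief
  /-- if the null score is unexpected, the market believes that quality is zero, the only choice
  that can be optimal without the test -/
  consistent_null : M.prior A.takersᶜ = 0 → A.nullBelief = Measure.dirac M.zeroQuality

/-- The principal's payoff `E[q(θ)]`. -/
def expectedQuality (A : M.Assessment R) : ℝ := ∫ θ, (A.quality θ : ℝ) ∂M.prior

end Assessment

/-- A rating scheme is optimal if one of its equilibria gives the principal at least the expected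
quality of every equilibrium of every rating scheme. -/
def IsOptimal (M : RatingModel) (R : M.RatingScheme) : Prop :=
  ∃ A : M.Assessment R, A.IsEquilibrium ∧
    ∀ (R' : M.RatingScheme) (A' : M.Assessment R'), A'.IsEquilibrium →
      A'.expectedQuality ≤ A.expectedQuality

open Classical in
/-- The result of a pass/fail test with minimum standard `q₀`: `true` means pass. -/
def passFailScore (M : RatingModel) (q₀ x : M.Quality) : Bool := if q₀ ≤ x then true else false

theorem measurable_passFailScore (M : RatingModel) (q₀ : M.Quality) :
    Measurable (M.passFailScore q₀) :=
  Measurable.ite measurableSet_Ici measurable_const measurable_const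

/-- The pass/fail test with minimum standard `q₀`. -/
abbrev passFail (M : RatingModel) (q₀ : M.Quality) : M.RatingScheme where
  Score := Bool
  kernel := Kernel.deterministic (M.passFailScore q₀) (M.measurable_passFailScore q₀)

/-- The fully revealing test: the score is the quality itself. -/
abbrev fullyRevealing (M : RatingModel) : M.RatingScheme where
  Score := M.Quality
  polishScore := isClosed_Icc.polishSpace
  kernel := Kernel.id

/-- The elasticity `θ f'(θ) / f(θ)` of the density. -/
def elasticity (M : RatingModel) (θ : ℝ) : ℝ := θ * deriv M.f θ / M.f θ

end RatingModel

end

/-! Only the quality `q θ` and the interim wage `w θ` of each type matter. Incentive compatibility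
makes `w` increasing and gives the envelope formula `U' = w` for `U θ = θ * w θ - c (q θ)`. Bayes'
rule makes wages a mean-preserving contraction of qualities: after each score, Chebyshev's
inequality for the belief shows that quality and any increasing function of it are positively
correlated. As both are increasing in the type, this becomes `Feasible`: `E q = E w`, and on every
upper tail of types `q` has at least the integral of `w`.

Part 1. Let `x` be the left limit of `w` at `θh`, and compare `w` with the step function that jumps
from `0` to `x` at the type willing to pay `c x` for the wage `x`. The difference crosses zero once,
from below. The envelope formula shows that its unweighted integral is nonnegative, so its integral
against an increasing `f` is nonnegative (`Feasible.expected_le_passQuality`). The step function is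
the outcome of a pass/fail test, and a best standard exists by compactness.

Part 2, sufficiency. Let `b = bestQ` be the outcome of full revelation and `U*` its utility. If `θl
= 0`, integration by parts turns `E w - E b` into `f θh * (U - U*) θh + ∫ -f' * (U - U*)`. The
boundary term is nonpositive, and `U* θ ≥ θ * q θ - c (q θ)` gives `U - U* ≤ θ * (w - q)`. What
remains is the integral of `f * (w - q)` against minus the elasticity, a nonnegative increasing
weight, and the tail inequalities make it nonpositive (`Feasible.expected_le_bestQ`).

Part 2, necessity. The equilibrium quality of full revelation is unique, so any equilibrium with a
higher mean refutes its optimality. If `θl > 0`, a minimum standard that all types just accept is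
better. If `f' > 0` at a type, pooling qualities around that type's choice shifts quality from
slightly lower to slightly higher types at an unchanged unweighted integral
(`deriv_density_nonpos_of_optimal`). If the elasticity increases from `a` to `b`, hiding with small
probability the qualities of types near `a` and near `b` behind one common score is better
(`noisy_gain_nonpos`, `covariance_nonneg_of_optimal`, `antitoneOn_elasticity_of_optimal`). -/

noncomputable section

open Filter Topology

namespace RatingModel

variable (M : RatingModel)

/-! ### The cost function and the efficient quality -/

/-- The marginal cost `c'`. -/
def marginalCost (x : ℝ) : ℝ := derivWithin M.c (Icc 0 M.qmax) x

theorem uniqueDiffOn_quality : UniqueDiffOn ℝ (Icc 0 M.qmax) := uniqueDiffOn_Icc M.qmax_pos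

theorem cost_continuousOn : ContinuousOn M.c (Icc 0 M.qmax) := M.c_smooth.continuousOn

theorem marginalCost_continuousOn : ContinuousOn M.marginalCost (Icc 0 M.qmax) :=
  M.c_smooth.continuousOn_derivWithin M.uniqueDiffOn_quality (by norm_num)

theorem marginalCost_strictMonoOn : StrictMonoOn M.marginalCost (Icc 0 M.qmax) := by
  refine strictMonoOn_of_deriv_pos (convex_Icc _ _) M.marginalCost_continuousOn fun x hx => ?_
  rw [interior_Icc] at hx
  have h := M.c_deriv2_pos x ⟨hx.1, hx.2.le⟩
  rw [iteratedDerivWithin_succ, iteratedDerivWithin_one,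
    derivWithin_of_mem_nhds (Icc_mem_nhds hx.1 hx.2)] at h
  exact h

theorem cost_hasDerivAt {x : ℝ} (hx : x ∈ Ioo 0 M.qmax) : HasDerivAt M.c (M.marginalCost x) x :=
  ((M.c_smooth.differentiableOn (by norm_num) x
    (Ioo_subset_Icc_self hx)).hasDerivWithinAt).hasDerivAt (Icc_mem_nhds hx.1 hx.2)

theorem cost_strictConvexOn : StrictConvexOn ℝ (Icc 0 M.qmax) M.c := by
  refine StrictMonoOn.strictConvexOn_of_deriv (convex_Icc _ _) M.cost_continuousOn ?_
  rw [interior_Icc]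
  intro x hx y hy hxy
  rw [(M.cost_hasDerivAt hx).deriv, (M.cost_hasDerivAt hy).deriv]
  exact M.marginalCost_strictMonoOn (Ioo_subset_Icc_self hx) (Ioo_subset_Icc_self hy) hxy

theorem cost_strictMonoOn : StrictMonoOn M.c (Icc 0 M.qmax) := by
  refine strictMonoOn_of_deriv_pos (convex_Icc _ _) M.cost_continuousOn fun x hx => ?_
  rw [interior_Icc] at hx
  rw [(M.cost_hasDerivAt hx).deriv]
  exact M.c_deriv_pos x ⟨hx.1, hx.2.le⟩

theorem cost_nonneg {x : ℝ} (hx : x ∈ Icc 0 M.qmax) : 0 ≤ M.c x := by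
  rw [← M.c_zero]
  exact M.cost_strictMonoOn.monotoneOn (left_mem_Icc.2 M.qmax_pos.le) hx hx.1

theorem cost_pos {x : ℝ} (hx : x ∈ Ioc 0 M.qmax) : 0 < M.c x := by
  rw [← M.c_zero]
  exact M.cost_strictMonoOn (left_mem_Icc.2 M.qmax_pos.le) (Ioc_subset_Icc_self hx) hx.1

theorem surplus_strictConcaveOn (θ : ℝ) :
    StrictConcaveOn ℝ (Icc 0 M.qmax) (fun x => θ * x - M.c x) := by
  have h : ConcaveOn ℝ (Icc 0 M.qmax) (fun x : ℝ => θ * x) :=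
    ((LinearMap.mul ℝ ℝ θ).concaveOn (convex_Icc _ _))
  exact h.sub_strictConvexOn M.cost_strictConvexOn

theorem surplus_continuousOn (θ : ℝ) : ContinuousOn (fun x => θ * x - M.c x) (Icc 0 M.qmax) :=
  (continuousOn_const.mul continuousOn_id).sub M.cost_continuousOn

/-- Small qualities cost less than they are worth to a positive type. -/
theorem exists_cost_lt {θ : ℝ} (hθ : 0 < θ) : ∃ x ∈ Ioo 0 M.qmax, M.c x < θ * x := by
  have h0 : HasDerivWithinAt M.c 0 (Icc 0 M.qmax) 0 := by
    have := (M.c_smooth.differentiableOn (by norm_num) 0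
      (left_mem_Icc.2 M.qmax_pos.le)).hasDerivWithinAt
    rwa [M.c_deriv_zero] at this
  have h1 := h0.mono Ioo_subset_Icc_self
  rw [hasDerivWithinAt_iff_tendsto_slope' (by simp)] at h1
  have h2 := h1.eventually (gt_mem_nhds hθ)
  have : (𝓝[Ioo 0 M.qmax] (0 : ℝ)).NeBot := by
    rw [nhdsWithin_Ioo_eq_nhdsGT M.qmax_pos]; infer_instance
  obtain ⟨x, hx, hm⟩ := (h2.and self_mem_nhdsWithin).exists
  refine ⟨x, hm, ?_⟩
  rw [slope_def_field, M.c_zero, sub_zero, sub_zero, div_lt_iff₀ hm.1] at hx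
  exact hx

theorem exists_bestQuality (θ : ℝ) :
    ∃ x : M.Quality, ∀ y : M.Quality, θ * y - M.c y ≤ θ * x - M.c x := by
  obtain ⟨x, hx, h⟩ := isCompact_Icc.exists_isMaxOn (nonempty_Icc.2 M.qmax_pos.le)
    (M.surplus_continuousOn θ)
  exact ⟨⟨x, hx⟩, fun y => h y.2⟩

/-- The quality that type `θ` produces for a wage equal to quality. -/
def bestQuality (θ : ℝ) : M.Quality := (M.exists_bestQuality θ).choose

theorem le_bestQuality_surplus (θ : ℝ) {x : ℝ} (hx : x ∈ Icc 0 M.qmax) :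
    θ * x - M.c x ≤ θ * M.bestQuality θ - M.c (M.bestQuality θ) :=
  (M.exists_bestQuality θ).choose_spec ⟨x, hx⟩

theorem bestQuality_unique {θ x : ℝ} (hx : x ∈ Icc 0 M.qmax)
    (h : θ * M.bestQuality θ - M.c (M.bestQuality θ) ≤ θ * x - M.c x) :
    x = M.bestQuality θ := by
  refine (M.surplus_strictConcaveOn θ).eq_of_isMaxOn (fun y hy => ?_)
    (fun y hy => M.le_bestQuality_surplus θ hy) hx (M.bestQuality θ).2
  exact (M.le_bestQuality_surplus θ hy).trans h

theorem bestQuality_mono : Monotone M.bestQuality := by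
  intro θ θ' h
  rcases h.eq_or_lt with rfl | h
  · exact le_rfl
  have h1 := M.le_bestQuality_surplus θ (M.bestQuality θ').2
  have h2 := M.le_bestQuality_surplus θ' (M.bestQuality θ).2
  rw [← Subtype.coe_le_coe]
  by_contra! h3
  nlinarith

theorem bestQuality_zero : (M.bestQuality 0 : ℝ) = 0 := by
  have h := M.le_bestQuality_surplus 0 (left_mem_Icc.2 M.qmax_pos.le)
  rw [M.c_zero] at h
  by_contra h0
  have := M.cost_pos ⟨lt_of_le_of_ne (M.bestQuality 0).2.1 (Ne.symm h0), (M.bestQuality 0).2.2⟩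
  linarith

theorem bestQuality_surplus_nonneg (θ : ℝ) :
    0 ≤ θ * M.bestQuality θ - M.c (M.bestQuality θ) := by
  have h := M.le_bestQuality_surplus θ (left_mem_Icc.2 M.qmax_pos.le)
  simpa [M.c_zero] using h

theorem bestQuality_surplus_pos {θ : ℝ} (hθ : 0 < θ) :
    0 < θ * M.bestQuality θ - M.c (M.bestQuality θ) := by
  obtain ⟨x, hx, h⟩ := M.exists_cost_lt hθ
  have := M.le_bestQuality_surplus θ (Ioo_subset_Icc_self hx)
  linarith

theorem bestQuality_pos {θ : ℝ} (hθ : 0 < θ) : (0 : ℝ) < M.bestQuality θ := by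
  have := M.bestQuality_surplus_pos hθ
  refine lt_of_le_of_ne (M.bestQuality θ).2.1 fun h => ?_
  rw [← h, M.c_zero] at this
  simp at this

/-- By `qmax_large` the surplus at `qmax` is at most zero, while the optimal surplus of a positive
type is positive. This keeps the optimum interior, so the first-order condition is an equality. -/
theorem bestQuality_lt {θ : ℝ} (h0 : 0 < θ) (hθ : θ ≤ M.θh) : (M.bestQuality θ : ℝ) < M.qmax := by
  have := M.bestQuality_surplus_pos h0
  refine lt_of_le_of_ne (M.bestQuality θ).2.2 fun h => ?_
  rw [h] at this
  have := M.qmax_large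
  nlinarith [M.qmax_pos]

theorem marginalCost_bestQuality {θ : ℝ} (h0 : 0 ≤ θ) (hθ : θ ≤ M.θh) :
    M.marginalCost (M.bestQuality θ) = θ := by
  rcases h0.eq_or_lt with rfl | h0
  · rw [M.bestQuality_zero]; exact M.c_deriv_zero
  have hx : (M.bestQuality θ : ℝ) ∈ Ioo 0 M.qmax := ⟨M.bestQuality_pos h0, M.bestQuality_lt h0 hθ⟩
  have hd : HasDerivAt (fun x => θ * x - M.c x) (θ * 1 - M.marginalCost (M.bestQuality θ))
      (M.bestQuality θ) := ((hasDerivAt_id _).const_mul θ).sub (M.cost_hasDerivAt hx)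
  have hmax : IsLocalMax (fun x => θ * x - M.c x) (M.bestQuality θ : ℝ) := by
    filter_upwards [Icc_mem_nhds hx.1 hx.2] with y hy using M.le_bestQuality_surplus θ hy
  have := hmax.hasDerivAt_eq_zero hd
  linarith

theorem bestQuality_strictMonoOn : StrictMonoOn M.bestQuality (Icc 0 M.θh) := by
  intro θ hθ θ' hθ' h
  refine lt_of_le_of_ne (M.bestQuality_mono h.le) fun he => h.ne ?_
  rw [← M.marginalCost_bestQuality hθ.1 hθ.2, ← M.marginalCost_bestQuality hθ'.1 hθ'.2, he]

/-- Marginal cost is continuous and injective on a compact space, hence an embedding, and composing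
it with `bestQuality` gives the identity. -/
theorem bestQuality_continuousOn : ContinuousOn M.bestQuality (Icc 0 M.θh) := by
  have he : Topology.IsEmbedding (fun x : M.Quality => M.marginalCost x) := by
    refine Topology.IsClosedEmbedding.isEmbedding (Continuous.isClosedEmbedding ?_ ?_)
    · exact continuousOn_iff_continuous_domRestrict.1 M.marginalCost_continuousOn
    · intro x y h
      exact Subtype.ext (M.marginalCost_strictMonoOn.injOn x.2 y.2 h)
  rw [he.continuousOn_iff]
  exact continuousOn_id.congr fun θ hθ => M.marginalCost_bestQuality hθ.1 hθ.2

theorem types_subset : M.types ⊆ Icc 0 M.θh := Icc_subset_Icc_left M.θl_nonneg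

end RatingModel

namespace RatingModel

variable (M : RatingModel)

/-! ### The prior -/

theorem density_aemeasurable : AEMeasurable M.f (volume.restrict M.types) :=
  M.f_cont.aemeasurable measurableSet_Icc

theorem density_integrableOn : IntegrableOn M.f M.types := M.f_cont.integrableOn_Icc

theorem integral_prior (g : ℝ → ℝ) : ∫ θ, g θ ∂M.prior = ∫ θ in M.θl..M.θh, M.f θ * g θ := by
  rw [prior, integral_withDensity_eq_integral_toReal_smul₀
    M.density_aemeasurable.ennreal_ofReal (by simp),
    intervalIntegral.integral_of_le M.θl_lt_θh.le, ← integral_Icc_eq_integral_Ioc]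
  refine setIntegral_congr_fun measurableSet_Icc fun θ hθ => ?_
  simp [ENNReal.toReal_ofReal (M.f_pos θ hθ).le]

theorem ae_prior_of_ae {p : ℝ → Prop} (h : ∀ᵐ θ, θ ∈ M.types → p θ) : ∀ᵐ θ ∂M.prior, p θ :=
  (withDensity_absolutelyContinuous _ _).ae_le ((ae_restrict_iff' measurableSet_Icc).2 h)

theorem ae_prior_mem : ∀ᵐ θ ∂M.prior, θ ∈ M.types :=
  M.ae_prior_of_ae (Eventually.of_forall fun _ h => h)

instance prior_isProbabilityMeasure : IsProbabilityMeasure M.prior := by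
  constructor
  rw [prior, withDensity_apply _ MeasurableSet.univ, Measure.restrict_univ,
    ← ofReal_integral_eq_lintegral_ofReal M.density_integrableOn
      ((ae_restrict_iff' measurableSet_Icc).2 (Eventually.of_forall fun θ hθ => (M.f_pos θ hθ).le)),
    M.f_density, ENNReal.ofReal_one]

/-! ### Implementable allocations -/

/-- Quality `q` and interim wage `w`, as functions of the type, are incentive compatible. -/
structure Implementable (q w : ℝ → ℝ) : Prop where
  mem : ∀ θ ∈ M.types, q θ ∈ Icc 0 M.qmax
  ic : ∀ θ ∈ M.types, ∀ θ' ∈ M.types, θ * w θ' - M.c (q θ') ≤ θ * w θ - M.c (q θ)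
  ir : ∀ θ ∈ M.types, 0 ≤ θ * w θ - M.c (q θ)

variable {M}

theorem Implementable.wage_mono {q w : ℝ → ℝ} (h : M.Implementable q w) :
    MonotoneOn w M.types := by
  intro θ hθ θ' hθ' hle
  rcases hle.eq_or_lt with rfl | hlt
  · exact le_rfl
  have h1 := h.ic θ hθ θ' hθ'
  have h2 := h.ic θ' hθ' θ hθ
  by_contra! h3
  nlinarith

theorem Implementable.quality_mono {q w : ℝ → ℝ} (h : M.Implementable q w) :
    MonotoneOn q M.types := by
  intro θ hθ θ' hθ' hle
  have h1 := h.ic θ hθ θ' hθ'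
  have h2 := h.wage_mono hθ hθ' hle
  have h3 : 0 ≤ θ := M.θl_nonneg.trans hθ.1
  rw [← M.cost_strictMonoOn.le_iff_le (h.mem θ hθ) (h.mem θ' hθ')]
  nlinarith

/-- Each type could imitate the other at no change in cost. Type zero ignores wages, hence the
positivity assumptions. It allows all types at an atom of quality to be treated as one block. -/
theorem Implementable.wage_eq {q w : ℝ → ℝ} (h : M.Implementable q w) {θ θ' : ℝ}
    (hθ : θ ∈ M.types) (hθ' : θ' ∈ M.types) (h0 : 0 < θ) (h0' : 0 < θ') (he : q θ = q θ') :
    w θ = w θ' := by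
  have h1 := h.ic θ hθ θ' hθ'
  have h2 := h.ic θ' hθ' θ hθ
  rw [he] at h1 h2
  exact le_antisymm (le_of_mul_le_mul_left (by linarith) h0')
    (le_of_mul_le_mul_left (by linarith) h0)

theorem Implementable.quality_intervalIntegrable {q w : ℝ → ℝ} (h : M.Implementable q w) {s t : ℝ}
    (hs : s ∈ M.types) (ht : t ∈ M.types) : IntervalIntegrable q volume s t :=
  (h.quality_mono.mono (uIcc_subset_Icc hs ht)).intervalIntegrable

theorem Implementable.wage_intervalIntegrable {q w : ℝ → ℝ} (h : M.Implementable q w) {s t : ℝ}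
    (hs : s ∈ M.types) (ht : t ∈ M.types) : IntervalIntegrable w volume s t :=
  (h.wage_mono.mono (uIcc_subset_Icc hs ht)).intervalIntegrable

theorem density_mul_intervalIntegrable {g : ℝ → ℝ} {s t : ℝ}
    (hs : s ∈ M.types) (ht : t ∈ M.types) (hg : IntervalIntegrable g volume s t) :
    IntervalIntegrable (fun θ => M.f θ * g θ) volume s t :=
  hg.continuousOn_mul (M.f_cont.mono (uIcc_subset_Icc hs ht))

variable (M) in
/-- Incentive compatible allocations in which wages are less spread out than qualities. -/
structure Feasible (q w : ℝ → ℝ) : Prop extends M.Implementable q w where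
  balance : ∫ θ in M.θl..M.θh, M.f θ * (q θ - w θ) = 0
  -- Majorization can be stated with tails of types because `q` and `w` both increase in the type.
  major : ∀ t ∈ M.types, 0 ≤ ∫ θ in t..M.θh, M.f θ * (q θ - w θ)

/-! ### Equilibria induce feasible allocations -/

namespace Assessment

variable {R : M.RatingScheme} {A : M.Assessment R}

open Classical in
/-- The interim wage of each type. -/
def typeWage (A : M.Assessment R) (θ : ℝ) : ℝ :=
  if θ ∈ A.takers then A.interimWage (A.quality θ) else A.nullWage

theorem payoff_eq (A : M.Assessment R) (θ : ℝ) :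
    A.payoff θ = θ * A.typeWage θ - M.c (A.quality θ) := by
  unfold payoff typeWage payoffTake payoffDecline
  split_ifs <;> rfl

theorem IsEquilibrium.implementable (h : A.IsEquilibrium) :
    M.Implementable (fun θ => A.quality θ) A.typeWage where
  mem θ _ := (A.quality θ).2
  ic θ hθ θ' hθ' := by
    rw [← A.payoff_eq]
    by_cases ht : θ' ∈ A.takers
    · have := h.optimal_take θ hθ (A.quality θ')
      simpa [typeWage, ht, payoffTake] using this
    · have := h.optimal_decline θ hθ (A.quality θ')
      simpa [typeWage, ht, payoffDecline] using this
  ir θ hθ := by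
    rw [← A.payoff_eq]
    refine le_trans ?_ (h.optimal_decline θ hθ M.zeroQuality)
    have h1 : 0 ≤ θ := M.θl_nonneg.trans hθ.1
    have h2 : 0 ≤ A.nullWage := integral_nonneg fun x => x.2.1
    simp only [payoffDecline, zeroQuality, M.c_zero, sub_zero]
    positivity

end Assessment

theorem integrable_quality (μ : Measure M.Quality) [IsFiniteMeasure μ] :
    Integrable (fun x : M.Quality => (x : ℝ)) μ :=
  Integrable.of_bound measurable_subtype_coe.aestronglyMeasurable M.qmax
    (Eventually.of_forall fun x => by
      rw [Real.norm_eq_abs, abs_of_nonneg x.2.1]; exact x.2.2)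

theorem integral_quality_mem (μ : Measure M.Quality) [IsProbabilityMeasure μ] :
    ∫ x, (x : ℝ) ∂μ ∈ Icc 0 M.qmax := by
  refine ⟨integral_nonneg fun x => x.2.1, ?_⟩
  calc ∫ x, (x : ℝ) ∂μ ≤ ∫ _, M.qmax ∂μ :=
        integral_mono (integrable_quality μ) (integrable_const _) fun x => x.2.2
    _ = M.qmax := by simp

theorem abs_le_of_monotone {φ : ℝ → ℝ} (hφ : Monotone φ) (x : M.Quality) :
    |φ x| ≤ |φ 0| + |φ M.qmax| := by
  have h1 := hφ x.2.1
  have h2 := hφ x.2.2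
  rw [abs_le]
  constructor
  · have := neg_abs_le (φ 0); have := abs_nonneg (φ M.qmax); linarith
  · have := le_abs_self (φ M.qmax); have := abs_nonneg (φ 0); linarith

theorem abs_mul_sub_le {φ : ℝ → ℝ} (hφ : Monotone φ) (x : M.Quality) {y : ℝ}
    (hy : y ∈ Icc 0 M.qmax) : ‖φ x * (x - y)‖ ≤ (|φ 0| + |φ M.qmax|) * M.qmax := by
  rw [norm_mul]
  refine mul_le_mul (abs_le_of_monotone hφ x) ?_ (norm_nonneg _) (by positivity)
  rw [Real.norm_eq_abs, abs_le]
  constructor <;> linarith [x.2.1, x.2.2, hy.1, hy.2]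

/-- Chebyshev's association inequality for an increasing function of quality. -/
theorem integral_mul_sub_mean_nonneg (μ : Measure M.Quality) [IsProbabilityMeasure μ]
    {φ : ℝ → ℝ} (hφ : Monotone φ) :
    0 ≤ ∫ x, φ x * (x - ∫ y, (y : ℝ) ∂μ) ∂μ := by
  set m := ∫ y, (y : ℝ) ∂μ with hm
  have hi : Integrable (fun x : M.Quality => φ x * (x - m)) μ :=
    Integrable.of_bound ((hφ.measurable.comp measurable_subtype_coe).mul
      (measurable_subtype_coe.sub_const m)).aestronglyMeasurable _
      (Eventually.of_forall fun x => abs_mul_sub_le hφ x (integral_quality_mem μ))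
  -- Subtracting this zero integral leaves the integrand `(φ x - φ m) * (x - m)`, which is
  -- nonnegative by monotonicity.
  have h0 : ∫ x : M.Quality, φ m * (x - m) ∂μ = 0 := by
    rw [integral_const_mul, integral_sub (integrable_quality μ) (integrable_const _)]
    simp [hm]
  refine h0.symm.le.trans (integral_mono (((integrable_quality μ).sub (integrable_const _)).const_mul _) hi
    fun x => ?_)
  rcases le_total (x : ℝ) m with h | h
  · have := hφ h; nlinarith
  · have := hφ h; nlinarith

namespace Assessment

variable {R : M.RatingScheme} {A : M.Assessment R}

theorem measurable_wage (A : M.Assessment R) [IsMarkovKernel A.belief] : Measurable A.wage :=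
  (StronglyMeasurable.integral_kernel (κ := A.belief)
    measurable_subtype_coe.stronglyMeasurable).measurable

theorem wage_mem (A : M.Assessment R) [IsMarkovKernel A.belief] (s : R.Score) :
    A.wage s ∈ Icc 0 M.qmax := integral_quality_mem _

theorem measurable_interimWage (A : M.Assessment R) [IsMarkovKernel A.belief] :
    Measurable A.interimWage :=
  (StronglyMeasurable.integral_kernel (κ := R.kernel) A.measurable_wage.stronglyMeasurable).measurable

theorem integrable_wage (A : M.Assessment R) [IsMarkovKernel A.belief] (μ : Measure R.Score)
    [IsFiniteMeasure μ] : Integrable A.wage μ :=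
  Integrable.of_bound A.measurable_wage.aestronglyMeasurable M.qmax
    (Eventually.of_forall fun s => by
      rw [Real.norm_eq_abs, abs_of_nonneg (A.wage_mem s).1]; exact (A.wage_mem s).2)

theorem interimWage_mem (A : M.Assessment R) [IsMarkovKernel A.belief] (x : M.Quality) :
    A.interimWage x ∈ Icc 0 M.qmax := by
  refine ⟨integral_nonneg fun s => (A.wage_mem s).1, ?_⟩
  calc ∫ s, A.wage s ∂(R.kernel x) ≤ ∫ _, M.qmax ∂(R.kernel x) :=
        integral_mono (A.integrable_wage _) (integrable_const _) fun s => (A.wage_mem s).2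
    _ = M.qmax := by simp

instance (A : M.Assessment R) : IsFiniteMeasure A.takerQuality := by
  unfold takerQuality; infer_instance

/-- The joint law of quality and score is disintegrated in two ways, which agree by Bayes' rule.
Conditioning on quality turns the wage into the interim wage; conditioning on the score leaves
Chebyshev's inequality for the belief. -/
theorem IsEquilibrium.integral_taker_nonneg (h : A.IsEquilibrium) {φ : ℝ → ℝ} (hφ : Monotone φ) :
    0 ≤ ∫ x, φ x * (x - A.interimWage x) ∂A.takerQuality := by
  have := h.belief_markov
  set F : M.Quality × R.Score → ℝ := fun p => φ p.1 * (p.1 - A.wage p.2) with hF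
  have hFm : Measurable F :=
    (hφ.measurable.comp (measurable_subtype_coe.comp measurable_fst)).mul
      ((measurable_subtype_coe.comp measurable_fst).sub (A.measurable_wage.comp measurable_snd))
  have hFs : Measurable fun p : R.Score × M.Quality => F p.swap := hFm.comp measurable_swap
  have hFb : ∀ p, ‖F p‖ ≤ (|φ 0| + |φ M.qmax|) * M.qmax := fun p =>
    abs_mul_sub_le hφ p.1 (A.wage_mem p.2)
  have h1 : ∫ p, F p ∂(A.takerQuality ⊗ₘ R.kernel) =
      ∫ x, φ x * (x - A.interimWage x) ∂A.takerQuality := by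
    rw [Measure.integral_compProd
      (Integrable.of_bound hFm.aestronglyMeasurable _ (Eventually.of_forall hFb))]
    refine integral_congr_ae (Eventually.of_forall fun x => ?_)
    simp only [hF]
    rw [integral_const_mul, integral_sub (integrable_const _) (A.integrable_wage _)]
    simp [interimWage]
  have h2 : ∫ p, F p ∂(A.takerQuality ⊗ₘ R.kernel) =
      ∫ p, F p.swap ∂((R.kernel ∘ₘ A.takerQuality) ⊗ₘ A.belief) := by
    rw [← h.bayes, integral_map measurable_swap.aemeasurable hFs.aestronglyMeasurable]
    simp
  rw [← h1, h2, Measure.integral_compProd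
      (Integrable.of_bound hFs.aestronglyMeasurable _
        (Eventually.of_forall fun p => hFb p.swap))]
  exact integral_nonneg fun s => integral_mul_sub_mean_nonneg (A.belief s) hφ

theorem IsEquilibrium.integral_decline_nonneg (h : A.IsEquilibrium) {φ : ℝ → ℝ}
    (hφ : Monotone φ) :
    0 ≤ ∫ θ in A.takersᶜ, φ (A.quality θ) * (A.quality θ - A.nullWage) ∂M.prior := by
  have := h.nullBelief_prob
  have h1 := integral_map (μ := M.prior.restrict A.takersᶜ) h.measurable_quality.aemeasurable
    (f := fun x : M.Quality => φ x * (x - A.nullWage))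
    ((hφ.measurable.comp measurable_subtype_coe).mul
      (measurable_subtype_coe.sub_const _)).aestronglyMeasurable
  rw [← h1, h.bayes_null, integral_smul_measure]
  exact smul_nonneg ENNReal.toReal_nonneg (integral_mul_sub_mean_nonneg A.nullBelief hφ)

theorem IsEquilibrium.measurable_typeWage (h : A.IsEquilibrium) : Measurable A.typeWage := by
  have := h.belief_markov
  exact Measurable.ite h.measurable_takers (A.measurable_interimWage.comp h.measurable_quality)
    measurable_const

theorem IsEquilibrium.typeWage_mem (h : A.IsEquilibrium) (θ : ℝ) :
    A.typeWage θ ∈ Icc 0 M.qmax := by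
  have := h.belief_markov
  have := h.nullBelief_prob
  unfold typeWage
  split_ifs
  · exact A.interimWage_mem _
  · exact integral_quality_mem _

/-- Wages are a mean-preserving contraction of qualities. -/
theorem IsEquilibrium.integral_mono_mul_nonneg (h : A.IsEquilibrium) {φ : ℝ → ℝ}
    (hφ : Monotone φ) :
    0 ≤ ∫ θ, φ (A.quality θ) * (A.quality θ - A.typeWage θ) ∂M.prior := by
  have := h.belief_markov
  have hm : Measurable fun θ => φ (A.quality θ) * (A.quality θ - A.typeWage θ) :=
    (hφ.measurable.comp (measurable_subtype_coe.comp h.measurable_quality)).mul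
      ((measurable_subtype_coe.comp h.measurable_quality).sub h.measurable_typeWage)
  have hi : Integrable (fun θ => φ (A.quality θ) * (A.quality θ - A.typeWage θ)) M.prior :=
    Integrable.of_bound hm.aestronglyMeasurable _
      (Eventually.of_forall fun θ => abs_mul_sub_le hφ _ (h.typeWage_mem θ))
  rw [← integral_add_compl h.measurable_takers hi]
  refine add_nonneg ?_ ?_
  · have h1 := integral_map (μ := M.prior.restrict A.takers) h.measurable_quality.aemeasurable
      (f := fun x : M.Quality => φ x * (x - A.interimWage x))
      ((hφ.measurable.comp measurable_subtype_coe).mul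
        (measurable_subtype_coe.sub A.measurable_interimWage)).aestronglyMeasurable
    have h2 := h.integral_taker_nonneg hφ
    rw [takerQuality, h1] at h2
    refine h2.trans_eq (setIntegral_congr_fun h.measurable_takers fun θ hθ => ?_)
    simp [typeWage, hθ]
  · refine (h.integral_decline_nonneg hφ).trans_eq
      (setIntegral_congr_fun h.measurable_takers.compl fun θ hθ => ?_)
    have : θ ∉ A.takers := hθ
    simp [typeWage, this]

theorem _root_.RatingModel.integral_prior_indicator_Ioi {t : ℝ} (ht : t ∈ M.types) {g : ℝ → ℝ}
    (hg : IntervalIntegrable g volume M.θl M.θh) :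
    ∫ θ, (Ioi t).indicator g θ ∂M.prior = ∫ θ in t..M.θh, M.f θ * g θ := by
  have hl : M.θl ∈ M.types := left_mem_Icc.2 M.θl_lt_θh.le
  have hh : M.θh ∈ M.types := right_mem_Icc.2 M.θl_lt_θh.le
  have hg' : IntervalIntegrable ((Ioi t).indicator g) volume M.θl M.θh := by
    rw [intervalIntegrable_iff] at hg ⊢
    exact hg.indicator measurableSet_Ioi
  have hi := density_mul_intervalIntegrable hl hh hg'
  rw [M.integral_prior, ← intervalIntegral.integral_add_adjacent_intervals
    (hi.mono_set (uIcc_subset_uIcc left_mem_uIcc (Icc_subset_uIcc ht)))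
    (hi.mono_set (uIcc_subset_uIcc (Icc_subset_uIcc ht) right_mem_uIcc))]
  rw [intervalIntegral.integral_of_le ht.1, intervalIntegral.integral_of_le ht.2,
    intervalIntegral.integral_of_le ht.2]
  have h1 : ∫ θ in Ioc M.θl t, M.f θ * (Ioi t).indicator g θ = ∫ θ in Ioc M.θl t, 0 := by
    refine setIntegral_congr_fun measurableSet_Ioc fun θ hθ => ?_
    rw [indicator_of_notMem (by simpa using hθ.2), mul_zero]
  have h2 : ∫ θ in Ioc t M.θh, M.f θ * (Ioi t).indicator g θ = ∫ θ in Ioc t M.θh, M.f θ * g θ := by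
    refine setIntegral_congr_fun measurableSet_Ioc fun θ hθ => ?_
    rw [indicator_of_mem (by exact hθ.1)]
  rw [h1, h2, integral_zero, zero_add]

theorem IsEquilibrium.integrable_of_monotone (h : A.IsEquilibrium) {φ : ℝ → ℝ}
    (hφ : Monotone φ) :
    Integrable (fun θ => φ (A.quality θ) * (A.quality θ - A.typeWage θ)) M.prior :=
  Integrable.of_bound ((hφ.measurable.comp (measurable_subtype_coe.comp h.measurable_quality)).mul
      ((measurable_subtype_coe.comp h.measurable_quality).sub
        h.measurable_typeWage)).aestronglyMeasurable _
      (Eventually.of_forall fun _ => abs_mul_sub_le hφ _ (h.typeWage_mem _))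

/-- The tail inequality at `t` comes from the contraction inequality with an indicator of high
qualities. Types with the same quality as `t` may lie on both sides of `t`, so the indicator must
include or exclude this whole block, whichever gives the lower bound. -/
theorem IsEquilibrium.feasible (h : A.IsEquilibrium) :
    M.Feasible (fun θ => A.quality θ) A.typeWage := by
  have hI := h.implementable
  have hl : M.θl ∈ M.types := left_mem_Icc.2 M.θl_lt_θh.le
  have hh : M.θh ∈ M.types := right_mem_Icc.2 M.θl_lt_θh.le
  have hbal : ∫ θ in M.θl..M.θh, M.f θ * (A.quality θ - A.typeWage θ) = 0 := by
    rw [← M.integral_prior]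
    have h1 := h.integral_mono_mul_nonneg (φ := fun _ => 1) monotone_const
    have h2 := h.integral_mono_mul_nonneg (φ := fun _ => -1) monotone_const
    simp only [one_mul, neg_mul, integral_neg] at h1 h2
    linarith
  refine ⟨hI, hbal, fun t ht => ?_⟩
  -- `wage_eq` needs positive types; `t = 0` can only be the lowest type, whose tail is the whole
  -- interval.
  rcases (M.θl_nonneg.trans ht.1).eq_or_lt with h0 | h0
  · have : t = M.θl := le_antisymm (h0 ▸ M.θl_nonneg) ht.1
    rw [this, hbal]
  have hii : IntervalIntegrable (fun θ => (A.quality θ : ℝ) - A.typeWage θ) volume M.θl M.θh :=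
    (hI.quality_intervalIntegrable hl hh).sub (hI.wage_intervalIntegrable hl hh)
  rw [← integral_prior_indicator_Ioi ht hii]
  have hint : Integrable ((Ioi t).indicator fun θ => (A.quality θ : ℝ) - A.typeWage θ) M.prior := by
    refine Integrable.indicator ?_ measurableSet_Ioi
    simpa using h.integrable_of_monotone (φ := fun _ => 1) monotone_const
  have hpos : ∀ᵐ θ ∂M.prior, θ ∈ M.types ∧ 0 < θ := by
    have h1 : ∀ᵐ θ : ℝ, θ ≠ 0 := by simp [ae_iff]
    refine M.ae_prior_of_ae ?_
    filter_upwards [h1] with θ hθ hm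
    exact ⟨hm, lt_of_le_of_ne (M.θl_nonneg.trans hm.1) hθ.symm⟩
  obtain ⟨x, hx⟩ : ∃ x : ℝ, (A.quality t : ℝ) = x := ⟨_, rfl⟩
  -- Here the block at quality `x` contributes nonnegatively, so the tail beyond `t` has at least
  -- the integral over `{q > x}`.
  rcases le_total (A.typeWage t) x with hc | hc
  · have hφ : Monotone ((Ioi x).indicator fun _ => (1 : ℝ)) := by
      intro a b hab
      by_cases ha : x < a
      · simp [ha, ha.trans_le hab]
      · by_cases hb : x < b <;> simp [ha, hb]
    refine (h.integral_mono_mul_nonneg hφ).trans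
      (integral_mono_ae (h.integrable_of_monotone hφ) hint ?_)
    filter_upwards [hpos] with θ hθ
    by_cases hq : x < A.quality θ
    · have : t < θ := by
        by_contra! hle
        exact absurd (hI.quality_mono hθ.1 ht hle) (not_le.2 (hx ▸ hq))
      simp [hq, this]
    · by_cases hlt : t < θ
      · have he : (A.quality θ : ℝ) = x :=
          le_antisymm (not_lt.1 hq) (hx ▸ hI.quality_mono ht hθ.1 hlt.le)
        have hw := hI.wage_eq hθ.1 ht hθ.2 h0 (he.trans hx.symm)
        simp only [mem_Ioi, hlt, indicator_of_mem, hw, he]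
        simpa using hc
      · simp [hq, hlt]
  -- Here the block contributes nonpositively, so dropping its part below `t` from `{q ≥ x}` can
  -- only raise the integral.
  · have hφ : Monotone ((Ici x).indicator fun _ => (1 : ℝ)) := by
      intro a b hab
      by_cases ha : x ≤ a
      · simp [ha, ha.trans hab]
      · by_cases hb : x ≤ b <;> simp [ha, hb]
    refine (h.integral_mono_mul_nonneg hφ).trans
      (integral_mono_ae (h.integrable_of_monotone hφ) hint ?_)
    filter_upwards [hpos] with θ hθ
    by_cases hlt : t < θ
    · have : x ≤ A.quality θ := hx ▸ hI.quality_mono ht hθ.1 hlt.le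
      simp [hlt, this]
    · by_cases hq : x ≤ A.quality θ
      · have he : (A.quality θ : ℝ) = x :=
          le_antisymm (hx ▸ hI.quality_mono hθ.1 ht (not_lt.1 hlt)) hq
        have hw := hI.wage_eq hθ.1 ht hθ.2 h0 (he.trans hx.symm)
        simp only [mem_Ici, hlt, mem_Ioi, not_false_eq_true, indicator_of_notMem, hw, he, le_refl,
          indicator_of_mem, one_mul]
        linarith
      · simp [hq, hlt]

theorem expectedQuality_eq (A : M.Assessment R) :
    A.expectedQuality = ∫ θ in M.θl..M.θh, M.f θ * A.quality θ := M.integral_prior _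

end Assessment

end RatingModel

namespace RatingModel

variable {M : RatingModel}

/-! ### The envelope formula -/

variable (M) in
/-- The indirect utility under the allocation `(q, w)`. -/
def utility (q w : ℝ → ℝ) (θ : ℝ) : ℝ := θ * w θ - M.c (q θ)

theorem left_mem_types : M.θl ∈ M.types := left_mem_Icc.2 M.θl_lt_θh.le

theorem right_mem_types : M.θh ∈ M.types := right_mem_Icc.2 M.θl_lt_θh.le

theorem Implementable.subgradient {q w : ℝ → ℝ} (h : M.Implementable q w) {θ θ' : ℝ}
    (hθ : θ ∈ M.types) (hθ' : θ' ∈ M.types) :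
    w θ * (θ' - θ) ≤ M.utility q w θ' - M.utility q w θ := by
  have := h.ic θ' hθ' θ hθ
  unfold utility
  linarith

theorem Implementable.abs_wage_le {q w : ℝ → ℝ} (h : M.Implementable q w) {θ : ℝ}
    (hθ : θ ∈ M.types) : |w θ| ≤ |w M.θl| + |w M.θh| := by
  have h1 := h.wage_mono left_mem_types hθ hθ.1
  have h2 := h.wage_mono hθ right_mem_types hθ.2
  rw [abs_le]
  constructor
  · have := neg_abs_le (w M.θl); have := abs_nonneg (w M.θh); linarith
  · have := le_abs_self (w M.θh); have := abs_nonneg (w M.θl); linarith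

/-- Neither `q` nor `w` need be continuous: `w` is a bounded subgradient of the utility, which is
therefore Lipschitz. -/
theorem Implementable.utility_continuousOn {q w : ℝ → ℝ} (h : M.Implementable q w) :
    ContinuousOn (M.utility q w) M.types := by
  have hlip : LipschitzOnWith (|w M.θl| + |w M.θh|).toNNReal (M.utility q w) M.types := by
    refine LipschitzOnWith.of_dist_le_mul fun x hx y hy => ?_
    rw [Real.dist_eq, Real.dist_eq, Real.coe_toNNReal _ (by positivity), abs_le]
    have h1 := h.subgradient hx hy
    have h2 := h.subgradient hy hx
    have h3 : ∀ z ∈ M.types, |w z * (x - y)| ≤ (|w M.θl| + |w M.θh|) * |x - y| := fun z hz => by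
      rw [abs_mul]; gcongr; exact h.abs_wage_le hz
    have h4 := abs_le.1 (h3 x hx)
    have h5 := abs_le.1 (h3 y hy)
    constructor <;> linarith
  exact hlip.continuousOn

/-- The monotone function `w` has countably many jumps. Where it is continuous, the linearization
error of the utility lies between `0` and `(w θ' - w θ) * (θ' - θ)`. -/
theorem Implementable.exists_countable_hasDerivAt {q w : ℝ → ℝ} (h : M.Implementable q w) :
    ∃ s : Set ℝ, s.Countable ∧ ∀ θ ∈ Ioo M.θl M.θh \ s, HasDerivAt (M.utility q w) (w θ) θ := by
  refine ⟨_, h.wage_mono.countable_not_continuousWithinAt, fun θ hθ => ?_⟩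
  have hm : θ ∈ M.types := Ioo_subset_Icc_self hθ.1
  have hnhds : M.types ∈ 𝓝 θ := Icc_mem_nhds hθ.1.1 hθ.1.2
  have hc : ContinuousAt w θ := by
    have : ContinuousWithinAt w M.types θ := by
      by_contra hcon
      exact hθ.2 ⟨hm, hcon⟩
    exact this.continuousAt hnhds
  rw [hasDerivAt_iff_isLittleO]
  have h0 : Tendsto (fun θ' => w θ' - w θ) (𝓝 θ) (𝓝 0) := by
    simpa using hc.tendsto.sub_const (w θ)
  have h1 := ((Asymptotics.isLittleO_one_iff ℝ).2 h0).mul_isBigO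
    (Asymptotics.isBigO_refl (fun θ' => θ' - θ) (𝓝 θ))
  simp only [one_mul] at h1
  refine (Asymptotics.IsBigO.of_bound 1 ?_).trans_isLittleO h1
  filter_upwards [hnhds] with θ' hθ'
  have h2 := h.subgradient hm hθ'
  have h3 := h.subgradient hθ' hm
  rw [one_mul, Real.norm_eq_abs, Real.norm_eq_abs, smul_eq_mul, abs_of_nonneg (by linarith)]
  refine le_trans ?_ (le_abs_self _)
  linarith

theorem Implementable.integral_wage {q w : ℝ → ℝ} (h : M.Implementable q w) :
    ∫ θ in M.θl..M.θh, w θ = M.utility q w M.θh - M.utility q w M.θl := by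
  obtain ⟨s, hs, hd⟩ := h.exists_countable_hasDerivAt
  exact integral_eq_of_hasDerivAt_off_countable_of_le _ _ M.θl_lt_θh.le hs
    h.utility_continuousOn hd (h.wage_intervalIntegrable left_mem_types right_mem_types)

/-! ### Pass/fail tests are best when the density is increasing -/

variable (M) in
open Classical in
/-- The quality of type `θ` when only quality `x` is rewarded, by the wage `x`. -/
def passQuality (x θ : ℝ) : ℝ := if M.c x ≤ θ * x then x else 0

theorem density_integral_pos {t : ℝ} (ht : t ∈ M.types) (h : t < M.θh) :
    0 < ∫ θ in t..M.θh, M.f θ :=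
  intervalIntegral.intervalIntegral_pos_of_pos_on
    ((M.f_cont.mono (uIcc_subset_Icc ht right_mem_types)).intervalIntegrable)
    (fun θ hθ => M.f_pos θ ⟨ht.1.trans hθ.1.le, hθ.2.le⟩) h

theorem measurable_passQuality (x : ℝ) : Measurable (M.passQuality x) :=
  Measurable.ite (measurableSet_le measurable_const (measurable_id.mul_const x)) measurable_const
    measurable_const

theorem abs_passQuality_le {x : ℝ} (hx : x ∈ Icc 0 M.qmax) (θ : ℝ) :
    |M.passQuality x θ| ≤ x := by
  unfold passQuality
  split_ifs
  · rw [abs_of_nonneg hx.1]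
  · simpa using hx.1

theorem passQuality_intervalIntegrable {x : ℝ} (hx : x ∈ Icc 0 M.qmax) (s t : ℝ) :
    IntervalIntegrable (M.passQuality x) volume s t := by
  refine IntervalIntegrable.mono_fun (g := M.passQuality x) (f := fun _ => x)
    intervalIntegrable_const (measurable_passQuality x).aestronglyMeasurable
    (Eventually.of_forall fun θ => ?_)
  simp only [Real.norm_eq_abs, abs_of_nonneg hx.1]
  exact abs_passQuality_le hx θ

theorem Implementable.wage_nonneg {q w : ℝ → ℝ} (h : M.Implementable q w) {θ : ℝ}
    (hθ : θ ∈ M.types) (h0 : 0 < θ) : 0 ≤ w θ := by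
  have h1 := h.ir θ hθ
  have h2 := M.cost_nonneg (h.mem θ hθ)
  exact nonneg_of_mul_nonneg_right (by linarith : 0 ≤ θ * w θ) h0

theorem Implementable.integral_wage_eq {q w : ℝ → ℝ} (h : M.Implementable q w)
    (h1 : ∫ θ in M.θl..M.θh, M.f θ * (q θ - w θ) = 0) :
    ∫ θ in M.θl..M.θh, M.f θ * q θ = ∫ θ in M.θl..M.θh, M.f θ * w θ := by
  simp only [mul_sub] at h1
  rw [intervalIntegral.integral_sub
    (density_mul_intervalIntegrable left_mem_types right_mem_types
      (h.quality_intervalIntegrable left_mem_types right_mem_types))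
    (density_mul_intervalIntegrable left_mem_types right_mem_types
      (h.wage_intervalIntegrable left_mem_types right_mem_types))] at h1
  linarith

/-- If `w t` exceeded `y`, so would all wages above `t`, and the tail inequality at `t` would fail.
Here `t < θh` gives the tail positive mass. -/
theorem Feasible.wage_le {q w : ℝ → ℝ} (h : M.Feasible q w) {t y : ℝ} (ht : t ∈ Ico M.θl M.θh)
    (hy : ∀ θ ∈ Ioo M.θl M.θh, q θ ≤ y) : w t ≤ y := by
  have htm : t ∈ M.types := Ico_subset_Icc_self ht
  by_contra! hlt
  have h1 := h.major t htm
  have h2 : ∫ θ in t..M.θh, M.f θ * (q θ - w θ) ≤ ∫ θ in t..M.θh, M.f θ * (y - w t) := by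
    refine intervalIntegral.integral_mono_on_of_le_Ioo ht.2.le
      (density_mul_intervalIntegrable htm right_mem_types
        ((h.quality_intervalIntegrable htm right_mem_types).sub
          (h.wage_intervalIntegrable htm right_mem_types)))
      (density_mul_intervalIntegrable htm right_mem_types intervalIntegrable_const)
      fun θ hθ => ?_
    have hθm : θ ∈ M.types := ⟨ht.1.trans hθ.1.le, hθ.2.le⟩
    refine mul_le_mul_of_nonneg_left ?_ (M.f_pos θ hθm).le
    have := hy θ ⟨ht.1.trans_lt hθ.1, hθ.2⟩
    have := h.wage_mono htm hθm hθ.1.le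
    linarith
  rw [intervalIntegral.integral_mul_const] at h2
  have h3 := density_integral_pos htm ht.2
  nlinarith

/-- The limits of wage and quality at the highest type. -/
theorem Feasible.exists_top {q w : ℝ → ℝ} (h : M.Feasible q w) :
    ∃ w₁ ∈ Icc 0 M.qmax, (∀ θ ∈ Ioo M.θl M.θh, w θ ≤ w₁) ∧
      M.c w₁ + M.utility q w M.θh ≤ M.θh * w₁ := by
  have hne : (Ioo M.θl M.θh).Nonempty := nonempty_Ioo.2 M.θl_lt_θh
  have hsub : Ioo M.θl M.θh ⊆ M.types := Ioo_subset_Icc_self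
  have hqb : BddAbove (q '' Ioo M.θl M.θh) :=
    ⟨M.qmax, by rintro _ ⟨θ, hθ, rfl⟩; exact (h.mem θ (hsub hθ)).2⟩
  have hwb : BddAbove (w '' Ioo M.θl M.θh) :=
    ⟨w M.θh, by rintro _ ⟨θ, hθ, rfl⟩; exact h.wage_mono (hsub hθ) right_mem_types hθ.2.le⟩
  -- Left limits replace the values at `θh`, a null type about which the tail inequalities say
  -- nothing.
  have hqt := (h.quality_mono.mono hsub).tendsto_nhdsWithin_Ioo_left hne hqb
  have hwt := (h.wage_mono.mono hsub).tendsto_nhdsWithin_Ioo_left hne hwb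
  set q₁ := sSup (q '' Ioo M.θl M.θh)
  set w₁ := sSup (w '' Ioo M.θl M.θh)
  have hq1 : ∀ θ ∈ Ioo M.θl M.θh, q θ ≤ q₁ := fun θ hθ => le_csSup hqb ⟨θ, hθ, rfl⟩
  have hw1 : ∀ θ ∈ Ioo M.θl M.θh, w θ ≤ w₁ := fun θ hθ => le_csSup hwb ⟨θ, hθ, rfl⟩
  have hwq : w₁ ≤ q₁ := by
    refine csSup_le (hne.image _) ?_
    rintro _ ⟨θ, hθ, rfl⟩
    exact h.wage_le (Ioo_subset_Ico_self hθ) hq1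
  have hq1m : q₁ ∈ Icc 0 M.qmax := by
    obtain ⟨θ, hθ⟩ := hne
    refine ⟨(h.mem θ (hsub hθ)).1.trans (hq1 θ hθ), csSup_le (⟨_, θ, hθ, rfl⟩) ?_⟩
    rintro _ ⟨θ, hθ, rfl⟩
    exact (h.mem θ (hsub hθ)).2
  have hw1m : w₁ ∈ Icc 0 M.qmax := by
    obtain ⟨θ, hθ⟩ := hne
    exact ⟨(h.wage_nonneg (hsub hθ) (M.θl_nonneg.trans_lt hθ.1)).trans (hw1 θ hθ),
      hwq.trans hq1m.2⟩
  refine ⟨w₁, hw1m, hw1, ?_⟩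
  have hmem : ∀ᶠ θ in 𝓝[<] M.θh, θ ∈ Ioo M.θl M.θh := Ioo_mem_nhdsLT M.θl_lt_θh
  have hct : Tendsto (fun θ => M.c (q θ)) (𝓝[<] M.θh) (𝓝 (M.c q₁)) := by
    refine (M.cost_continuousOn q₁ hq1m).tendsto.comp (tendsto_nhdsWithin_iff.2 ⟨hqt, ?_⟩)
    filter_upwards [hmem] with θ hθ using h.mem θ (hsub hθ)
  have hUt : Tendsto (M.utility q w) (𝓝[<] M.θh) (𝓝 (M.utility q w M.θh)) := by
    refine (h.utility_continuousOn _ right_mem_types).tendsto.mono_left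
      (nhdsWithin_le_of_mem ?_)
    filter_upwards [hmem] with θ hθ using hsub hθ
  have hid : Tendsto (fun θ : ℝ => θ) (𝓝[<] M.θh) (𝓝 M.θh) := tendsto_id.mono_left nhdsWithin_le_nhds
  -- The limit identity is `c q₁ + U θh = θh * w₁`; since `w₁ ≤ q₁`, the cost of `q₁` may be
  -- replaced by that of `w₁`.
  have hlim := tendsto_nhds_unique (hct.add hUt) ((hid.mul hwt).congr fun θ => by
    unfold utility; ring)
  have := M.cost_strictMonoOn.monotoneOn hw1m hq1m hwq
  linarith

theorem Feasible.expected_le_passQuality {q w : ℝ → ℝ} (h : M.Feasible q w)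
    (hf : MonotoneOn M.f M.types) :
    ∃ x ∈ Icc 0 M.qmax,
      ∫ θ in M.θl..M.θh, M.f θ * q θ ≤ ∫ θ in M.θl..M.θh, M.f θ * M.passQuality x θ := by
  obtain ⟨x, hx, hwx, hcx⟩ := h.exists_top
  refine ⟨x, hx, ?_⟩
  rw [h.integral_wage_eq h.balance]
  have hwi := h.wage_intervalIntegrable left_mem_types right_mem_types
  have hgi := passQuality_intervalIntegrable (M := M) hx M.θl M.θh
  have hint := h.integral_wage
  have hul : 0 ≤ M.utility q w M.θl := h.ir _ left_mem_types
  rcases hx.1.eq_or_lt with h0 | h0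
  · refine intervalIntegral.integral_mono_on_of_le_Ioo M.θl_lt_θh.le
      (density_mul_intervalIntegrable left_mem_types right_mem_types hwi)
      (density_mul_intervalIntegrable left_mem_types right_mem_types hgi) fun θ hθ => ?_
    have h1 := hwx θ hθ
    have h2 := M.f_pos θ (Ioo_subset_Icc_self hθ)
    have h3 : M.passQuality x θ = 0 := by simp [passQuality, ← h0]
    rw [h3]
    nlinarith

  -- The lowest type that passes the standard `x`.
  set s := max M.θl (M.c x / x) with hs
  have hcθ : M.c x ≤ M.θh * x := by
    have : 0 ≤ M.utility q w M.θh := h.ir _ right_mem_types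
    linarith
  have hsm : s ∈ M.types := ⟨le_max_left _ _, max_le M.θl_lt_θh.le ((div_le_iff₀ h0).2 hcθ)⟩
  have hge : ∀ θ ∈ Ioo M.θl M.θh, s ≤ θ → M.passQuality x θ = x := fun θ _ hθ => by
    have : M.c x ≤ θ * x := (div_le_iff₀ h0).1 ((le_max_right _ _).trans hθ)
    simp [passQuality, this]
  have hlt : ∀ θ ∈ Ioo M.θl M.θh, θ < s → M.passQuality x θ = 0 := fun θ hθ hθs => by
    have h1 : θ < M.c x / x := by
      rcases lt_max_iff.1 hθs with h1 | h1
      · exact absurd h1 (not_lt.2 hθ.1.le)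
      · exact h1
    have : ¬ M.c x ≤ θ * x := not_le.2 ((lt_div_iff₀ h0).1 h1)
    simp [passQuality, this]
  have hpass : ∫ θ in M.θl..M.θh, M.passQuality x θ = x * (M.θh - s) := by
    rw [← intervalIntegral.integral_add_adjacent_intervals (b := s)
      (passQuality_intervalIntegrable hx _ _) (passQuality_intervalIntegrable hx _ _)]
    have h1 : ∫ θ in M.θl..s, M.passQuality x θ = ∫ θ in M.θl..s, (0 : ℝ) := by
      rw [intervalIntegral.integral_of_le hsm.1, intervalIntegral.integral_of_le hsm.1,
        integral_Ioc_eq_integral_Ioo, integral_Ioc_eq_integral_Ioo]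
      exact setIntegral_congr_fun measurableSet_Ioo fun θ hθ =>
        hlt θ ⟨hθ.1, hθ.2.trans_le hsm.2⟩ hθ.2
    have h2 : ∫ θ in s..M.θh, M.passQuality x θ = ∫ θ in s..M.θh, x := by
      rw [intervalIntegral.integral_of_le hsm.2, intervalIntegral.integral_of_le hsm.2,
        integral_Ioc_eq_integral_Ioo, integral_Ioc_eq_integral_Ioo]
      exact setIntegral_congr_fun measurableSet_Ioo fun θ hθ =>
        hge θ ⟨hsm.1.trans_lt hθ.1, hθ.2⟩ hθ.1.le
    rw [h1, h2]
    simp [mul_comm]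
  -- If all types pass, `w ≤ x` suffices. Otherwise the step function integrates to `θh * x - c x`,
  -- which bounds `U θh` and hence `∫ w = U θh - U θl`.
  have hbase : 0 ≤ ∫ θ in M.θl..M.θh, (M.passQuality x θ - w θ) := by
    rw [intervalIntegral.integral_sub hgi hwi, hpass, hint]
    rcases max_cases M.θl (M.c x / x) with ⟨h1, _⟩ | ⟨h1, _⟩
    · rw [hs, h1, ← hint]
      have : ∫ θ in M.θl..M.θh, w θ ≤ ∫ θ in M.θl..M.θh, x :=
        intervalIntegral.integral_mono_on_of_le_Ioo M.θl_lt_θh.le hwi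
          intervalIntegrable_const hwx
      rw [intervalIntegral.integral_const, smul_eq_mul] at this
      linarith
    · rw [hs, h1, mul_sub, mul_div_cancel₀ _ h0.ne']
      linarith
  -- Single crossing: the difference is nonpositive below `s`, where `f ≤ f s`, and nonnegative
  -- above, where `f ≥ f s`.
  have hcross : ∫ θ in M.θl..M.θh, M.f s * (M.passQuality x θ - w θ) ≤
      ∫ θ in M.θl..M.θh, M.f θ * (M.passQuality x θ - w θ) := by
    refine intervalIntegral.integral_mono_on_of_le_Ioo M.θl_lt_θh.le
      ((hgi.sub hwi).const_mul _)
      (density_mul_intervalIntegrable left_mem_types right_mem_types (hgi.sub hwi))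
      fun θ hθ => ?_
    have hθm : θ ∈ M.types := Ioo_subset_Icc_self hθ
    rcases le_or_gt s θ with hle | hgt
    · rw [hge θ hθ hle]
      exact mul_le_mul_of_nonneg_right (hf hsm hθm hle) (sub_nonneg.2 (hwx θ hθ))
    · rw [hlt θ hθ hgt]
      have h1 := h.wage_nonneg hθm (M.θl_nonneg.trans_lt hθ.1)
      have h2 := hf hθm hsm hgt.le
      nlinarith
  rw [intervalIntegral.integral_const_mul] at hcross
  have hnn := (mul_nonneg (M.f_pos s hsm).le hbase).trans hcross
  simp only [mul_sub] at hnn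
  rw [intervalIntegral.integral_sub
    (density_mul_intervalIntegrable left_mem_types right_mem_types hgi)
    (density_mul_intervalIntegrable left_mem_types right_mem_types hwi)] at hnn
  linarith

variable (M) in
-- For fixed `θ`, passing is discontinuous in the standard `x > 0` only if `θ = c x / x`, a null
-- event. Dominated convergence then gives continuity on a compact set; at `x = 0` the bound
-- `passQuality y θ ≤ y` takes over.
theorem exists_best_passQuality :
    ∃ x ∈ Icc 0 M.qmax, ∀ y ∈ Icc 0 M.qmax,
      ∫ θ in M.θl..M.θh, M.f θ * M.passQuality y θ ≤
        ∫ θ in M.θl..M.θh, M.f θ * M.passQuality x θ := by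
  simp only [← M.integral_prior]
  suffices hcont : ContinuousOn (fun x => ∫ θ, M.passQuality x θ ∂M.prior) (Icc 0 M.qmax) from
    isCompact_Icc.exists_isMaxOn (nonempty_Icc.2 M.qmax_pos.le) hcont
  intro x hx
  refine continuousWithinAt_of_dominated (bound := fun _ => M.qmax)
    (Eventually.of_forall fun y => (measurable_passQuality y).aestronglyMeasurable) ?_
    (integrable_const _) ?_
  · filter_upwards [self_mem_nhdsWithin] with y hy
    exact Eventually.of_forall fun θ => (abs_passQuality_le hy θ).trans hy.2
  · have hne : ∀ᵐ θ : ℝ, θ ≠ M.c x / x := by simp [ae_iff]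
    refine M.ae_prior_of_ae ?_
    filter_upwards [hne] with θ hθ _
    rcases hx.1.eq_or_lt with h0 | h0
    · have h1 : M.passQuality x θ = 0 := by simp [passQuality, ← h0]
      rw [ContinuousWithinAt, h1]
      refine squeeze_zero_norm' (a := fun y => y) ?_ ?_
      · filter_upwards [self_mem_nhdsWithin] with y hy using abs_passQuality_le hy θ
      · rw [← h0]; exact tendsto_id.mono_left nhdsWithin_le_nhds
    · have hc := M.cost_continuousOn x hx
      have hm : ContinuousWithinAt (fun y => θ * y) (Icc 0 M.qmax) x :=
        (continuous_const.mul continuous_id).continuousWithinAt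
      rw [ne_eq, eq_div_iff h0.ne'] at hθ
      rcases lt_or_gt_of_ne hθ with hlt | hlt
      · refine (continuousWithinAt_const (b := (0 : ℝ))).congr_of_eventuallyEq
          ?_ (by simp [passQuality, not_le.2 hlt])
        filter_upwards [hm.tendsto.eventually_lt hc.tendsto hlt] with y hy
        simp [passQuality, not_le.2 hy]
      · refine continuousWithinAt_id.congr_of_eventuallyEq
          ?_ (by simp [passQuality, hlt.le])
        filter_upwards [hc.tendsto.eventually_lt hm.tendsto hlt] with y hy
        simp [passQuality, hy.le]

end RatingModel

/-! ### Stochastic dominance -/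

theorem MonotoneOn.exists_superlevel_ae_eq {a b : ℝ} (hab : a ≤ b) {φ : ℝ → ℝ}
    (hφ : MonotoneOn φ (Ioo a b)) (k : ℝ) :
    ∃ t ∈ Icc a b, ({x | k < φ x} ∩ Ioo a b : Set ℝ) =ᵐ[volume] Ioo t b := by
  set U : Set ℝ := {x | k < φ x} ∩ Ioo a b with hU
  rcases U.eq_empty_or_nonempty with he | hne
  · exact ⟨b, right_mem_Icc.2 hab, by rw [he, Ioo_self]; exact EventuallyEq.rfl⟩
  have hbdd : BddBelow U := ⟨a, fun x hx => hx.2.1.le⟩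
  have hlb : a ≤ sInf U := le_csInf hne fun x hx => hx.2.1.le
  refine ⟨sInf U, ⟨hlb, ?_⟩, ?_⟩
  · obtain ⟨x, hx⟩ := hne
    exact (csInf_le hbdd hx).trans hx.2.2.le
  · refine EventuallyLE.antisymm ?_ ?_
    · have h1 : U ≤ᵐ[volume] Icc (sInf U) b :=
        (show U ⊆ Icc (sInf U) b from
          fun x hx => ⟨csInf_le hbdd hx, hx.2.2.le⟩).eventuallyLE
      exact h1.trans Ioo_ae_eq_Icc.symm.le
    · refine (show Ioo (sInf U) b ⊆ U from fun x hx => ?_).eventuallyLE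
      obtain ⟨y, hy, hyx⟩ := exists_lt_of_csInf_lt hne hx.1
      have hxm : x ∈ Ioo a b := ⟨hlb.trans_lt hx.1, hx.2⟩
      exact ⟨hy.1.trans_le (hφ hy.2 hxm hyx.le), hxm⟩

/-- If the tails of `u` dominate the tails of `v`, then `u` gives a larger weight to every
increasing function. -/
theorem MonotoneOn.integral_mul_le_of_tails {a b : ℝ} (hab : a ≤ b) {φ u v : ℝ → ℝ}
    (hφ : MonotoneOn φ (Ioo a b)) (hφ0 : ∀ x ∈ Ioo a b, 0 ≤ φ x)
    (hu0 : ∀ x ∈ Ioo a b, 0 ≤ u x) (hv0 : ∀ x ∈ Ioo a b, 0 ≤ v x)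
    (hu : IntegrableOn u (Ioo a b)) (hv : IntegrableOn v (Ioo a b))
    (hφu : IntegrableOn (fun x => φ x * u x) (Ioo a b))
    (hφv : IntegrableOn (fun x => φ x * v x) (Ioo a b))
    (htail : ∀ t ∈ Icc a b, ∫ x in Ioo t b, v x ≤ ∫ x in Ioo t b, u x) :
    ∫ x in Ioo a b, φ x * v x ≤ ∫ x in Ioo a b, φ x * u x := by
  have hφm : AEMeasurable φ (volume.restrict (Ioo a b)) :=
    aemeasurable_restrict_of_monotoneOn measurableSet_Ioo hφ
  -- Layer cake: the integral of `φ` against the density `g` is the integral over levels `k` of the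
  -- `g`-mass of `{φ > k}`, and each such set is an upper tail up to a null set.
  have key : ∀ g : ℝ → ℝ, (∀ x ∈ Ioo a b, 0 ≤ g x) → IntegrableOn g (Ioo a b) →
      IntegrableOn (fun x => φ x * g x) (Ioo a b) →
      ENNReal.ofReal (∫ x in Ioo a b, φ x * g x) = ∫⁻ k in Ioi (0 : ℝ),
        ((volume.restrict (Ioo a b)).withDensity fun x => ENNReal.ofReal (g x)) {x | k < φ x} := by
    intro g hg0 hg hφg
    have hac := withDensity_absolutelyContinuous (volume.restrict (Ioo a b))
      (fun x => ENNReal.ofReal (g x))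
    rw [← lintegral_eq_lintegral_meas_lt _ (hac.ae_le ?_) (hφm.mono_ac hac),
      lintegral_withDensity_eq_lintegral_mul₀ hg.aemeasurable.ennreal_ofReal hφm.ennreal_ofReal,
      ofReal_integral_eq_lintegral_ofReal hφg]
    · refine setLIntegral_congr_fun measurableSet_Ioo fun x hx => ?_
      simp only [Pi.mul_apply]
      rw [ENNReal.ofReal_mul (hφ0 x hx), mul_comm]
    · exact (ae_restrict_iff' measurableSet_Ioo).2
        (Eventually.of_forall fun x hx => mul_nonneg (hφ0 x hx) (hg0 x hx))
    · exact (ae_restrict_iff' measurableSet_Ioo).2 (Eventually.of_forall hφ0)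
  have hle : ENNReal.ofReal (∫ x in Ioo a b, φ x * v x) ≤
      ENNReal.ofReal (∫ x in Ioo a b, φ x * u x) := by
    rw [key v hv0 hv hφv, key u hu0 hu hφu]
    refine lintegral_mono fun k => ?_
    obtain ⟨t, ht, hUt⟩ := hφ.exists_superlevel_ae_eq hab k
    have hmeas : ∀ g : ℝ → ℝ, (∀ x ∈ Ioo a b, 0 ≤ g x) → IntegrableOn g (Ioo a b) →
        ((volume.restrict (Ioo a b)).withDensity fun x => ENNReal.ofReal (g x)) {x | k < φ x} =
          ENNReal.ofReal (∫ x in Ioo t b, g x) := by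
      intro g hg0 hg
      have hsub : Ioo t b ⊆ Ioo a b := Ioo_subset_Ioo_left ht.1
      rw [withDensity_apply', Measure.restrict_restrict' measurableSet_Ioo,
        Measure.restrict_congr_set hUt, ofReal_integral_eq_lintegral_ofReal (hg.mono_set hsub)]
      exact (ae_restrict_iff' measurableSet_Ioo).2
        (Eventually.of_forall fun x hx => hg0 x (hsub hx))
    rw [hmeas v hv0 hv, hmeas u hu0 hu]
    exact ENNReal.ofReal_le_ofReal (htail t ht)
  refine (ENNReal.ofReal_le_ofReal_iff ?_).1 hle
  exact setIntegral_nonneg measurableSet_Ioo fun x hx => mul_nonneg (hφ0 x hx) (hu0 x hx)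

namespace RatingModel

variable {M : RatingModel}

/-! ### Comparison with full revelation -/

variable (M) in
/-- The efficient quality as a real-valued function. -/
def bestQ (θ : ℝ) : ℝ := M.bestQuality θ

theorem implementable_bestQ : M.Implementable M.bestQ M.bestQ where
  mem θ _ := (M.bestQuality θ).2
  ic θ _ θ' _ := M.le_bestQuality_surplus θ (M.bestQuality θ').2
  ir θ _ := M.bestQuality_surplus_nonneg θ

theorem le_utility_bestQ (θ : ℝ) {x : ℝ} (hx : x ∈ Icc 0 M.qmax) :
    θ * x - M.c x ≤ M.utility M.bestQ M.bestQ θ := M.le_bestQuality_surplus θ hx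

/-- Type zero ignores wages, so its utility is minus a cost, and participation makes it nonnegative.
This removes the lower boundary term in the integration by parts. -/
theorem Implementable.utility_left {q w : ℝ → ℝ} (h : M.Implementable q w) (h0 : M.θl = 0) :
    M.utility q w M.θl = 0 := by
  have h1 := h.ir _ left_mem_types
  have h2 := M.cost_nonneg (h.mem _ left_mem_types)
  unfold utility
  rw [h0, zero_mul] at *
  linarith

theorem hasDerivAt_density (hd : DifferentiableOn ℝ M.f (Ioo M.θl M.θh)) {θ : ℝ}
    (hθ : θ ∈ Ioo M.θl M.θh) : HasDerivAt M.f (deriv M.f θ) θ :=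
  ((hd θ hθ).differentiableAt (Ioo_mem_nhds hθ.1 hθ.2)).hasDerivAt

theorem deriv_density_nonpos (hf : AntitoneOn M.f M.types) {θ : ℝ}
    (hθ : θ ∈ Ioo M.θl M.θh) : deriv M.f θ ≤ 0 := by
  have h : AntitoneOn M.f (Ioo M.θl M.θh) := hf.mono Ioo_subset_Icc_self
  rw [← derivWithin_of_isOpen isOpen_Ioo hθ]
  exact h.derivWithin_nonpos

/-- The derivative exists only inside the interval and may be unbounded there; it is integrable
because it has constant sign and `f` is continuous up to the ends. -/
theorem deriv_density_intervalIntegrable (hf : AntitoneOn M.f M.types)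
    (hd : DifferentiableOn ℝ M.f (Ioo M.θl M.θh)) :
    IntervalIntegrable (fun θ => -deriv M.f θ) volume M.θl M.θh := by
  have hmm : Ioo (min M.θl M.θh) (max M.θl M.θh) = Ioo M.θl M.θh := by
    rw [min_eq_left M.θl_lt_θh.le, max_eq_right M.θl_lt_θh.le]
  refine intervalIntegral.intervalIntegrable_deriv_of_nonneg (g := fun θ => -M.f θ) ?_ ?_ ?_
  · rw [uIcc_of_le M.θl_lt_θh.le]; exact M.f_cont.neg
  · rw [hmm]; exact fun θ hθ => (hasDerivAt_density hd hθ).neg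
  · rw [hmm]; exact fun θ hθ => neg_nonneg.2 (deriv_density_nonpos hf hθ)

/-- The gain in expected quality, compared with full revelation, in terms of utilities. -/
theorem Implementable.expected_sub_bestQ {q w : ℝ → ℝ} (h : M.Implementable q w)
    (hbal : ∫ θ in M.θl..M.θh, M.f θ * (q θ - w θ) = 0)
    (hf : AntitoneOn M.f M.types) (hd : DifferentiableOn ℝ M.f (Ioo M.θl M.θh))
    (h0 : M.θl = 0) :
    (∫ θ in M.θl..M.θh, M.f θ * q θ) - ∫ θ in M.θl..M.θh, M.f θ * M.bestQ θ =
      M.f M.θh * (M.utility q w M.θh - M.utility M.bestQ M.bestQ M.θh) +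
        ∫ θ in M.θl..M.θh, -deriv M.f θ * (M.utility q w θ - M.utility M.bestQ M.bestQ θ) := by
  have hb := implementable_bestQ (M := M)
  obtain ⟨s, hs, hsd⟩ := h.exists_countable_hasDerivAt
  obtain ⟨s', hs', hsd'⟩ := hb.exists_countable_hasDerivAt
  set Δ : ℝ → ℝ := fun θ => M.utility q w θ - M.utility M.bestQ M.bestQ θ with hΔ
  have hΔc : ContinuousOn Δ M.types := h.utility_continuousOn.sub hb.utility_continuousOn
  have hi1 : IntervalIntegrable (fun θ => deriv M.f θ * Δ θ) volume M.θl M.θh := by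
    have h1 : IntervalIntegrable (fun θ => deriv M.f θ) volume M.θl M.θh := by
      simpa only [Pi.neg_def, neg_neg] using (deriv_density_intervalIntegrable hf hd).neg
    exact h1.mul_continuousOn (hΔc.mono (uIcc_subset_Icc left_mem_types right_mem_types))
  have hw := h.wage_intervalIntegrable left_mem_types right_mem_types
  have hq := hb.wage_intervalIntegrable left_mem_types right_mem_types
  have hi2 := density_mul_intervalIntegrable left_mem_types right_mem_types (hw.sub hq)
  -- Integration by parts for `f * Δ`, valid although `Δ` may fail to be differentiable at countably
  -- many types.
  have hFTC := integral_eq_of_hasDerivAt_off_countable_of_le (fun θ => M.f θ * Δ θ)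
    (fun θ => deriv M.f θ * Δ θ + M.f θ * (w θ - M.bestQ θ)) M.θl_lt_θh.le (hs.union hs')
    (M.f_cont.mul hΔc) (fun θ hθ => by
      have hn := hθ.2
      rw [mem_union, not_or] at hn
      exact (hasDerivAt_density hd hθ.1).mul
        ((hsd θ ⟨hθ.1, hn.1⟩).sub (hsd' θ ⟨hθ.1, hn.2⟩))) (hi1.add hi2)
  rw [intervalIntegral.integral_add hi1 hi2] at hFTC
  simp only [mul_sub] at hFTC
  rw [intervalIntegral.integral_sub
    (density_mul_intervalIntegrable left_mem_types right_mem_types hw)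
    (density_mul_intervalIntegrable left_mem_types right_mem_types hq)] at hFTC
  have hΔ0 : Δ M.θl = 0 := by simp [hΔ, h.utility_left h0, hb.utility_left h0]
  rw [hΔ0, mul_zero] at hFTC
  rw [h.integral_wage_eq hbal]
  simp only [neg_mul, intervalIntegral.integral_neg]
  linarith

theorem intervalIntegrable_mul_monotoneOn {g w : ℝ → ℝ} {C : ℝ}
    (hg : IntervalIntegrable g volume M.θl M.θh) (hw : MonotoneOn w M.types)
    (hC : ∀ θ ∈ M.types, |w θ| ≤ C) :
    IntervalIntegrable (fun θ => g θ * w θ) volume M.θl M.θh := by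
  rw [intervalIntegrable_iff_integrableOn_Icc_of_le M.θl_lt_θh.le] at hg ⊢
  exact hg.mul_bdd (aemeasurable_restrict_of_monotoneOn measurableSet_Icc hw).aestronglyMeasurable
    ((ae_restrict_iff' measurableSet_Icc).2 (Eventually.of_forall hC))

theorem Feasible.expected_le_bestQ {q w : ℝ → ℝ} (h : M.Feasible q w)
    (hf : AntitoneOn M.f M.types) (hd : DifferentiableOn ℝ M.f (Ioo M.θl M.θh))
    (he : AntitoneOn M.elasticity (Ioo M.θl M.θh)) (h0 : M.θl = 0) :
    ∫ θ in M.θl..M.θh, M.f θ * q θ ≤ ∫ θ in M.θl..M.θh, M.f θ * M.bestQ θ := by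
  have hb := implementable_bestQ (M := M)
  have hsub : Ioo M.θl M.θh ⊆ M.types := Ioo_subset_Icc_self
  have htop : M.utility q w M.θh - M.utility M.bestQ M.bestQ M.θh ≤ 0 := by
    obtain ⟨x, hx, -, hcx⟩ := h.exists_top
    have := M.le_utility_bestQ M.θh hx
    linarith
  have hfi := deriv_density_intervalIntegrable hf hd
  have hid : IntervalIntegrable (fun θ => -deriv M.f θ * θ) volume M.θl M.θh :=
    hfi.mul_continuousOn continuousOn_id
  have hw := h.wage_intervalIntegrable left_mem_types right_mem_types
  have hq := h.quality_intervalIntegrable left_mem_types right_mem_types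
  have hiw := intervalIntegrable_mul_monotoneOn hid h.wage_mono fun θ hθ => h.abs_wage_le hθ
  have hiq := intervalIntegrable_mul_monotoneOn (C := M.qmax) hid h.quality_mono fun θ hθ => by
    rw [abs_of_nonneg (h.mem θ hθ).1]; exact (h.mem θ hθ).2
  have h1 : ∫ θ in M.θl..M.θh, -deriv M.f θ * (M.utility q w θ - M.utility M.bestQ M.bestQ θ) ≤
      ∫ θ in M.θl..M.θh, (-deriv M.f θ * θ * w θ - -deriv M.f θ * θ * q θ) := by
    refine intervalIntegral.integral_mono_on_of_le_Ioo M.θl_lt_θh.le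
      (hfi.mul_continuousOn ((h.utility_continuousOn.sub hb.utility_continuousOn).mono
        (uIcc_subset_Icc left_mem_types right_mem_types))) (hiw.sub hiq) fun θ hθ => ?_
    -- Under full revelation `θ` could also choose `q θ` at the wage `q θ`; the cost terms then
    -- cancel.
    have hu : M.utility q w θ - M.utility M.bestQ M.bestQ θ ≤ θ * w θ - θ * q θ := by
      have := M.le_utility_bestQ θ (h.mem θ (hsub hθ))
      unfold utility at *
      linarith
    have := mul_le_mul_of_nonneg_left hu (neg_nonneg.2 (deriv_density_nonpos hf hθ))
    linarith
  rw [intervalIntegral.integral_sub hiw hiq] at h1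
  have h2 : ∫ θ in M.θl..M.θh, -deriv M.f θ * θ * w θ ≤
      ∫ θ in M.θl..M.θh, -deriv M.f θ * θ * q θ := by
    have hconv : ∀ g : ℝ → ℝ, EqOn (fun θ => -deriv M.f θ * θ * g θ)
        (fun θ => -M.elasticity θ * (M.f θ * g θ)) (Ioo M.θl M.θh) := by
      intro g θ hθ
      have := (M.f_pos θ (hsub hθ)).ne'
      simp only [elasticity]
      field_simp
    have hio : ∀ {g : ℝ → ℝ}, IntervalIntegrable g volume M.θl M.θh →
        IntegrableOn g (Ioo M.θl M.θh) := fun hg =>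
      ((intervalIntegrable_iff_integrableOn_Ioo_of_le M.θl_lt_θh.le).1 hg)
    rw [intervalIntegral.integral_of_le M.θl_lt_θh.le, intervalIntegral.integral_of_le
      M.θl_lt_θh.le, integral_Ioc_eq_integral_Ioo, integral_Ioc_eq_integral_Ioo,
      setIntegral_congr_fun measurableSet_Ioo (hconv w),
      setIntegral_congr_fun measurableSet_Ioo (hconv q)]
    refine MonotoneOn.integral_mul_le_of_tails M.θl_lt_θh.le he.neg ?_ ?_ ?_
      (hio (density_mul_intervalIntegrable left_mem_types right_mem_types hq))
      (hio (density_mul_intervalIntegrable left_mem_types right_mem_types hw))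
      ((hio hiq).congr_fun (hconv q) measurableSet_Ioo)
      ((hio hiw).congr_fun (hconv w) measurableSet_Ioo) ?_
    · intro θ hθ
      have h3 := deriv_density_nonpos hf hθ
      have h4 := M.f_pos θ (hsub hθ)
      have h5 : 0 < θ := M.θl_nonneg.trans_lt hθ.1
      rw [elasticity, ← neg_div]
      exact div_nonneg (by nlinarith) h4.le
    · exact fun θ hθ => mul_nonneg (M.f_pos θ (hsub hθ)).le (h.mem θ (hsub hθ)).1
    · exact fun θ hθ => mul_nonneg (M.f_pos θ (hsub hθ)).le
        (h.wage_nonneg (hsub hθ) (M.θl_nonneg.trans_lt hθ.1))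
    · intro t ht
      have h3 := h.major t ht
      simp only [mul_sub] at h3
      rw [intervalIntegral.integral_sub
        (density_mul_intervalIntegrable ht right_mem_types
          (h.quality_intervalIntegrable ht right_mem_types))
        (density_mul_intervalIntegrable ht right_mem_types
          (h.wage_intervalIntegrable ht right_mem_types)),
        intervalIntegral.integral_of_le ht.2, intervalIntegral.integral_of_le ht.2,
        integral_Ioc_eq_integral_Ioo, integral_Ioc_eq_integral_Ioo] at h3
      linarith
  have h3 := h.expected_sub_bestQ h.balance hf hd h0
  have h4 := mul_nonneg (M.f_pos _ right_mem_types).le (neg_nonneg.2 htop)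
  linarith

end RatingModel

theorem MeasureTheory.Measure.mem_support_dirac {X : Type*} [TopologicalSpace X] [T1Space X]
    [MeasurableSpace X] [BorelSpace X] {a s : X} :
    s ∈ (Measure.dirac a).support ↔ s = a := by
  constructor
  · intro h
    have := Measure.support_subset_of_isClosed (μ := Measure.dirac a) (isClosed_singleton (x := a))
      (by simp)
    exact this h
  · rintro rfl
    rw [Measure.mem_support_iff_forall]
    intro U hU
    simp [mem_of_mem_nhds hU]

namespace RatingModel

variable {M : RatingModel}

/-! ### Deterministic rating schemes -/

/-- If the market interprets the score `s` of a deterministic scheme `g` as the quality `σ s`, then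
optimal choices that are interpreted correctly form an equilibrium. -/
theorem exists_equilibrium_of_deterministic (R : M.RatingScheme) {g : M.Quality → R.Score}
    (hg : Measurable g) (hk : R.kernel = Kernel.deterministic g hg) {σ : R.Score → M.Quality}
    (hσ : Measurable σ) (hgσ : ∀ x, g (σ (g x)) = g x) {quality : ℝ → M.Quality}
    (hq : Measurable quality) (hfix : ∀ θ ∈ M.types, σ (g (quality θ)) = quality θ)
    (hopt : ∀ θ ∈ M.types, ∀ x : M.Quality,
      θ * σ (g x) - M.c x ≤ θ * quality θ - M.c (quality θ)) :
    ∃ A : M.Assessment R, A.IsEquilibrium ∧ A.quality = quality := by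
  let A : M.Assessment R :=
    { quality := quality
      takers := univ
      belief := Kernel.deterministic σ hσ
      nullBelief := Measure.dirac M.zeroQuality }
  have hwage : ∀ s, A.wage s = σ s := fun s => by
    simp [Assessment.wage, A, Kernel.deterministic_apply]
  have hnull : A.nullWage = 0 := by simp [Assessment.nullWage, A, zeroQuality]
  have hinterim : ∀ x, A.interimWage x = σ (g x) := fun x => by
    simp only [Assessment.interimWage, hwage, hk, Kernel.deterministic_apply]
    exact integral_dirac' _ _ (measurable_subtype_coe.comp hσ).stronglyMeasurable
  have hpay : ∀ θ ∈ M.types, A.payoff θ = θ * quality θ - M.c (quality θ) := fun θ hθ => by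
    simp only [Assessment.payoff, A, mem_univ, if_true, Assessment.payoffTake]
    rw [show A.interimWage (quality θ) = _ from hinterim _, hfix θ hθ]
  refine ⟨A, ?_, rfl⟩
  refine ⟨hq, MeasurableSet.univ, inferInstanceAs (IsMarkovKernel (Kernel.deterministic σ hσ)),
    inferInstanceAs (IsProbabilityMeasure (Measure.dirac _)), ?_, ?_, ?_, ?_, ?_, fun _ => rfl⟩
  · intro θ hθ x
    rw [hpay θ hθ, Assessment.payoffTake, hinterim]
    exact hopt θ hθ x
  · intro θ hθ x
    rw [hpay θ hθ, Assessment.payoffDecline, hnull]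
    have h1 := hopt θ hθ M.zeroQuality
    have h2 : 0 ≤ θ * (σ (g M.zeroQuality) : ℝ) :=
      mul_nonneg (M.θl_nonneg.trans hθ.1) (σ (g M.zeroQuality)).2.1
    have h3 : M.c (M.zeroQuality : M.Quality) = 0 := M.c_zero
    have h4 := M.cost_nonneg x.2
    linarith
  -- On the path `σ` inverts `g`, so both joint laws are the image of the quality law under `x ↦ (g
  -- x, x)`.
  · have hae : ∀ᵐ x ∂A.takerQuality, σ (g x) = x := by
      simp only [Assessment.takerQuality, A, Measure.restrict_univ]
      refine (ae_map_iff hq.aemeasurable (p := fun x => σ (g x) = x)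
        (measurableSet_eq_fun (hσ.comp hg) measurable_id)).2 ?_
      filter_upwards [M.ae_prior_mem] with θ hθ using hfix θ hθ
    rw [hk, Measure.deterministic_comp_eq_map, Measure.compProd_deterministic,
      show A.belief = Kernel.deterministic σ hσ from rfl, Measure.compProd_deterministic,
      Measure.map_map (by fun_prop) (by fun_prop), Measure.map_map (by fun_prop) (by fun_prop)]
    refine Measure.map_congr ?_
    filter_upwards [hae] with x hx
    simp [hx]
  · rintro s ⟨x, hx⟩
    rw [hk, Kernel.deterministic_apply, Measure.mem_support_dirac] at hx
    have hb : A.belief s = Measure.dirac (σ s) := Kernel.deterministic_apply hσ s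
    rw [hb, ae_dirac_eq, eventually_pure, hk, Kernel.deterministic_apply,
      Measure.mem_support_dirac, hx, hgσ]
  · simp [A]

/-- The fully revealing test has an equilibrium with efficient qualities. -/
theorem exists_equilibrium_fullyRevealing :
    ∃ A : M.Assessment M.fullyRevealing, A.IsEquilibrium ∧ A.quality = M.bestQuality :=
  exists_equilibrium_of_deterministic M.fullyRevealing (g := fun x => x) measurable_id rfl
    (σ := fun x => x) measurable_id (fun _ => rfl) M.bestQuality_mono.measurable (fun _ _ => rfl)
    fun θ _ x => M.le_bestQuality_surplus θ x.2

/-! ### Uniqueness of equilibrium quality under full revelation -/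

/-- Without the test, only quality zero is optimal, and the market knows it. -/
theorem Assessment.IsEquilibrium.decline_quality {R : M.RatingScheme} {A : M.Assessment R}
    (h : A.IsEquilibrium) {θ : ℝ} (hθ : θ ∈ M.types) (ht : θ ∉ A.takers) :
    A.quality θ = M.zeroQuality := by
  have h1 := h.optimal_decline θ hθ M.zeroQuality
  rw [A.payoff_eq] at h1
  simp only [Assessment.typeWage, ht, if_false, Assessment.payoffDecline] at h1
  have h2 : M.c (M.zeroQuality : M.Quality) = 0 := M.c_zero
  refine Subtype.ext ?_
  by_contra hne
  have := M.cost_pos ⟨lt_of_le_of_ne (A.quality θ).2.1 (Ne.symm hne), (A.quality θ).2.2⟩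
  linarith

/-- If decliners have positive mass, Bayes' rule equates the belief with the law of their quality, a
point mass at zero; otherwise the condition for an unexpected null score applies. -/
theorem Assessment.IsEquilibrium.nullWage_eq {R : M.RatingScheme} {A : M.Assessment R}
    (h : A.IsEquilibrium) : A.nullWage = 0 := by
  have hd : A.nullBelief = Measure.dirac M.zeroQuality := by
    by_cases h0 : M.prior A.takersᶜ = 0
    · exact h.consistent_null h0
    have h1 := h.bayes_null
    have h2 : (M.prior.restrict A.takersᶜ).map A.quality =
        M.prior A.takersᶜ • Measure.dirac M.zeroQuality := by
      have : A.quality =ᵐ[M.prior.restrict A.takersᶜ] fun _ => M.zeroQuality := by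
        refine (ae_restrict_iff' h.measurable_takers.compl).2 ?_
        filter_upwards [M.ae_prior_mem] with θ hθ ht using h.decline_quality hθ ht
      rw [Measure.map_congr this, Measure.map_const, Measure.restrict_apply_univ]
    rw [h2] at h1
    ext s hs
    have h3 := congrArg (fun μ : Measure M.Quality => μ s) h1
    simp only [Measure.smul_apply, smul_eq_mul] at h3
    exact ((ENNReal.mul_right_inj h0 (measure_ne_top _ _)).1 h3).symm
  simp [Assessment.nullWage, hd, zeroQuality]

/-- A score has only one quality that can produce it, so consistency pins down the wage even off the
path. Strict concavity of the surplus then leaves one optimum, also for decliners, who have zero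
quality and zero wage. -/
theorem Assessment.IsEquilibrium.fullyRevealing_quality {A : M.Assessment M.fullyRevealing}
    (h : A.IsEquilibrium) {θ : ℝ} (hθ : θ ∈ M.types) : A.quality θ = M.bestQuality θ := by
  have hmk := h.belief_markov
  have hwage : ∀ s : M.Quality, A.wage s = s := by
    intro s
    have hsupp : ∀ x : M.Quality, s ∈ (M.fullyRevealing.kernel x).support ↔ s = x := fun x => by
      change s ∈ (Kernel.id x).support ↔ s = x
      rw [Kernel.id_apply]
      exact Measure.mem_support_dirac
    have h1 := h.consistent s ⟨s, (hsupp s).2 rfl⟩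
    simp only [hsupp] at h1
    have h2 : (fun x : M.Quality => (x : ℝ)) =ᵐ[A.belief s] fun _ => (s : ℝ) := by
      filter_upwards [h1] with x hx
      rw [← hx]
    rw [Assessment.wage, integral_congr_ae h2]
    simp
  have hinterim : ∀ x : M.Quality, A.interimWage x = x := by
    intro x
    have : M.fullyRevealing.kernel x = Measure.dirac x := Kernel.id_apply x
    rw [Assessment.interimWage, this]
    exact (integral_dirac _ _).trans (hwage x)
  have hopt := h.optimal_take θ hθ (M.bestQuality θ)
  rw [A.payoff_eq, Assessment.payoffTake, hinterim] at hopt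
  by_cases ht : θ ∈ A.takers
  · simp only [Assessment.typeWage, ht, if_true, hinterim] at hopt
    exact Subtype.ext (M.bestQuality_unique (A.quality θ).2 hopt)
  · have hz := h.decline_quality hθ ht
    simp only [Assessment.typeWage, ht, if_false, h.nullWage_eq, hz] at hopt
    have h2 : M.c (M.zeroQuality : M.Quality) = 0 := M.c_zero
    have h3 : ((M.zeroQuality : M.Quality) : ℝ) = 0 := rfl
    rw [hz]
    refine Subtype.ext (M.bestQuality_unique M.zeroQuality.2 ?_)
    rw [h2, h3]
    rw [h2] at hopt
    linarith

theorem isOptimal_fullyRevealing_iff :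
    M.IsOptimal M.fullyRevealing ↔ ∀ (R : M.RatingScheme) (A : M.Assessment R),
      A.IsEquilibrium → A.expectedQuality ≤ ∫ θ in M.θl..M.θh, M.f θ * M.bestQ θ := by
  constructor
  · rintro ⟨A, hA, hopt⟩ R A' hA'
    refine (hopt R A' hA').trans_eq ?_
    rw [A.expectedQuality_eq]
    refine intervalIntegral.integral_congr fun θ hθ => ?_
    rw [uIcc_of_le M.θl_lt_θh.le] at hθ
    simp only [bestQ, hA.fullyRevealing_quality hθ]
  · intro h
    obtain ⟨A, hA, hq⟩ := exists_equilibrium_fullyRevealing (M := M)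
    refine ⟨A, hA, fun R A' hA' => (h R A' hA').trans_eq ?_⟩
    rw [A.expectedQuality_eq, hq]
    rfl

/-! ### Pass/fail tests -/

/-- Passing is read as exactly `q₀` and failing as quality zero: within each result only the
cheapest quality is worth choosing. -/
theorem exists_equilibrium_passFail (q₀ : M.Quality) :
    ∃ A : M.Assessment (M.passFail q₀), A.IsEquilibrium ∧
      ∀ θ, (A.quality θ : ℝ) = M.passQuality q₀ θ := by
  classical
  let quality : ℝ → M.Quality := fun θ => if M.c q₀ ≤ θ * q₀ then q₀ else M.zeroQuality
  have hqm : Measurable quality :=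
    Measurable.ite (measurableSet_le measurable_const (measurable_id.mul_const _)) measurable_const
      measurable_const
  have hq : ∀ θ, (quality θ : ℝ) = M.passQuality q₀ θ := fun θ => by
    simp only [quality, passQuality]
    split_ifs <;> rfl
  let σ : Bool → M.Quality := fun b => if b then q₀ else M.zeroQuality
  have hfix : ∀ x, x = q₀ ∨ x = M.zeroQuality → σ (M.passFailScore q₀ x) = x := by
    rintro x (rfl | rfl)
    · simp [passFailScore, σ]
    -- With a zero standard, quality zero passes and coincides with `q₀`.
    · by_cases h : q₀ ≤ M.zeroQuality
      · simpa [passFailScore, σ, h] using le_antisymm h q₀.2.1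
      · simp [passFailScore, σ, h]
  have hσ : ∀ x, σ (M.passFailScore q₀ x) = if q₀ ≤ x then q₀ else M.zeroQuality := fun x => by
    by_cases h : q₀ ≤ x <;> simp [passFailScore, σ, h]
  suffices h : ∃ A : M.Assessment (M.passFail q₀), A.IsEquilibrium ∧ A.quality = quality by
    obtain ⟨A, hA, hAq⟩ := h
    exact ⟨A, hA, fun θ => by rw [hAq, hq]⟩
  refine exists_equilibrium_of_deterministic (M.passFail q₀)
    (M.measurable_passFailScore q₀) rfl (σ := σ) (measurable_of_countable _)
    (fun x => ?_) hqm (fun θ _ => hfix _ ?_) fun θ hθ x => ?_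
  · by_cases h : q₀ ≤ x
    · simp [passFailScore, σ, h]
    · have : ¬ q₀ ≤ M.zeroQuality := fun h' => h (h'.trans x.2.1)
      simp [passFailScore, σ, h, this]
  · simp only [quality]
    split_ifs <;> simp
  · rw [hσ, hq]
    have h1 := M.cost_nonneg x.2
    have h2 : 0 ≤ θ * (0 : ℝ) - M.c 0 := by simp [M.c_zero]
    have h3 : q₀ ≤ x → M.c q₀ ≤ M.c x := fun h =>
      M.cost_strictMonoOn.monotoneOn q₀.2 x.2 h
    have h4 : ((M.zeroQuality : M.Quality) : ℝ) = 0 := rfl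
    simp only [passQuality]
    split_ifs with h5 h6 h6
    · have := h3 h5; linarith
    · have := h3 h5; have := not_le.1 h6; linarith
    · rw [h4]; linarith
    · rw [h4]; linarith

theorem exists_isOptimal_passFail (hf : MonotoneOn M.f M.types) :
    ∃ q₀ : M.Quality, M.IsOptimal (M.passFail q₀) := by
  obtain ⟨x, hx, hbest⟩ := M.exists_best_passQuality
  obtain ⟨A, hA, hAq⟩ := exists_equilibrium_passFail (M := M) ⟨x, hx⟩
  refine ⟨⟨x, hx⟩, A, hA, fun R A' hA' => ?_⟩
  obtain ⟨y, hy, hle⟩ := hA'.feasible.expected_le_passQuality hf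
  rw [A'.expectedQuality_eq, A.expectedQuality_eq]
  simp only [hAq]
  exact hle.trans (hbest y hy)

end RatingModel

namespace RatingModel

variable {M : RatingModel}

/-! ### Tests that pool an interval of qualities -/

theorem surplus_le_of_le_bestQ {θ x z : ℝ} (hx : x ∈ Icc 0 M.qmax) (hxz : x ≤ z)
    (hz : z ≤ M.bestQ θ) : θ * x - M.c x ≤ θ * z - M.c z := by
  have h := (M.surplus_strictConcaveOn θ).concaveOn.min_le_of_mem_Icc hx (M.bestQuality θ).2
    ⟨hxz, hz⟩
  rwa [min_eq_left (M.le_bestQuality_surplus θ hx)] at h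

theorem surplus_le_of_bestQ_le {θ x z : ℝ} (hx : x ∈ Icc 0 M.qmax) (hxz : z ≤ x)
    (hz : M.bestQ θ ≤ z) : θ * x - M.c x ≤ θ * z - M.c z := by
  have h := (M.surplus_strictConcaveOn θ).concaveOn.min_le_of_mem_Icc (M.bestQuality θ).2 hx
    ⟨hz, hxz⟩
  rwa [min_eq_right (M.le_bestQuality_surplus θ hx)] at h

variable (M) in
open Classical in
/-- The quality of type `θ` when qualities between `lo` and `y` are rewarded like `lo`, where `t`
is indifferent between `lo` and `y`. -/
def censorQuality (lo y t θ : ℝ) : ℝ := if θ < t then min (M.bestQ θ) lo else max (M.bestQ θ) y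

/-- On either side of the gap the surplus is single-peaked, so only comparisons across the gap need
an argument. The average slope of `c` over the gap is `t`; by convexity it is at least `t` beyond
`y` and at most `t` before `lo`. -/
theorem censorQuality_optimal {lo y t : ℝ} (hlo : lo ∈ Icc 0 M.qmax) (hy : y ∈ Icc 0 M.qmax)
    (hly : lo < y) (ht : t * (y - lo) = M.c y - M.c lo) (θ : ℝ) {x : ℝ} (hx : x ∈ Icc 0 M.qmax)
    (hxf : x ≤ lo ∨ y ≤ x) :
    θ * x - M.c x ≤ θ * M.censorQuality lo y t θ - M.c (M.censorQuality lo y t θ) := by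
  have hc := M.cost_strictConvexOn.convexOn
  unfold censorQuality
  split_ifs with hθ
  · rcases le_total (M.bestQ θ) lo with hb | hb
    · rw [min_eq_left hb]
      exact M.le_bestQuality_surplus θ hx
    · rw [min_eq_right hb]
      rcases hxf with hxl | hyx
      · exact surplus_le_of_le_bestQ hx hxl hb
      · rcases hyx.eq_or_lt with rfl | hyx
        · nlinarith
        have h1 := hc.slope_mono_adjacent hlo hx hly hyx
        rw [← ht, mul_div_cancel_right₀ _ (sub_pos.2 hly).ne', le_div_iff₀ (sub_pos.2 hyx)] at h1
        nlinarith
  · rw [not_lt] at hθ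
    rcases le_total y (M.bestQ θ) with hb | hb
    · rw [max_eq_left hb]
      exact M.le_bestQuality_surplus θ hx
    · rw [max_eq_right hb]
      rcases hxf with hxl | hyx
      · rcases hxl.eq_or_lt with rfl | hxl
        · nlinarith
        have h1 := hc.slope_mono_adjacent hx hy hxl hly
        rw [← ht, mul_div_cancel_right₀ _ (sub_pos.2 hly).ne', div_le_iff₀ (sub_pos.2 hxl)] at h1
        nlinarith
      · exact surplus_le_of_bestQ_le hx hyx hb

theorem censorQuality_mem {lo y t : ℝ} (hlo : lo ∈ Icc 0 M.qmax) (hy : y ∈ Icc 0 M.qmax) (θ : ℝ) :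
    M.censorQuality lo y t θ ∈ Icc 0 M.qmax := by
  have hb : M.bestQ θ ∈ Icc 0 M.qmax := (M.bestQuality θ).2
  unfold censorQuality
  split_ifs
  · exact ⟨le_min hb.1 hlo.1, (min_le_left _ _).trans hb.2⟩
  · exact ⟨hb.1.trans (le_max_left _ _), max_le hb.2 hy.2⟩

theorem censorQuality_fixed {lo y t : ℝ} (θ : ℝ) :
    M.censorQuality lo y t θ ≤ lo ∨ y ≤ M.censorQuality lo y t θ := by
  unfold censorQuality
  split_ifs
  · exact Or.inl (min_le_right _ _)
  · exact Or.inr (le_max_right _ _)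

theorem implementable_censorQuality {lo y t : ℝ} (hlo : lo ∈ Icc 0 M.qmax)
    (hy : y ∈ Icc 0 M.qmax) (hly : lo < y) (ht : t * (y - lo) = M.c y - M.c lo) :
    M.Implementable (M.censorQuality lo y t) (M.censorQuality lo y t) where
  mem θ _ := censorQuality_mem hlo hy θ
  ic θ _ θ' _ := censorQuality_optimal hlo hy hly ht θ (censorQuality_mem hlo hy θ')
    (censorQuality_fixed θ')
  ir θ _ := by
    have := censorQuality_optimal hlo hy hly ht θ (left_mem_Icc.2 M.qmax_pos.le) (Or.inl hlo.1)
    simpa [M.c_zero] using this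

/-- The score `g x` equals `lo` on the gap and `x` elsewhere, and is taken at face value. As `g x ≤
x`, producing more than the score shows only adds cost. -/
theorem exists_equilibrium_censor {lo y t : ℝ} (hlo : lo ∈ Icc 0 M.qmax)
    (hy : y ∈ Icc 0 M.qmax) (hly : lo < y) (ht : t * (y - lo) = M.c y - M.c lo) :
    ∃ (R : M.RatingScheme) (A : M.Assessment R), A.IsEquilibrium ∧
      ∀ θ, (A.quality θ : ℝ) = M.censorQuality lo y t θ := by
  classical
  let g : M.Quality → M.Quality := fun x => if lo ≤ x ∧ (x : ℝ) < y then ⟨lo, hlo⟩ else x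
  have hg : Measurable g :=
    Measurable.ite ((measurableSet_le measurable_const measurable_subtype_coe).inter
      (measurableSet_lt measurable_subtype_coe measurable_const)) measurable_const measurable_id
  have hgfix : ∀ x : M.Quality, (x : ℝ) ≤ lo ∨ y ≤ x → g x = x := by
    intro x hx
    simp only [g]
    split_ifs with h
    · rcases hx with hx | hx
      · exact Subtype.ext (le_antisymm h.1 hx)
      · exact absurd h.2 (not_lt.2 hx)
    · rfl
  have hgf : ∀ x, ((g x : M.Quality) : ℝ) ≤ lo ∨ y ≤ (g x : M.Quality) := by
    intro x
    simp only [g]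
    split_ifs with h
    · exact Or.inl le_rfl
    · rw [not_and_or, not_le, not_lt] at h
      exact h.imp le_of_lt id
  have hgle : ∀ x, ((g x : M.Quality) : ℝ) ≤ x := by
    intro x
    simp only [g]
    split_ifs with h
    · exact h.1
    · exact le_rfl
  let R : M.RatingScheme :=
    { Score := M.Quality
      polishScore := isClosed_Icc.polishSpace
      kernel := Kernel.deterministic g hg }
  let quality : ℝ → M.Quality := fun θ => ⟨M.censorQuality lo y t θ, censorQuality_mem hlo hy θ⟩
  have hbm : Measurable M.bestQ := measurable_subtype_coe.comp M.bestQuality_mono.measurable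
  have hqm : Measurable quality :=
    Measurable.subtype_mk (Measurable.ite measurableSet_Iio (hbm.min measurable_const)
      (hbm.max measurable_const))
  suffices h : ∃ A : M.Assessment R, A.IsEquilibrium ∧ A.quality = quality by
    obtain ⟨A, hA, hAq⟩ := h
    exact ⟨R, A, hA, fun θ => by rw [hAq]⟩
  refine exists_equilibrium_of_deterministic R hg rfl (σ := fun x => x) measurable_id
    (fun x => hgfix _ (hgf x)) hqm (fun θ _ => hgfix _ (censorQuality_fixed θ)) fun θ _ x => ?_
  have h1 := censorQuality_optimal hlo hy hly ht θ (g x).2 (hgf x)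
  have h2 := M.cost_strictMonoOn.monotoneOn (g x).2 x.2 (hgle x)
  change θ * ((g x : M.Quality) : ℝ) - M.c x ≤ _
  refine le_trans ?_ h1
  linarith

theorem bestQ_continuousOn : ContinuousOn M.bestQ (Icc 0 M.θh) :=
  continuous_subtype_val.comp_continuousOn M.bestQuality_continuousOn

theorem bestQ_mono : Monotone M.bestQ := fun _ _ h => M.bestQuality_mono h

theorem bestQ_strictMonoOn : StrictMonoOn M.bestQ (Icc 0 M.θh) := fun _ hx _ hy h =>
  M.bestQuality_strictMonoOn hx hy h

/-! ### Necessary conditions from minimum standards and pooling -/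

/-- If even the lowest type is productive, then a minimum standard raises expected quality. -/
theorem θl_eq_zero_of_optimal (h : M.IsOptimal M.fullyRevealing) : M.θl = 0 := by
  rw [isOptimal_fullyRevealing_iff] at h
  by_contra hne
  have hpos : 0 < M.θl := lt_of_le_of_ne M.θl_nonneg (Ne.symm hne)
  obtain ⟨x, hx, hcx⟩ := M.exists_cost_lt hpos
  -- The standard `y` leaves the lowest type indifferent to zero quality, so all types meet it.
  obtain ⟨y, hy, hcy⟩ : (0 : ℝ) ∈ (fun y => M.c y - M.θl * y) '' Icc x M.qmax := by
    have hgc : ContinuousOn (fun y => M.c y - M.θl * y) (Icc x M.qmax) :=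
      (M.cost_continuousOn.mono (Icc_subset_Icc_left hx.1.le)).sub
        (continuous_const.mul continuous_id).continuousOn
    refine intermediate_value_Icc hx.2.le hgc ⟨by linarith, ?_⟩
    have := M.qmax_large
    have := mul_lt_mul_of_pos_right M.θl_lt_θh M.qmax_pos
    linarith
  have hy0 : 0 < y := hx.1.trans_le hy.1
  have hym : y ∈ Icc 0 M.qmax := ⟨hy0.le, hy.2⟩
  simp only at hcy
  -- Otherwise the surplus of `θl` would still be increasing from `x` to `y`, but it falls from a
  -- positive value to zero.
  have hby : M.bestQ M.θl < y := by
    by_contra! hle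
    have := surplus_le_of_le_bestQ (Ioo_subset_Icc_self hx) hy.1 hle
    linarith
  obtain ⟨R, A, hA, hAq⟩ := exists_equilibrium_censor (M := M) (t := M.θl)
    (left_mem_Icc.2 M.qmax_pos.le) hym hy0 (by rw [M.c_zero]; linarith)
  have hle := h R A hA
  rw [A.expectedQuality_eq] at hle
  have hbc : ContinuousOn M.bestQ M.types := bestQ_continuousOn.mono M.types_subset
  have hcont : ContinuousOn (fun θ => M.f θ * (max (M.bestQ θ) y - M.bestQ θ)) M.types :=
    M.f_cont.mul ((hbc.sup continuousOn_const).sub hbc)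
  have hgain : 0 < ∫ θ in M.θl..M.θh, M.f θ * (max (M.bestQ θ) y - M.bestQ θ) := by
    refine intervalIntegral.integral_pos M.θl_lt_θh hcont (fun θ hθ => ?_)
      ⟨M.θl, left_mem_types, ?_⟩
    · exact mul_nonneg (M.f_pos θ (Ioc_subset_Icc_self hθ)).le (sub_nonneg.2 (le_max_left _ _))
    · exact mul_pos (M.f_pos _ left_mem_types)
        (sub_pos.2 (lt_max_of_lt_right hby))
  have hq : ∫ θ in M.θl..M.θh, M.f θ * A.quality θ =
      ∫ θ in M.θl..M.θh, M.f θ * max (M.bestQ θ) y := by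
    refine intervalIntegral.integral_congr fun θ hθ => ?_
    rw [uIcc_of_le M.θl_lt_θh.le] at hθ
    simp only [hAq, censorQuality, if_neg (not_lt.2 hθ.1)]
  simp only [mul_sub] at hgain
  rw [intervalIntegral.integral_sub] at hgain
  · linarith
  · exact (M.f_cont.mul (hbc.sup continuousOn_const)).intervalIntegrable_of_Icc M.θl_lt_θh.le
  · exact (M.f_cont.mul hbc).intervalIntegrable_of_Icc M.θl_lt_θh.le

/-- Around a type where the density increases, pooling raises expected quality. -/
theorem deriv_density_nonpos_of_optimal (h : M.IsOptimal M.fullyRevealing)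
    (hd : DifferentiableOn ℝ M.f (Ioo M.θl M.θh)) {θ₀ : ℝ} (hθ₀ : θ₀ ∈ Ioo M.θl M.θh) :
    deriv M.f θ₀ ≤ 0 := by
  rw [isOptimal_fullyRevealing_iff] at h
  by_contra! hpos
  have hb := implementable_bestQ (M := M)
  -- a neighbourhood on which the density crosses its value at `θ₀` from below
  obtain ⟨ε, hε, hcross⟩ : ∃ ε > 0, ∀ θ, |θ - θ₀| < ε → 0 ≤ (M.f θ - M.f θ₀) * (θ - θ₀) ∧
      (θ ≠ θ₀ → 0 < (M.f θ - M.f θ₀) * (θ - θ₀)) := by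
    have h1 := (hasDerivAt_iff_tendsto_slope.1 (hasDerivAt_density hd hθ₀)).eventually
      (lt_mem_nhds hpos)
    rw [eventually_nhdsWithin_iff, Metric.eventually_nhds_iff] at h1
    obtain ⟨ε, hε, h2⟩ := h1
    have h3 : ∀ θ, |θ - θ₀| < ε → θ ≠ θ₀ → 0 < (M.f θ - M.f θ₀) * (θ - θ₀) := by
      intro θ hθ hne
      have h4 := h2 (y := θ) hθ hne
      rw [slope_def_field] at h4
      have h5 : 0 < (θ - θ₀) ^ 2 := by have := sub_ne_zero.2 hne; positivity
      have h6 : (M.f θ - M.f θ₀) * (θ - θ₀) = (M.f θ - M.f θ₀) / (θ - θ₀) * (θ - θ₀) ^ 2 := by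
        have := sub_ne_zero.2 hne
        field_simp
      rw [h6]
      exact mul_pos h4 h5
    refine ⟨ε, hε, fun θ hθ => ⟨?_, h3 θ hθ⟩⟩
    rcases eq_or_ne θ θ₀ with rfl | hne
    · simp
    · exact (h3 θ hθ hne).le
  obtain ⟨δ, hδ, hδε, hδl, hδh⟩ : ∃ δ > 0, δ < ε ∧ M.θl < θ₀ - δ ∧ θ₀ + δ < M.θh := by
    refine ⟨min (ε / 2) (min ((θ₀ - M.θl) / 2) ((M.θh - θ₀) / 2)), ?_, ?_, ?_, ?_⟩
    · have := sub_pos.2 hθ₀.1; have := sub_pos.2 hθ₀.2; positivity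
    · exact (min_le_left _ _).trans_lt (by linarith)
    · have := (min_le_right (ε / 2) _).trans (min_le_left ((θ₀ - M.θl) / 2) ((M.θh - θ₀) / 2))
      linarith [hθ₀.1]
    · have := (min_le_right (ε / 2) _).trans (min_le_right ((θ₀ - M.θl) / 2) ((M.θh - θ₀) / 2))
      linarith [hθ₀.2]
  have hl0 := M.θl_nonneg
  have hm1 : θ₀ - δ ∈ Icc 0 M.θh := ⟨by linarith, by linarith⟩
  have hm0 : θ₀ ∈ Icc 0 M.θh := ⟨by linarith, by linarith⟩
  have hm2 : θ₀ + δ ∈ Icc 0 M.θh := ⟨by linarith, by linarith⟩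
  have hlt1 : M.bestQ (θ₀ - δ) < M.bestQ θ₀ := bestQ_strictMonoOn hm1 hm0 (by linarith)
  have hlt2 : M.bestQ θ₀ < M.bestQ (θ₀ + δ) := bestQ_strictMonoOn hm0 hm2 (by linarith)
  have hbm : ∀ θ, M.bestQ θ ∈ Icc 0 M.qmax := fun θ => (M.bestQuality θ).2
  set H : ℝ → ℝ := fun x => θ₀ * x - M.c x with hH
  have hHc : ContinuousOn H (Icc 0 M.qmax) := M.surplus_continuousOn θ₀
  have hHlt : ∀ x ∈ Icc 0 M.qmax, x ≠ M.bestQ θ₀ → H x < H (M.bestQ θ₀) := fun x hx hne => by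
    by_contra! hle
    exact hne (M.bestQuality_unique hx hle)
  -- A surplus level just below the peak of `θ₀`: it is attained once on each side, at `lo` and `y`,
  -- which makes `θ₀` indifferent and confines all changes to types within `δ`.
  obtain ⟨v, hv1, hv2⟩ := exists_between (max_lt (hHlt _ (hbm (θ₀ - δ)) hlt1.ne)
    (hHlt _ (hbm (θ₀ + δ)) hlt2.ne'))
  rw [max_lt_iff] at hv1
  obtain ⟨lo, hlo, hlov⟩ := intermediate_value_Ioo hlt1.le
    (hHc.mono (Icc_subset_Icc (hbm _).1 (hbm _).2)) ⟨hv1.1, hv2⟩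
  obtain ⟨y, hy, hyv⟩ := intermediate_value_Ioo' hlt2.le
    (hHc.mono (Icc_subset_Icc (hbm _).1 (hbm _).2)) ⟨hv1.2, hv2⟩
  have hlom : lo ∈ Icc 0 M.qmax := ⟨(hbm _).1.trans hlo.1.le, hlo.2.le.trans (hbm _).2⟩
  have hym : y ∈ Icc 0 M.qmax := ⟨(hbm _).1.trans hy.1.le, hy.2.le.trans (hbm _).2⟩
  have hly : lo < y := hlo.2.trans hy.1
  have ht : θ₀ * (y - lo) = M.c y - M.c lo := by
    have := hlov.trans hyv.symm
    simp only [hH] at this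
    linarith
  obtain ⟨R, A, hA, hAq⟩ := exists_equilibrium_censor hlom hym hly ht
  have hQ := implementable_censorQuality hlom hym hly ht
  set Q := M.censorQuality lo y θ₀ with hQdef
  have hQh : Q M.θh = M.bestQ M.θh := by
    have h1 : y ≤ M.bestQ M.θh := hy.2.le.trans (bestQ_mono hδh.le)
    rw [hQdef, censorQuality, if_neg (not_lt.2 hθ₀.2.le), max_eq_left h1]
  have hQl : Q M.θl = M.bestQ M.θl := by
    have h1 : M.bestQ M.θl ≤ lo := (bestQ_mono hδl.le).trans hlo.1.le
    rw [hQdef, censorQuality, if_pos hθ₀.1, min_eq_left h1]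
  have hQi := hQ.wage_intervalIntegrable left_mem_types right_mem_types
  have hbi := hb.wage_intervalIntegrable left_mem_types right_mem_types
  -- By the envelope formula both integrals are utility differences between the extreme types, whose
  -- choices are unaffected.
  have hzero : ∫ θ in M.θl..M.θh, (Q θ - M.bestQ θ) = 0 := by
    rw [intervalIntegral.integral_sub hQi hbi, hQ.integral_wage, hb.integral_wage]
    simp only [utility, hQh, hQl]
    ring
  have hnear : ∀ θ, θ ∉ Ioo (θ₀ - δ) (θ₀ + δ) → Q θ = M.bestQ θ := by
    intro θ hθ
    rw [mem_Ioo, not_and_or, not_lt, not_lt] at hθ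
    rcases hθ with hθ | hθ
    · rw [hQdef, censorQuality, if_pos (by linarith), min_eq_left]
      exact (bestQ_mono hθ).trans hlo.1.le
    · rw [hQdef, censorQuality, if_neg (by linarith), max_eq_left]
      exact hy.2.le.trans (bestQ_mono hθ)
  -- Near `θ₀` pooling lowers quality where `f < f θ₀` and raises it where `f > f θ₀`.
  have hnonneg : ∀ θ, 0 ≤ (M.f θ - M.f θ₀) * (Q θ - M.bestQ θ) := by
    intro θ
    by_cases hθ : θ ∈ Ioo (θ₀ - δ) (θ₀ + δ)
    · have hc := (hcross θ (by rw [abs_lt]; constructor <;> linarith [hθ.1, hθ.2])).1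
      rcases lt_or_ge θ θ₀ with hlt | hge
      · have h1 : Q θ ≤ M.bestQ θ := by
          rw [hQdef, censorQuality, if_pos hlt]; exact min_le_left _ _
        have h2 : M.f θ - M.f θ₀ ≤ 0 := by nlinarith
        nlinarith
      · have h1 : M.bestQ θ ≤ Q θ := by
          rw [hQdef, censorQuality, if_neg (not_lt.2 hge)]; exact le_max_left _ _
        rcases hge.eq_or_lt with rfl | hgt
        · simp
        · have h2 : 0 ≤ M.f θ - M.f θ₀ := nonneg_of_mul_nonneg_left hc (sub_pos.2 hgt)
          exact mul_nonneg h2 (sub_nonneg.2 h1)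
    · simp [hnear θ hθ]
  have hprod : IntervalIntegrable (fun θ => (M.f θ - M.f θ₀) * (Q θ - M.bestQ θ)) volume
      M.θl M.θh :=
    (hQi.sub hbi).continuousOn_mul ((M.f_cont.sub continuousOn_const).mono
      (uIcc_subset_Icc left_mem_types right_mem_types))
  have hgain : 0 < ∫ θ in M.θl..M.θh, (M.f θ - M.f θ₀) * (Q θ - M.bestQ θ) := by
    -- Types between `θ₀` and `r` are pushed up strictly, to `y`, which makes the gain strict.
    obtain ⟨r, hr, hry⟩ := intermediate_value_Ioo (show θ₀ ≤ θ₀ + δ by linarith)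
      (bestQ_continuousOn.mono (Icc_subset_Icc hm0.1 hm2.2))
      (show y ∈ Ioo (M.bestQ θ₀) (M.bestQ (θ₀ + δ)) from hy)
    have hsub : uIcc θ₀ r ⊆ uIcc M.θl M.θh := by
      rw [uIcc_of_le hr.1.le, uIcc_of_le M.θl_lt_θh.le]
      exact Icc_subset_Icc hθ₀.1.le (by linarith [hr.2])
    refine lt_of_lt_of_le (intervalIntegral.intervalIntegral_pos_of_pos_on
      (hprod.mono_set hsub) (fun θ hθ => ?_) hr.1)
      (intervalIntegral.integral_mono_interval hθ₀.1.le hr.1.le (by linarith [hr.2])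
        (Eventually.of_forall hnonneg) hprod)
    have hθm : θ ∈ Icc 0 M.θh := ⟨hm0.1.trans hθ.1.le, by linarith [hθ.2, hr.2]⟩
    have h1 : M.bestQ θ < y := by
      rw [← hry]
      exact bestQ_strictMonoOn hθm ⟨hm0.1.trans hr.1.le, by linarith [hr.2]⟩ hθ.2
    have h2 : Q θ = y := by
      rw [hQdef, censorQuality, if_neg (not_lt.2 hθ.1.le), max_eq_right h1.le]
    have h3 := (hcross θ (by rw [abs_lt]; constructor <;> linarith [hθ.1, hθ.2, hr.2])).2 hθ.1.ne'
    rw [h2]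
    exact mul_pos (pos_of_mul_pos_left h3 (sub_pos.2 hθ.1).le) (sub_pos.2 h1)
  have hle := h R A hA
  rw [A.expectedQuality_eq] at hle
  simp only [hAq] at hle
  have hsplit : ∫ θ in M.θl..M.θh, (M.f θ - M.f θ₀) * (Q θ - M.bestQ θ) =
      (∫ θ in M.θl..M.θh, M.f θ * Q θ) - (∫ θ in M.θl..M.θh, M.f θ * M.bestQ θ) -
        M.f θ₀ * ∫ θ in M.θl..M.θh, (Q θ - M.bestQ θ) := by
    rw [← intervalIntegral.integral_const_mul, ← intervalIntegral.integral_sub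
      (density_mul_intervalIntegrable left_mem_types right_mem_types hQi)
      (density_mul_intervalIntegrable left_mem_types right_mem_types hbi),
      ← intervalIntegral.integral_sub
        ((density_mul_intervalIntegrable left_mem_types right_mem_types hQi).sub
          (density_mul_intervalIntegrable left_mem_types right_mem_types hbi))
        ((hQi.sub hbi).const_mul _)]
    exact intervalIntegral.integral_congr fun θ _ => by ring
  rw [hzero] at hsplit
  linarith

theorem antitoneOn_density_of_optimal (h : M.IsOptimal M.fullyRevealing)
    (hd : DifferentiableOn ℝ M.f (Ioo M.θl M.θh)) : AntitoneOn M.f M.types := by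
  refine antitoneOn_of_deriv_nonpos (convex_Icc _ _) M.f_cont ?_ ?_
  · rwa [interior_Icc]
  · rw [interior_Icc]
    exact fun θ hθ => deriv_density_nonpos_of_optimal h hd hθ

end RatingModel

namespace RatingModel

variable {M : RatingModel}

/-! ### Noisy tests: quality is revealed or replaced by one uninformative score -/

/-- The score is the quality `x`, but with probability `p x` it is replaced by the score `-1`. -/
def noisyKernel (p : M.Quality → ℝ) (hp : Measurable p) : Kernel M.Quality ℝ where
  toFun x := ENNReal.ofReal (1 - p x) • Measure.dirac (x : ℝ) +
    ENNReal.ofReal (p x) • Measure.dirac (-1)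
  measurable' := by
    refine Measure.measurable_of_measurable_coe _ fun s hs => ?_
    simp only [Measure.add_apply, Measure.smul_apply, smul_eq_mul, Measure.dirac_apply' _ hs]
    exact ((measurable_const.sub hp).ennreal_ofReal.mul
      ((measurable_one.indicator hs).comp measurable_subtype_coe)).add
      (hp.ennreal_ofReal.mul_const _)

theorem noisyKernel_apply (p : M.Quality → ℝ) (hp : Measurable p) (x : M.Quality) :
    noisyKernel p hp x = ENNReal.ofReal (1 - p x) • Measure.dirac (x : ℝ) +
      ENNReal.ofReal (p x) • Measure.dirac (-1) := rfl

theorem isMarkovKernel_noisyKernel (p : M.Quality → ℝ) (hp : Measurable p)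
    (hp01 : ∀ x, p x ∈ Icc 0 1) : IsMarkovKernel (noisyKernel p hp) := by
  refine ⟨fun x => ⟨?_⟩⟩
  rw [noisyKernel_apply]
  simp only [Measure.add_apply, Measure.smul_apply, smul_eq_mul, measure_univ, mul_one]
  rw [← ENNReal.ofReal_add (sub_nonneg.2 (hp01 x).2) (hp01 x).1]
  simp

theorem lintegral_noisyKernel (p : M.Quality → ℝ) (hp : Measurable p) (x : M.Quality)
    {g : ℝ → ENNReal} (hg : Measurable g) :
    ∫⁻ s, g s ∂(noisyKernel p hp x) =
      ENNReal.ofReal (1 - p x) * g x + ENNReal.ofReal (p x) * g (-1) := by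
  rw [noisyKernel_apply, lintegral_add_measure, lintegral_smul_measure, lintegral_smul_measure,
    lintegral_dirac' _ hg, lintegral_dirac' _ hg, smul_eq_mul, smul_eq_mul]

theorem neg_one_mem_support_noisyKernel {p : M.Quality → ℝ} {hp : Measurable p} {x : M.Quality}
    (h : 0 < p x) : (-1 : ℝ) ∈ (noisyKernel p hp x).support := by
  rw [noisyKernel_apply, Measure.mem_support_iff_forall]
  intro U hU
  simp only [Measure.add_apply, Measure.smul_apply, smul_eq_mul]
  rw [Measure.dirac_apply_of_mem (mem_of_mem_nhds hU), mul_one]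
  exact lt_of_lt_of_le (ENNReal.ofReal_pos.2 h) le_add_self

theorem eq_of_mem_support_noisyKernel {p : M.Quality → ℝ} {hp : Measurable p} {x : M.Quality}
    {s : ℝ} (h : s ∈ (noisyKernel p hp x).support) (hs : s ≠ -1) : s = x := by
  have hcl : IsClosed ({(x : ℝ), -1} : Set ℝ) := (Set.toFinite _).isClosed
  have := Measure.support_subset_of_isClosed (μ := noisyKernel p hp x) hcl (by
    rw [noisyKernel_apply, mem_ae_iff]
    simp [Measure.add_apply]) h
  rcases this with h | h
  · exact h
  · exact absurd h hs

/-- If the score `-1` has positive probability and leads to the mean belief `μ`, optimal choices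
form an equilibrium of the noisy test. -/
theorem exists_equilibrium_noisy {p : M.Quality → ℝ} (hp : Measurable p)
    (hp01 : ∀ x, p x ∈ Icc 0 1) {μ : ℝ} {quality : ℝ → M.Quality} (hq : Measurable quality)
    (hbayes : ∫ θ, p (quality θ) * (μ - quality θ) ∂M.prior = 0)
    (hpos : 0 < ∫ θ, p (quality θ) ∂M.prior)
    (hopt : ∀ θ ∈ M.types, ∀ x : M.Quality, θ * (x + p x * (μ - x)) - M.c x ≤
      θ * (quality θ + p (quality θ) * (μ - quality θ)) - M.c (quality θ)) :
    ∃ (R : M.RatingScheme) (A : M.Assessment R), A.IsEquilibrium ∧ A.quality = quality := by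
  have hmk := isMarkovKernel_noisyKernel p hp hp01
  let R : M.RatingScheme := { Score := ℝ, kernel := noisyKernel p hp }
  set m : Measure M.Quality := M.prior.map quality with hm
  have hmp : IsProbabilityMeasure m := Measure.isProbabilityMeasure_map hq.aemeasurable
  have hpb : ∀ x, ‖p x‖ ≤ 1 := fun x => by
    rw [Real.norm_eq_abs, abs_of_nonneg (hp01 x).1]; exact (hp01 x).2
  have hpi : Integrable p m := Integrable.of_bound hp.aestronglyMeasurable 1
    (Eventually.of_forall hpb)
  have hpxi : Integrable (fun x : M.Quality => p x * x) m :=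
    (integrable_quality m).bdd_mul hp.aestronglyMeasurable (Eventually.of_forall hpb)
  have hpos' : 0 < ∫ x, p x ∂m := by
    rwa [hm, integral_map hq.aemeasurable hp.aestronglyMeasurable]
  have hmean : ∫ x, p x * x ∂m = μ * ∫ x, p x ∂m := by
    have h1 : ∫ x, p x * (μ - x) ∂m = 0 := by
      have hms : Measurable fun x : M.Quality => p x * (μ - x) :=
        hp.mul (measurable_const.sub measurable_subtype_coe)
      rw [hm, integral_map hq.aemeasurable hms.aestronglyMeasurable]
      exact hbayes
    simp only [mul_sub] at h1
    rw [integral_sub (hpi.mul_const μ) hpxi, integral_mul_const] at h1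
    linarith
  set K : ENNReal := ENNReal.ofReal (∫ x, p x ∂m) with hK
  have hK0 : K ≠ 0 := (ENNReal.ofReal_pos.2 hpos').ne'
  have hKtop : K ≠ ⊤ := ENNReal.ofReal_ne_top
  have hKl : ∫⁻ x, ENNReal.ofReal (p x) ∂m = K :=
    (ofReal_integral_eq_lintegral_ofReal hpi (Eventually.of_forall fun x => (hp01 x).1)).symm
  -- The Bayesian posterior after the uninformative score: the quality law reweighted by the
  -- probability of being hidden.
  let ν : Measure M.Quality := K⁻¹ • m.withDensity fun x => ENNReal.ofReal (p x)
  have hνp : IsProbabilityMeasure ν := by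
    refine ⟨?_⟩
    simp only [ν, Measure.smul_apply, smul_eq_mul]
    rw [withDensity_apply _ MeasurableSet.univ, Measure.restrict_univ, hKl,
      ENNReal.inv_mul_cancel hK0 hKtop]
  have hνmean : ∫ x, (x : ℝ) ∂ν = μ := by
    simp only [ν]
    rw [integral_smul_measure, integral_withDensity_eq_integral_toReal_smul hp.ennreal_ofReal
      (by simp)]
    have h1 : ∀ x : M.Quality, (ENNReal.ofReal (p x)).toReal • (x : ℝ) = p x * x := fun x => by
      rw [ENNReal.toReal_ofReal (hp01 x).1, smul_eq_mul]
    simp only [h1, hmean]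
    rw [ENNReal.toReal_inv, hK, ENNReal.toReal_ofReal hpos'.le, smul_eq_mul]
    field_simp
  let proj : ℝ → M.Quality := projIcc 0 M.qmax M.qmax_pos.le
  have hproj : Measurable proj := continuous_projIcc.measurable
  have hprojx : ∀ x : M.Quality, proj x = x := fun x => projIcc_val M.qmax_pos.le x
  -- Qualities are nonnegative, so `-1` is never a revealed quality. Scores that no quality can
  -- produce receive an arbitrary measurable belief through `proj`.
  let bel : Kernel ℝ M.Quality := Kernel.piecewise (measurableSet_singleton (-1 : ℝ))
    (Kernel.const ℝ ν) (Kernel.deterministic proj hproj)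
  have hbel1 : bel (-1) = ν := by simp [bel, Kernel.piecewise_apply]
  have hbel2 : ∀ s : ℝ, s ≠ -1 → bel s = Measure.dirac (proj s) := fun s hs => by
    simp [bel, Kernel.piecewise_apply, hs, Kernel.deterministic_apply]
  have hxne : ∀ x : M.Quality, (x : ℝ) ≠ -1 := fun x => by linarith [x.2.1]
  have hbelx : ∀ x : M.Quality, bel (x : ℝ) = Measure.dirac x := fun x => by
    rw [hbel2 _ (hxne x), hprojx]
  have hbelm : IsMarkovKernel bel := by
    refine ⟨fun s => ?_⟩
    by_cases hs : s = -1
    · rw [hs, hbel1]; exact hνp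
    · rw [hbel2 s hs]; infer_instance
  let A : M.Assessment R :=
    { quality := quality
      takers := univ
      belief := bel
      nullBelief := Measure.dirac M.zeroQuality }
  have hAm : IsMarkovKernel A.belief := hbelm
  have hwage1 : A.wage (-1 : ℝ) = μ := by
    change ∫ x : M.Quality, (x : ℝ) ∂(bel (-1)) = μ
    rw [hbel1, hνmean]
  have hwagex : ∀ x : M.Quality, A.wage (x : ℝ) = x := fun x => by
    change ∫ y : M.Quality, (y : ℝ) ∂(bel x) = x
    rw [hbelx]
    exact integral_dirac _ _
  have hinterim : ∀ x, A.interimWage x = x + p x * (μ - x) := fun x => by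
    have h1 : A.interimWage x = ∫ s : ℝ, A.wage s ∂(noisyKernel p hp x) := rfl
    rw [h1, noisyKernel_apply, integral_add_measure, integral_smul_measure, integral_smul_measure,
      integral_dirac, integral_dirac, hwage1, hwagex, ENNReal.toReal_ofReal (hp01 x).1,
      ENNReal.toReal_ofReal (sub_nonneg.2 (hp01 x).2)]
    · simp only [smul_eq_mul]; ring
    · exact (A.integrable_wage (Measure.dirac (x : ℝ))).smul_measure ENNReal.ofReal_ne_top
    · exact (A.integrable_wage (Measure.dirac (-1 : ℝ))).smul_measure ENNReal.ofReal_ne_top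
  have hnull : A.nullWage = 0 := by simp [Assessment.nullWage, A, zeroQuality]
  have hpay : ∀ θ, A.payoff θ =
      θ * (quality θ + p (quality θ) * (μ - quality θ)) - M.c (quality θ) := fun θ => by
    simp only [Assessment.payoff, A, mem_univ, if_true, Assessment.payoffTake]
    rw [show A.interimWage (quality θ) = _ from hinterim _]
  have htq : A.takerQuality = m := by simp [Assessment.takerQuality, A, hm]
  refine ⟨R, A, ⟨hq, MeasurableSet.univ, hbelm,
    inferInstanceAs (IsProbabilityMeasure (Measure.dirac _)), ?_, ?_, ?_, ?_, ?_, fun _ => rfl⟩, rfl⟩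
  · intro θ hθ x
    rw [hpay θ, Assessment.payoffTake, hinterim]
    exact hopt θ hθ x
  · intro θ hθ x
    rw [hpay θ, Assessment.payoffDecline, hnull]
    have h1 := hopt θ hθ M.zeroQuality
    have h0 : ((M.zeroQuality : M.Quality) : ℝ) = 0 := rfl
    have hμ : 0 ≤ μ := by rw [← hνmean]; exact integral_nonneg fun x => x.2.1
    have h2 : 0 ≤ θ * (0 + p M.zeroQuality * (μ - 0)) := by
      have := M.θl_nonneg.trans hθ.1
      have := (hp01 M.zeroQuality).1
      rw [zero_add, sub_zero]
      positivity
    rw [h0, M.c_zero] at h1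
    have h4 := M.cost_nonneg x.2
    linarith
  · rw [htq]
    change (m ⊗ₘ noisyKernel p hp).map Prod.swap = (noisyKernel p hp ∘ₘ m) ⊗ₘ bel
    have hfin : IsFiniteMeasure ((m ⊗ₘ noisyKernel p hp).map Prod.swap) :=
      Measure.isFiniteMeasure_map _ _
    -- On a rectangle both laws split into a revealed and a hidden part; the hidden parts agree
    -- because `K * ν T` is the integral of `p` over `T`.
    refine Measure.ext_prod fun {S T} hS hT => ?_
    rw [Measure.map_apply measurable_swap (hS.prod hT), preimage_swap_prod,
      Measure.compProd_apply_prod hT hS, Measure.compProd_apply_prod hS hT,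
      ← lintegral_indicator hS, Measure.lintegral_bind (noisyKernel p hp).measurable.aemeasurable
        ((bel.measurable_coe hT).indicator hS).aemeasurable, ← lintegral_indicator hT]
    have hR : ∀ x : M.Quality,
        ∫⁻ s, S.indicator (fun s => bel s T) s ∂(noisyKernel p hp x) =
          ENNReal.ofReal (1 - p x) * S.indicator 1 (x : ℝ) * T.indicator 1 x +
            ENNReal.ofReal (p x) * (S.indicator 1 (-1 : ℝ) * ν T) := fun x => by
      rw [lintegral_noisyKernel p hp x ((bel.measurable_coe hT).indicator hS)]
      congr 1
      · by_cases hx : (x : ℝ) ∈ S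
        · simp [hx, hbelx, Measure.dirac_apply' _ hT]
        · simp [hx]
      · by_cases hx : (-1 : ℝ) ∈ S
        · simp [hx, hbel1]
        · simp [hx]
    have hL : ∀ x : M.Quality, T.indicator (fun x => noisyKernel p hp x S) x =
        ENNReal.ofReal (1 - p x) * S.indicator 1 (x : ℝ) * T.indicator 1 x +
          S.indicator 1 (-1 : ℝ) * T.indicator (fun x => ENNReal.ofReal (p x)) x := fun x => by
      by_cases hx : x ∈ T
      · simp only [hx, indicator_of_mem, noisyKernel_apply, Measure.add_apply, Measure.smul_apply,
          smul_eq_mul, Measure.dirac_apply' _ hS, Pi.one_apply, mul_one]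
        rw [mul_comm (ENNReal.ofReal (p x))]
      · simp [hx]
    simp only [hR, hL]
    have hmeas : Measurable fun x : M.Quality =>
        ENNReal.ofReal (1 - p x) * S.indicator 1 (x : ℝ) * T.indicator 1 x :=
      ((measurable_const.sub hp).ennreal_ofReal.mul ((measurable_one.indicator hS).comp
        measurable_subtype_coe)).mul (measurable_one.indicator hT)
    rw [lintegral_add_left hmeas, lintegral_add_left hmeas,
      lintegral_const_mul _ (hp.ennreal_ofReal.indicator hT),
      lintegral_mul_const _ hp.ennreal_ofReal, hKl, lintegral_indicator hT]
    congr 1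
    simp only [ν, Measure.smul_apply, smul_eq_mul]
    rw [withDensity_apply _ hT, mul_left_comm, ← mul_assoc K, ENNReal.mul_inv_cancel hK0 hKtop,
      one_mul]
  · rintro s ⟨x, hx⟩
    change ∀ᵐ y ∂(bel s), s ∈ (noisyKernel p hp y).support
    by_cases hs : s = -1
    · subst hs
      rw [hbel1]
      have h1 : ∀ᵐ y ∂(m.withDensity fun x => ENNReal.ofReal (p x)), 0 < p y := by
        rw [ae_withDensity_iff hp.ennreal_ofReal]
        exact Eventually.of_forall fun y hy => ENNReal.ofReal_pos.1 (pos_iff_ne_zero.2 hy)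
      have h2 : ∀ᵐ y ∂ν, 0 < p y := Measure.ae_smul_measure h1 _
      filter_upwards [h2] with y hy using neg_one_mem_support_noisyKernel hy
    · have h1 := eq_of_mem_support_noisyKernel (hp := hp) hx hs
      rw [h1, hbelx, ae_dirac_eq, eventually_pure]
      rwa [← h1]
  · simp [A]

end RatingModel

/-- Maximizers over a compact space depend continuously on parameters where they are unique. -/
theorem continuousAt_argmax {Y X : Type*} [TopologicalSpace Y] [TopologicalSpace X]
    [CompactSpace X] {Φ : Y × X → ℝ} (hΦ : Continuous Φ) {s : Y → X}
    (hs : ∀ y z, Φ (y, z) ≤ Φ (y, s y)) {y₀ : Y}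
    (huniq : ∀ x, (∀ z, Φ (y₀, z) ≤ Φ (y₀, x)) → x = s y₀) : ContinuousAt s y₀ := by
  refine isCompact_univ.tendsto_nhds_of_unique_mapClusterPt
    (Eventually.of_forall fun _ => mem_univ _) fun x _ hx => huniq x fun z => ?_
  obtain ⟨U, hU, hUs⟩ := mapClusterPt_iff_ultrafilter.1 hx
  have h1 : Tendsto (fun y => Φ (y, z)) U (𝓝 (Φ (y₀, z))) :=
    ((hΦ.comp (continuous_id.prodMk continuous_const)).tendsto y₀).mono_left hU
  have h2 : Tendsto (fun y => Φ (y, s y)) U (𝓝 (Φ (y₀, x))) :=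
    (hΦ.tendsto (y₀, x)).comp ((tendsto_id.mono_left hU).prodMk_nhds hUs)
  exact le_of_tendsto_of_tendsto' h1 h2 fun y => hs y z

namespace RatingModel

variable {M : RatingModel}

/-! ### Slightly noisy tests -/

/-- The interim wage if quality `x` is hidden with probability `y.1 * P x`, where hidden quality is
rewarded by the wage `y.2 / y.1`. -/
def noisyWage (P : C(M.Quality, ℝ)) (y : ℝ × ℝ) (x : M.Quality) : ℝ :=
  x - y.1 * (P x * x) + y.2 * P x

/-- The coordinates `(ε, ε * μ)` make the wage affine in `y` and continuous at `0`, so optimal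
qualities converge as `ε → 0` whatever `μ` does. -/
theorem continuous_noisySurplus (P : C(M.Quality, ℝ)) (θ : ℝ) :
    Continuous fun p : (ℝ × ℝ) × M.Quality => θ * noisyWage P p.1 p.2 - M.c p.2 := by
  have hc : Continuous fun x : M.Quality => M.c x :=
    continuousOn_iff_continuous_domRestrict.1 M.cost_continuousOn
  unfold noisyWage
  have hc' := hc.comp (continuous_snd (X := ℝ × ℝ))
  have hP := P.continuous.comp (continuous_snd (X := ℝ × ℝ))
  have hx := continuous_subtype_val.comp (continuous_snd (X := ℝ × ℝ) (Y := M.Quality))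
  have h1 := continuous_fst.comp (continuous_fst (X := ℝ × ℝ) (Y := M.Quality))
  have h2 := continuous_snd.comp (continuous_fst (X := ℝ × ℝ) (Y := M.Quality))
  exact (continuous_const.mul ((hx.sub (h1.mul (hP.mul hx))).add (h2.mul hP))).sub hc'

instance : Nonempty M.Quality := ⟨M.zeroQuality⟩

theorem exists_noisyQuality (P : C(M.Quality, ℝ)) (y : ℝ × ℝ) (θ : ℝ) :
    ∃ x : M.Quality, ∀ z : M.Quality,
      θ * noisyWage P y z - M.c z ≤ θ * noisyWage P y x - M.c x := by
  have hcont : Continuous fun x : M.Quality => θ * noisyWage P y x - M.c x :=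
    (continuous_noisySurplus P θ).comp (continuous_const.prodMk continuous_id)
  obtain ⟨x, -, hx⟩ := isCompact_univ.exists_isMaxOn univ_nonempty hcont.continuousOn
  exact ⟨x, fun z => hx (mem_univ z)⟩

/-- An optimal quality under the wage `noisyWage`, constant outside the set of types. -/
def noisyQuality (P : C(M.Quality, ℝ)) (y : ℝ × ℝ) (θ : ℝ) : M.Quality :=
  (exists_noisyQuality P y (projIcc M.θl M.θh M.θl_lt_θh.le θ)).choose

theorem noisyQuality_optimal (P : C(M.Quality, ℝ)) (y : ℝ × ℝ) {θ : ℝ} (hθ : θ ∈ M.types)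
    (z : M.Quality) : θ * noisyWage P y z - M.c z ≤
      θ * noisyWage P y (noisyQuality P y θ) - M.c (noisyQuality P y θ) := by
  have h : (projIcc M.θl M.θh M.θl_lt_θh.le θ : ℝ) * noisyWage P y z - M.c z ≤
      (projIcc M.θl M.θh M.θl_lt_θh.le θ : ℝ) * noisyWage P y (noisyQuality P y θ) -
        M.c (noisyQuality P y θ) :=
    (exists_noisyQuality P y (projIcc M.θl M.θh M.θl_lt_θh.le θ)).choose_spec z
  have he : (projIcc M.θl M.θh M.θl_lt_θh.le θ : ℝ) = θ := by rw [projIcc_of_mem _ hθ]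
  rwa [he] at h

theorem implementable_noisyQuality {P : C(M.Quality, ℝ)} (hP : ∀ x, 0 ≤ P x) {y : ℝ × ℝ}
    (hy : 0 ≤ y.2) : M.Implementable (fun θ => noisyQuality P y θ)
      (fun θ => noisyWage P y (noisyQuality P y θ)) where
  mem θ _ := (noisyQuality P y θ).2
  ic θ hθ θ' _ := noisyQuality_optimal P y hθ _
  ir θ hθ := by
    refine le_trans ?_ (noisyQuality_optimal P y hθ M.zeroQuality)
    have h1 := M.θl_nonneg.trans hθ.1
    have h2 := hP M.zeroQuality
    simp only [noisyWage, zeroQuality, M.c_zero] at *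
    simp only [mul_zero, sub_zero, zero_add]
    positivity

/-- Maximizers are picked by choice; measurability comes from monotonicity in the type, extended to
the line by projection. -/
theorem measurable_noisyQuality {P : C(M.Quality, ℝ)} (hP : ∀ x, 0 ≤ P x) {y : ℝ × ℝ}
    (hy : 0 ≤ y.2) : Measurable (noisyQuality P y) := by
  refine Monotone.measurable fun θ θ' h => ?_
  have h1 := (implementable_noisyQuality hP hy).quality_mono
    (projIcc M.θl M.θh M.θl_lt_θh.le θ).2 (projIcc M.θl M.θh M.θl_lt_θh.le θ').2
    (monotone_projIcc M.θl_lt_θh.le h)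
  have he : ∀ θ, noisyQuality P y (projIcc M.θl M.θh M.θl_lt_θh.le θ : Icc M.θl M.θh) =
      noisyQuality P y θ := fun θ => by
    unfold noisyQuality
    simp only [projIcc_val]
  simp only [he] at h1
  exact h1

/-- Almost every type has a unique optimal quality. -/
theorem ae_noisyQuality_unique {P : C(M.Quality, ℝ)} (hP : ∀ x, 0 ≤ P x) {y : ℝ × ℝ}
    (hy : 0 ≤ y.2) : ∀ᵐ θ ∂M.prior, θ ∈ M.types ∧ ∀ x : M.Quality,
      (∀ z : M.Quality, θ * noisyWage P y z - M.c z ≤ θ * noisyWage P y x - M.c x) →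
        x = noisyQuality P y θ := by
  have hI := implementable_noisyQuality hP hy
  obtain ⟨s, hs, hd⟩ := hI.exists_countable_hasDerivAt
  refine M.ae_prior_of_ae ?_
  filter_upwards [hs.ae_notMem volume, (Set.finite_singleton M.θl).countable.ae_notMem volume,
    (Set.finite_singleton M.θh).countable.ae_notMem volume] with θ h1 h2 h3 hθ
  refine ⟨hθ, fun x hx => ?_⟩
  have hθo : θ ∈ Ioo M.θl M.θh :=
    ⟨lt_of_le_of_ne hθ.1 (Ne.symm h2), lt_of_le_of_ne hθ.2 h3⟩
  have hder := (hd θ ⟨hθo, h1⟩).sub ((hasDerivAt_id θ).mul_const (noisyWage P y x))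
  -- The payoff from `x` is an affine minorant of the utility that touches it at `θ`. Where the
  -- utility is differentiable this fixes the wage of `x`, then its cost, then `x` itself.
  have hmin : IsLocalMin (fun θ' => M.utility (fun θ => noisyQuality P y θ)
      (fun θ => noisyWage P y (noisyQuality P y θ)) θ' - id θ' * noisyWage P y x) θ := by
    filter_upwards [Icc_mem_nhds hθo.1 hθo.2] with θ' hθ'
    have h4 := noisyQuality_optimal P y hθ' x
    have h5 := hx (noisyQuality P y θ)
    simp only [utility, id]
    linarith
  have hw := hmin.hasDerivAt_eq_zero hder
  rw [one_mul] at hw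
  have h6 := hx (noisyQuality P y θ)
  have h7 := noisyQuality_optimal P y hθ x
  rw [sub_eq_zero.1 hw] at h6 h7
  exact Subtype.ext (M.cost_strictMonoOn.injOn x.2 (noisyQuality P y θ).2 (by linarith))

theorem continuousAt_noisyQuality (P : C(M.Quality, ℝ)) {y : ℝ × ℝ} {θ : ℝ} (hθ : θ ∈ M.types)
    (h : ∀ x : M.Quality, (∀ z : M.Quality,
      θ * noisyWage P y z - M.c z ≤ θ * noisyWage P y x - M.c x) → x = noisyQuality P y θ) :
    ContinuousAt (fun y => noisyQuality P y θ) y :=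
  continuousAt_argmax (continuous_noisySurplus P θ) (fun y z => noisyQuality_optimal P y hθ z) h

theorem noisyQuality_zero (P : C(M.Quality, ℝ)) {θ : ℝ} (hθ : θ ∈ M.types) :
    noisyQuality P 0 θ = M.bestQuality θ := by
  refine Subtype.ext (M.bestQuality_unique (noisyQuality P 0 θ).2 ?_)
  simpa [noisyWage] using noisyQuality_optimal P 0 hθ (M.bestQuality θ)

theorem tendsto_noisyQuality (P : C(M.Quality, ℝ)) {θ : ℝ} (hθ : θ ∈ M.types) :
    Tendsto (fun y => noisyQuality P y θ) (𝓝 0) (𝓝 (M.bestQuality θ)) := by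
  rw [← noisyQuality_zero P hθ]
  refine continuousAt_noisyQuality P hθ fun x hx => ?_
  rw [noisyQuality_zero P hθ]
  refine Subtype.ext (M.bestQuality_unique x.2 ?_)
  simpa [noisyWage] using hx (M.bestQuality θ)

theorem abs_mul_quality_le {P : C(M.Quality, ℝ)} (hP : ∀ x, P x ∈ Icc (0 : ℝ) 1)
    (x : M.Quality) : ‖P x * x‖ ≤ M.qmax := by
  rw [Real.norm_eq_abs, abs_of_nonneg (mul_nonneg (hP x).1 x.2.1)]
  have := mul_le_mul (hP x).2 x.2.2 x.2.1 zero_le_one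
  linarith

theorem norm_le_one_of_mem {P : C(M.Quality, ℝ)} (hP : ∀ x, P x ∈ Icc (0 : ℝ) 1)
    (x : M.Quality) : ‖P x‖ ≤ 1 := by
  rw [Real.norm_eq_abs, abs_of_nonneg (hP x).1]
  exact (hP x).2

/-- The wage of the uninformative score can be chosen in line with Bayes' rule. -/
theorem exists_bayes_wage {P : C(M.Quality, ℝ)} (hP : ∀ x, P x ∈ Icc (0 : ℝ) 1) {ε : ℝ}
    (hε : 0 ≤ ε) : ∃ μ ∈ Icc 0 M.qmax,
      ∫ θ, P (noisyQuality P (ε, ε * μ) θ) * (μ - noisyQuality P (ε, ε * μ) θ) ∂M.prior = 0 := by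
  have hm : ∀ μ ∈ Icc 0 M.qmax, Measurable (noisyQuality P (ε, ε * μ)) := fun μ hμ =>
    measurable_noisyQuality (fun x => (hP x).1) (mul_nonneg hε hμ.1)
  have hcont : ContinuousOn (fun μ => ∫ θ, P (noisyQuality P (ε, ε * μ) θ) *
      (μ - noisyQuality P (ε, ε * μ) θ) ∂M.prior) (Icc 0 M.qmax) := by
    intro μ hμ
    refine continuousWithinAt_of_dominated (bound := fun _ => M.qmax) ?_ ?_
      (integrable_const _) ?_
    · filter_upwards [self_mem_nhdsWithin] with μ' hμ'
      exact ((P.continuous.measurable.comp (hm μ' hμ')).mul (measurable_const.sub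
        (measurable_subtype_coe.comp (hm μ' hμ')))).aestronglyMeasurable
    · filter_upwards [self_mem_nhdsWithin] with μ' hμ'
      refine Eventually.of_forall fun θ => ?_
      set x := noisyQuality P (ε, ε * μ') θ
      rw [norm_mul]
      have h1 : ‖μ' - (x : ℝ)‖ ≤ M.qmax := by
        rw [Real.norm_eq_abs, abs_le]
        constructor <;> linarith [hμ'.1, hμ'.2, x.2.1, x.2.2]
      calc ‖P x‖ * ‖μ' - (x : ℝ)‖ ≤ 1 * M.qmax :=
            mul_le_mul (norm_le_one_of_mem hP x) h1 (norm_nonneg _) zero_le_one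
        _ = M.qmax := one_mul _
    · filter_upwards [ae_noisyQuality_unique (P := P) (y := (ε, ε * μ)) (fun x => (hP x).1)
        (mul_nonneg hε hμ.1)] with θ hθ
      have h1 : ContinuousAt (fun μ' : ℝ => noisyQuality P (ε, ε * μ') θ) μ :=
        ContinuousAt.comp (f := fun μ' : ℝ => (ε, ε * μ'))
          (g := fun y => noisyQuality P y θ) (continuousAt_noisyQuality P hθ.1 hθ.2)
          (continuous_const.prodMk (continuous_const.mul continuous_id)).continuousAt
      exact ((P.continuous.continuousAt.comp h1).mul (continuousAt_id.sub
        (continuous_subtype_val.continuousAt.comp h1))).continuousWithinAt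
  have h0 : (0 : ℝ) ∈ (fun μ => ∫ θ, P (noisyQuality P (ε, ε * μ) θ) *
      (μ - noisyQuality P (ε, ε * μ) θ) ∂M.prior) '' Icc 0 M.qmax := by
    -- The hidden wage is a fixed point, since qualities react to it; almost sure uniqueness of
    -- choices made the excess wage continuous in `μ`, and it changes sign between `0` and `qmax`.
    refine intermediate_value_Icc M.qmax_pos.le hcont ⟨?_, ?_⟩
    · refine integral_nonpos fun θ => ?_
      exact mul_nonpos_of_nonneg_of_nonpos (hP _).1
        (sub_nonpos.2 (noisyQuality P (ε, ε * 0) θ).2.1)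
    · refine integral_nonneg fun θ => ?_
      exact mul_nonneg (hP _).1 (sub_nonneg.2 (noisyQuality P (ε, ε * M.qmax) θ).2.2)
  exact h0

/-- Optimality of full revelation excludes gains from slightly noisy tests. -/
theorem noisy_gain_nonpos (h : M.IsOptimal M.fullyRevealing) (hf : AntitoneOn M.f M.types)
    (hd : DifferentiableOn ℝ M.f (Ioo M.θl M.θh)) (h0 : M.θl = 0) {P : C(M.Quality, ℝ)}
    (hP : ∀ x, P x ∈ Icc (0 : ℝ) 1) (hPh : P (M.bestQuality M.θh) = 0) {ε μ : ℝ}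
    (hε : 0 < ε) (hε1 : ε ≤ 1) (hμ : μ ∈ Icc 0 M.qmax)
    (hb : ∫ θ, P (noisyQuality P (ε, ε * μ) θ) * (μ - noisyQuality P (ε, ε * μ) θ) ∂M.prior = 0)
    (hpos : 0 < ∫ θ, P (noisyQuality P (ε, ε * μ) θ) ∂M.prior) :
    μ * ∫ θ in M.θl..M.θh, -deriv M.f θ * (θ * P (M.bestQuality θ)) ≤
      ∫ θ in M.θl..M.θh, -deriv M.f θ * (θ * (P (M.bestQuality θ) * M.bestQ θ)) := by
  rw [isOptimal_fullyRevealing_iff] at h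
  have hI := implementable_noisyQuality (P := P) (y := (ε, ε * μ)) (fun x => (hP x).1)
    (mul_nonneg hε.le hμ.1)
  have hm := measurable_noisyQuality (P := P) (y := (ε, ε * μ)) (fun x => (hP x).1)
    (mul_nonneg hε.le hμ.1)
  have hopt := fun θ hθ => noisyQuality_optimal P (ε, ε * μ) (θ := θ) hθ
  set q := noisyQuality P (ε, ε * μ) with hq
  have hw : ∀ x, noisyWage P (ε, ε * μ) x = x + ε * P x * (μ - x) := fun x => by
    unfold noisyWage; ring
  simp only [hw] at hI hopt
  obtain ⟨R, A, hA, hAq⟩ := exists_equilibrium_noisy (p := fun x => ε * P x) (μ := μ)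
    (P.continuous.measurable.const_mul ε)
    (fun x => ⟨mul_nonneg hε.le (hP x).1, mul_le_one₀ hε1 (hP x).1 (hP x).2⟩) hm
    (by simp only [mul_assoc, integral_const_mul, hb, mul_zero])
    (by rw [integral_const_mul]; exact mul_pos hε hpos) hopt
  have hle := h R A hA
  rw [A.expectedQuality_eq, hAq] at hle
  have hbal : ∫ θ in M.θl..M.θh, M.f θ * ((q θ : ℝ) - (q θ + ε * P (q θ) * (μ - q θ))) = 0 := by
    rw [← M.integral_prior]
    have : ∀ θ, ((q θ : ℝ) - (q θ + ε * P (q θ) * (μ - q θ))) =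
        -ε * (P (q θ) * (μ - q θ)) := fun θ => by ring
    simp only [this, integral_const_mul, hb, mul_zero]
  have hgain := hI.expected_sub_bestQ hbal hf hd h0
  set U := M.utility (fun θ => (q θ : ℝ)) fun θ => q θ + ε * P (q θ) * (μ - q θ) with hU
  -- Keeping the old quality is an available deviation, which gives a bound linear in `ε` with no
  -- error term. At `θh` it is zero because `P` vanishes there.
  have hUge : ∀ θ ∈ M.types, ε * (θ * (P (M.bestQuality θ) * (μ - M.bestQ θ))) ≤
      U θ - M.utility M.bestQ M.bestQ θ := fun θ hθ => by
    have := hopt θ hθ (M.bestQuality θ)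
    simp only [hU, utility, bestQ] at *
    linarith
  have htop : 0 ≤ U M.θh - M.utility M.bestQ M.bestQ M.θh := by
    have := hUge M.θh right_mem_types
    rwa [hPh, zero_mul, mul_zero, mul_zero] at this
  have hbc : ContinuousOn M.bestQ M.types := bestQ_continuousOn.mono M.types_subset
  have hPc : ContinuousOn (fun θ => P (M.bestQuality θ)) M.types :=
    P.continuous.comp_continuousOn (M.bestQuality_continuousOn.mono M.types_subset)
  have huIcc : uIcc M.θl M.θh ⊆ M.types := uIcc_subset_Icc left_mem_types right_mem_types
  have hfi := deriv_density_intervalIntegrable hf hd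
  have hi : ∀ {g : ℝ → ℝ}, ContinuousOn g M.types →
      IntervalIntegrable (fun θ => -deriv M.f θ * g θ) volume M.θl M.θh := fun hg =>
    hfi.mul_continuousOn (hg.mono huIcc)
  have hi0 : IntervalIntegrable (fun θ => -deriv M.f θ * (θ * P (M.bestQuality θ))) volume
      M.θl M.θh := hi (continuousOn_id.mul hPc)
  have hi1 : IntervalIntegrable (fun θ => -deriv M.f θ * (θ * (P (M.bestQuality θ) * M.bestQ θ)))
      volume M.θl M.θh := hi (continuousOn_id.mul (hPc.mul hbc))
  have hlow : ∫ θ in M.θl..M.θh, -deriv M.f θ *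
      (ε * (θ * (P (M.bestQuality θ) * (μ - M.bestQ θ)))) ≤
      ∫ θ in M.θl..M.θh, -deriv M.f θ * (U θ - M.utility M.bestQ M.bestQ θ) := by
    refine intervalIntegral.integral_mono_on_of_le_Ioo M.θl_lt_θh.le
      (hi (continuousOn_const.mul (continuousOn_id.mul (hPc.mul (continuousOn_const.sub hbc)))))
      (hi (hI.utility_continuousOn.sub implementable_bestQ.utility_continuousOn)) fun θ hθ => ?_
    exact mul_le_mul_of_nonneg_left (hUge θ (Ioo_subset_Icc_self hθ))
      (neg_nonneg.2 (deriv_density_nonpos hf hθ))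
  have hsplit : ∫ θ in M.θl..M.θh, -deriv M.f θ *
      (ε * (θ * (P (M.bestQuality θ) * (μ - M.bestQ θ)))) =
      ε * (μ * (∫ θ in M.θl..M.θh, -deriv M.f θ * (θ * P (M.bestQuality θ))) -
        ∫ θ in M.θl..M.θh, -deriv M.f θ * (θ * (P (M.bestQuality θ) * M.bestQ θ))) := by
    rw [← intervalIntegral.integral_const_mul, ← intervalIntegral.integral_sub
      (hi0.const_mul μ) hi1, ← intervalIntegral.integral_const_mul]
    exact intervalIntegral.integral_congr fun θ _ => by ring
  have h1 := mul_nonneg (M.f_pos _ right_mem_types).le htop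
  have h2 : ε * (μ * (∫ θ in M.θl..M.θh, -deriv M.f θ * (θ * P (M.bestQuality θ))) -
        ∫ θ in M.θl..M.θh, -deriv M.f θ * (θ * (P (M.bestQuality θ) * M.bestQ θ))) ≤ 0 := by
    linarith
  exact sub_nonpos.1 (nonpos_of_mul_nonpos_right h2 hε)

/-- Under optimality of full revelation, `-M.elasticity` and efficient quality are positively
correlated under every reweighting of types. -/
theorem covariance_nonneg_of_optimal (h : M.IsOptimal M.fullyRevealing)
    (hf : AntitoneOn M.f M.types) (hd : DifferentiableOn ℝ M.f (Ioo M.θl M.θh)) (h0 : M.θl = 0)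
    {P : C(M.Quality, ℝ)} (hP : ∀ x, P x ∈ Icc (0 : ℝ) 1) (hPh : P (M.bestQuality M.θh) = 0) :
    (∫ θ in M.θl..M.θh, -deriv M.f θ * (θ * P (M.bestQuality θ))) *
        (∫ θ in M.θl..M.θh, M.f θ * (P (M.bestQuality θ) * M.bestQ θ)) ≤
      (∫ θ in M.θl..M.θh, -deriv M.f θ * (θ * (P (M.bestQuality θ) * M.bestQ θ))) *
        ∫ θ in M.θl..M.θh, M.f θ * P (M.bestQuality θ) := by
  set C₀ := ∫ θ in M.θl..M.θh, -deriv M.f θ * (θ * P (M.bestQuality θ))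
  set C₁ := ∫ θ in M.θl..M.θh, -deriv M.f θ * (θ * (P (M.bestQuality θ) * M.bestQ θ))
  simp only [← M.integral_prior]
  let ε : ℕ → ℝ := fun n => 1 / ((n : ℝ) + 1)
  have hε : ∀ n, 0 < ε n := fun n => by positivity
  have hε1 : ∀ n, ε n ≤ 1 := fun n => by
    rw [div_le_one (by positivity)]
    have : (0 : ℝ) ≤ n := by positivity
    linarith
  have hεt : Tendsto ε atTop (𝓝 0) := tendsto_one_div_add_atTop_nhds_zero_nat
  choose μ hμ hb using fun n => exists_bayes_wage hP (hε n).le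
  let q : ℕ → ℝ → M.Quality := fun n => noisyQuality P (ε n, ε n * μ n)
  have hqm : ∀ n, Measurable (q n) := fun n =>
    measurable_noisyQuality (fun x => (hP x).1) (mul_nonneg (hε n).le (hμ n).1)
  have hyt : Tendsto (fun n => (ε n, ε n * μ n)) atTop (𝓝 (0 : ℝ × ℝ)) := by
    refine hεt.prodMk_nhds (squeeze_zero (fun n => mul_nonneg (hε n).le (hμ n).1)
      (fun n => mul_le_mul_of_nonneg_left (hμ n).2 (hε n).le) ?_)
    simpa using hεt.mul_const M.qmax
  have hqt : ∀ θ ∈ M.types, Tendsto (fun n => q n θ) atTop (𝓝 (M.bestQuality θ)) := fun θ hθ =>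
    (tendsto_noisyQuality P hθ).comp hyt
  have hPm : ∀ n, Measurable fun θ => P (q n θ) := fun n => P.continuous.measurable.comp (hqm n)
  have hPqm : ∀ n, Measurable fun θ => P (q n θ) * (q n θ : ℝ) := fun n =>
    (hPm n).mul (measurable_subtype_coe.comp (hqm n))
  have hi0 : ∀ n, Integrable (fun θ => P (q n θ)) M.prior := fun n =>
    Integrable.of_bound (hPm n).aestronglyMeasurable 1
      (Eventually.of_forall fun θ => norm_le_one_of_mem hP _)
  have hi1 : ∀ n, Integrable (fun θ => P (q n θ) * (q n θ : ℝ)) M.prior := fun n =>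
    Integrable.of_bound (hPqm n).aestronglyMeasurable M.qmax
      (Eventually.of_forall fun θ => abs_mul_quality_le hP _)
  have hlim0 : Tendsto (fun n => ∫ θ, P (q n θ) ∂M.prior) atTop
      (𝓝 (∫ θ, P (M.bestQuality θ) ∂M.prior)) := by
    refine tendsto_integral_of_dominated_convergence (fun _ => 1)
      (fun n => (hPm n).aestronglyMeasurable) (integrable_const _)
      (fun n => Eventually.of_forall fun θ => norm_le_one_of_mem hP _) ?_
    filter_upwards [M.ae_prior_mem] with θ hθ
    exact (P.continuous.tendsto _).comp (hqt θ hθ)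
  have hlim1 : Tendsto (fun n => ∫ θ, P (q n θ) * (q n θ : ℝ) ∂M.prior) atTop
      (𝓝 (∫ θ, P (M.bestQuality θ) * M.bestQ θ ∂M.prior)) := by
    refine tendsto_integral_of_dominated_convergence (fun _ => M.qmax)
      (fun n => (hPqm n).aestronglyMeasurable) (integrable_const _)
      (fun n => Eventually.of_forall fun θ => abs_mul_quality_le hP _) ?_
    filter_upwards [M.ae_prior_mem] with θ hθ
    exact ((P.continuous.tendsto _).comp (hqt θ hθ)).mul
      ((continuous_subtype_val.tendsto _).comp (hqt θ hθ))
  refine le_of_tendsto_of_tendsto' (hlim1.const_mul C₀) (hlim0.const_mul C₁) fun n => ?_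
  have hmean : ∫ θ, P (q n θ) * (q n θ : ℝ) ∂M.prior = μ n * ∫ θ, P (q n θ) ∂M.prior := by
    have h1 := hb n
    simp only [mul_sub] at h1
    rw [integral_sub ((hi0 n).mul_const _) (hi1 n), integral_mul_const] at h1
    linarith
  -- Writing `E[P * q]` as `μ * E[P]` avoids dividing by the hidden mass, which may be zero.
  rcases (integral_nonneg fun θ => (hP (q n θ)).1 :
    0 ≤ ∫ θ, P (q n θ) ∂M.prior).eq_or_lt with hz | hpos
  · rw [hmean, ← hz]; simp
  · have := noisy_gain_nonpos h hf hd h0 hP hPh (hε n) (hε1 n) (hμ n) (hb n) hpos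
    rw [hmean]
    have := mul_le_mul_of_nonneg_right this hpos.le
    linarith

end RatingModel

namespace RatingModel

variable {M : RatingModel}

/-! ### The elasticity of the density -/

theorem integral_mul_indicator_tendsto {g : ℝ → ℝ} (hg : IntervalIntegrable g volume M.θl M.θh)
    {S : Set ℝ} (hS : IsClosed S) (hSs : S ⊆ Ioo M.θl M.θh) {ρ : ℕ → ℝ → ℝ}
    (hρm : ∀ n, ContinuousOn (ρ n) M.types) (hρ : ∀ n θ, ‖ρ n θ‖ ≤ 1)
    (hlim : ∀ θ ∈ M.types, Tendsto (fun n => ρ n θ) atTop (𝓝 (S.indicator (fun _ => 1) θ))) :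
    Tendsto (fun n => ∫ θ in M.θl..M.θh, g θ * ρ n θ) atTop (𝓝 (∫ θ in S, g θ)) := by
  have hgi := (intervalIntegrable_iff_integrableOn_Ioc_of_le M.θl_lt_θh.le).1 hg
  have hval : ∫ θ in S, g θ = ∫ θ in Ioc M.θl M.θh, g θ * S.indicator (fun _ => 1) θ := by
    have h1 : ∀ θ, g θ * S.indicator (fun _ => (1 : ℝ)) θ = S.indicator g θ := fun θ => by
      by_cases h : θ ∈ S <;> simp [h]
    simp only [h1]
    rw [setIntegral_indicator hS.measurableSet,
      inter_eq_self_of_subset_right (hSs.trans Ioo_subset_Ioc_self)]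
  rw [hval]
  simp only [intervalIntegral.integral_of_le M.θl_lt_θh.le]
  refine tendsto_integral_of_dominated_convergence (fun θ => ‖g θ‖) (fun n => ?_) hgi.norm
    (fun n => Eventually.of_forall fun θ => ?_) ?_
  · exact hgi.aestronglyMeasurable.mul
      (((hρm n).mono Ioc_subset_Icc_self).aestronglyMeasurable measurableSet_Ioc)
  · rw [norm_mul]
    exact mul_le_of_le_one_right (norm_nonneg _) (hρ n θ)
  · refine (ae_restrict_iff' measurableSet_Ioc).2 (Eventually.of_forall fun θ hθ => ?_)
    exact (hlim θ (Ioc_subset_Icc_self hθ)).const_mul _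

/-- The covariance inequality for the types in a closed set. -/
theorem setIntegral_covariance_of_optimal (h : M.IsOptimal M.fullyRevealing)
    (hf : AntitoneOn M.f M.types) (hd : DifferentiableOn ℝ M.f (Ioo M.θl M.θh)) (h0 : M.θl = 0)
    {S : Set ℝ} (hS : IsClosed S) (hSs : S ⊆ Ioo M.θl M.θh) {d : ℝ} (hd' : d < M.θh)
    (hSd : ∀ θ ∈ S, θ ≤ d) :
    (∫ θ in S, -deriv M.f θ * θ) * (∫ θ in S, M.f θ * M.bestQ θ) ≤
      (∫ θ in S, -deriv M.f θ * (θ * M.bestQ θ)) * ∫ θ in S, M.f θ := by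
  have hgap : 0 < M.θh - d := sub_pos.2 hd'
  let δ : ℕ → ℝ := fun n => (M.θh - d) * (1 / ((n : ℝ) + 1))
  have hδ : ∀ n, 0 < δ n := fun n => by positivity
  have hδt : Tendsto δ atTop (𝓝 0) := by
    have h1 : Tendsto δ atTop (𝓝 ((M.θh - d) * 0)) :=
      tendsto_one_div_add_atTop_nhds_zero_nat.const_mul (M.θh - d)
    rwa [mul_zero] at h1
  have hδle : ∀ n, δ n ≤ M.θh - d := fun n => by
    refine mul_le_of_le_one_right hgap.le ?_
    rw [div_le_one (by positivity)]
    have : (0 : ℝ) ≤ n := by positivity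
    linarith
  let T : ℕ → ℝ → ℝ := fun n θ => (thickenedIndicator (hδ n) S θ : ℝ)
  have hTc : ∀ n, Continuous (T n) := fun n =>
    NNReal.continuous_coe.comp (thickenedIndicator (hδ n) S).continuous
  have hT01 : ∀ n θ, T n θ ∈ Icc (0 : ℝ) 1 := fun n θ =>
    ⟨NNReal.coe_nonneg _, by exact_mod_cast thickenedIndicator_le_one (hδ n) S θ⟩
  have hTlim : ∀ θ, Tendsto (fun n => T n θ) atTop (𝓝 (S.indicator (fun _ => 1) θ)) := fun θ => by
    have h1 := (tendsto_pi_nhds.1 (thickenedIndicator_tendsto_indicator_closure hδ hδt S)) θ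
    rw [hS.closure_eq] at h1
    have h2 : Tendsto (fun n => T n θ) atTop
        (𝓝 ((S.indicator (fun _ => (1 : NNReal)) θ : NNReal) : ℝ)) :=
      (NNReal.continuous_coe.tendsto _).comp h1
    have h3 : ((S.indicator (fun _ => (1 : NNReal)) θ : NNReal) : ℝ) =
        S.indicator (fun _ => (1 : ℝ)) θ := by
      by_cases hθ : θ ∈ S <;> simp [hθ]
    rwa [h3] at h2
  have hTh : ∀ n, T n M.θh = 0 := fun n => by
    have : M.θh ∉ Metric.thickening (δ n) S := by
      rw [Metric.mem_thickening_iff]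
      rintro ⟨z, hz, hdist⟩
      have h1 := hSd z hz
      have h2 := hδle n
      rw [Real.dist_eq, abs_of_nonneg (by linarith)] at hdist
      linarith
    simp only [T, thickenedIndicator_zero (hδ n) S this, NNReal.coe_zero]
  -- Marginal cost recovers the type from its efficient quality, so a weight on types becomes a
  -- hiding probability on qualities. The choice of `δ` makes it vanish at `θh`.
  let P : ℕ → C(M.Quality, ℝ) := fun n => ⟨fun x => T n (M.marginalCost x), (hTc n).comp
    (continuousOn_iff_continuous_domRestrict.1 M.marginalCost_continuousOn)⟩
  have hPT : ∀ n, ∀ θ ∈ M.types, P n (M.bestQuality θ) = T n θ := fun n θ hθ => by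
    have h1 := M.types_subset hθ
    change T n (M.marginalCost (M.bestQuality θ)) = T n θ
    rw [M.marginalCost_bestQuality h1.1 h1.2]
  have hbc : ContinuousOn M.bestQ M.types := bestQ_continuousOn.mono M.types_subset
  have hPc : ∀ n, ContinuousOn (fun θ => P n (M.bestQuality θ)) M.types := fun n =>
    (P n).continuous.comp_continuousOn (M.bestQuality_continuousOn.mono M.types_subset)
  have hP01 : ∀ n x, P n x ∈ Icc (0 : ℝ) 1 := fun n x => hT01 n _
  have hlim : ∀ {g : ℝ → ℝ}, IntervalIntegrable g volume M.θl M.θh →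
      Tendsto (fun n => ∫ θ in M.θl..M.θh, g θ * P n (M.bestQuality θ)) atTop
        (𝓝 (∫ θ in S, g θ)) := fun hg =>
    integral_mul_indicator_tendsto hg hS hSs hPc (fun n θ => norm_le_one_of_mem (hP01 n) _)
      fun θ hθ => by simp only [hPT _ θ hθ]; exact hTlim θ
  have hsub : uIcc M.θl M.θh ⊆ M.types := uIcc_subset_Icc left_mem_types right_mem_types
  have hfi := deriv_density_intervalIntegrable hf hd
  have l1 := hlim (hfi.mul_continuousOn (g := fun θ => θ) continuousOn_id)
  have l2 := hlim (g := fun θ => M.f θ * M.bestQ θ)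
    ((M.f_cont.mul hbc).intervalIntegrable_of_Icc M.θl_lt_θh.le)
  have l3 := hlim (hfi.mul_continuousOn (g := fun θ => θ * M.bestQ θ)
    (continuousOn_id.mul (hbc.mono hsub)))
  have l4 := hlim (M.f_cont.intervalIntegrable_of_Icc M.θl_lt_θh.le)
  refine le_of_tendsto_of_tendsto' (l1.mul l2) (l3.mul l4) fun n => ?_
  have hcov := covariance_nonneg_of_optimal h hf hd h0 (hP01 n)
    ((hPT n _ right_mem_types).trans (hTh n))
  have e1 : ∀ θ, -deriv M.f θ * θ * P n (M.bestQuality θ) =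
      -deriv M.f θ * (θ * P n (M.bestQuality θ)) := fun θ => by ring
  have e2 : ∀ θ, M.f θ * M.bestQ θ * P n (M.bestQuality θ) =
      M.f θ * (P n (M.bestQuality θ) * M.bestQ θ) := fun θ => by ring
  have e3 : ∀ θ, -deriv M.f θ * (θ * M.bestQ θ) * P n (M.bestQuality θ) =
      -deriv M.f θ * (θ * (P n (M.bestQuality θ) * M.bestQ θ)) := fun θ => by ring
  simp only [e1, e2, e3]
  exact hcov

theorem integral_block_bounds (hf : AntitoneOn M.f M.types)
    (hd : DifferentiableOn ℝ M.f (Ioo M.θl M.θh)) {s t : ℝ} (hs : M.θl < s) (hst : s ≤ t)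
    (ht : t < M.θh) :
    (s * (M.f s - M.f t) ≤ ∫ θ in Icc s t, -deriv M.f θ * θ) ∧
    (∫ θ in Icc s t, -deriv M.f θ * θ ≤ t * (M.f s - M.f t)) ∧
    ((t - s) * M.f t ≤ ∫ θ in Icc s t, M.f θ) ∧
    (∫ θ in Icc s t, M.f θ ≤ (t - s) * M.f s) ∧
    (M.bestQ s * (∫ θ in Icc s t, M.f θ) ≤ ∫ θ in Icc s t, M.f θ * M.bestQ θ) ∧
    (∫ θ in Icc s t, -deriv M.f θ * (θ * M.bestQ θ) ≤
      M.bestQ t * ∫ θ in Icc s t, -deriv M.f θ * θ) := by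
  have hss : s ∈ M.types := ⟨hs.le, hst.trans ht.le⟩
  have htt : t ∈ M.types := ⟨hs.le.trans hst, ht.le⟩
  have hsub : uIcc s t ⊆ M.types := uIcc_subset_Icc hss htt
  have hsubo : ∀ θ ∈ Icc s t, θ ∈ Ioo M.θl M.θh := fun θ hθ =>
    ⟨hs.trans_le hθ.1, hθ.2.trans_lt ht⟩
  simp only [integral_Icc_eq_integral_Ioc, ← intervalIntegral.integral_of_le hst]
  have hbc : ContinuousOn M.bestQ (uIcc s t) :=
    bestQ_continuousOn.mono (hsub.trans M.types_subset)
  have hfi : IntervalIntegrable (fun θ => -deriv M.f θ) volume s t :=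
    (deriv_density_intervalIntegrable hf hd).mono_set (by
      rw [uIcc_of_le M.θl_lt_θh.le]; exact hsub)
  have hfdi : IntervalIntegrable M.f volume s t := (M.f_cont.mono hsub).intervalIntegrable
  have hFTC : ∫ θ in s..t, -deriv M.f θ = M.f s - M.f t := by
    have := intervalIntegral.integral_eq_sub_of_hasDerivAt (f := fun θ => -M.f θ)
      (f' := fun θ => -deriv M.f θ) (a := s) (b := t) (fun θ hθ => by
        rw [uIcc_of_le hst] at hθ
        exact (hasDerivAt_density hd (hsubo θ hθ)).neg) hfi
    rw [this]; ring
  have hpos : ∀ θ ∈ Icc s t, 0 ≤ -deriv M.f θ := fun θ hθ =>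
    neg_nonneg.2 (deriv_density_nonpos hf (hsubo θ hθ))
  have hid : IntervalIntegrable (fun θ => -deriv M.f θ * θ) volume s t :=
    hfi.mul_continuousOn continuousOn_id
  have hs0 : 0 < s := M.θl_nonneg.trans_lt hs
  refine ⟨?_, ?_, ?_, ?_, ?_, ?_⟩
  · rw [← hFTC, ← intervalIntegral.integral_const_mul]
    refine intervalIntegral.integral_mono_on hst (hfi.const_mul s) hid fun θ hθ => ?_
    have := mul_le_mul_of_nonneg_left hθ.1 (hpos θ hθ)
    linarith
  · rw [← hFTC, ← intervalIntegral.integral_const_mul]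
    refine intervalIntegral.integral_mono_on hst hid (hfi.const_mul t) fun θ hθ => ?_
    have := mul_le_mul_of_nonneg_left hθ.2 (hpos θ hθ)
    linarith
  · have := intervalIntegral.integral_mono_on hst intervalIntegrable_const hfdi
      fun θ hθ => hf (Ioo_subset_Icc_self (hsubo θ hθ)) htt hθ.2
    rwa [intervalIntegral.integral_const, smul_eq_mul] at this
  · have := intervalIntegral.integral_mono_on hst hfdi intervalIntegrable_const
      fun θ hθ => hf hss (Ioo_subset_Icc_self (hsubo θ hθ)) hθ.1
    rwa [intervalIntegral.integral_const, smul_eq_mul] at this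
  · rw [← intervalIntegral.integral_const_mul]
    refine intervalIntegral.integral_mono_on hst (hfdi.const_mul _)
      (hfdi.mul_continuousOn hbc) fun θ hθ => ?_
    have := mul_le_mul_of_nonneg_left (bestQ_mono (M := M) hθ.1)
      (M.f_pos θ (Ioo_subset_Icc_self (hsubo θ hθ))).le
    linarith
  · rw [← intervalIntegral.integral_const_mul]
    refine intervalIntegral.integral_mono_on hst
      (hfi.mul_continuousOn (continuousOn_id.mul hbc)) (hid.const_mul _) fun θ hθ => ?_
    have := mul_le_mul_of_nonneg_left (bestQ_mono (M := M) hθ.2)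
      (mul_nonneg (hpos θ hθ) (hs0.le.trans hθ.1))
    linarith

/-- Since `f'` need not be continuous, its averages are not controlled pointwise. On a short block
the factor `θ` is nearly constant, and `∫ -f'` is a difference of `f`, so the average is squeezed
between multiples of a difference quotient. -/
theorem tendsto_block_integrals (hf : AntitoneOn M.f M.types)
    (hd : DifferentiableOn ℝ M.f (Ioo M.θl M.θh)) {s : ℝ} (hs : s ∈ Ioo M.θl M.θh) :
    Tendsto (fun h => h⁻¹ * ∫ θ in Icc s (s + h), -deriv M.f θ * θ) (𝓝[>] 0)
      (𝓝 (s * -deriv M.f s)) ∧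
    Tendsto (fun h => h⁻¹ * ∫ θ in Icc s (s + h), M.f θ) (𝓝[>] 0) (𝓝 (M.f s)) ∧
    Tendsto (fun h => M.bestQ (s + h)) (𝓝[>] 0) (𝓝 (M.bestQ s)) := by
  have hadd : Tendsto (fun h => s + h) (𝓝[>] 0) (𝓝 s) := by
    have : Tendsto (fun h => s + h) (𝓝 0) (𝓝 (s + 0)) := tendsto_id.const_add s
    rw [add_zero] at this
    exact this.mono_left nhdsWithin_le_nhds
  have hnhds : M.types ∈ 𝓝 s := Icc_mem_nhds hs.1 hs.2
  have hfc : Tendsto (fun h => M.f (s + h)) (𝓝[>] 0) (𝓝 (M.f s)) :=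
    (M.f_cont.continuousAt hnhds).tendsto.comp hadd
  have hbc : Tendsto (fun h => M.bestQ (s + h)) (𝓝[>] 0) (𝓝 (M.bestQ s)) :=
    ((bestQ_continuousOn.mono M.types_subset).continuousAt hnhds).tendsto.comp hadd
  have hslope : Tendsto (fun h => h⁻¹ * (M.f s - M.f (s + h))) (𝓝[>] 0) (𝓝 (-deriv M.f s)) := by
    have h1 := ((hasDerivAt_iff_tendsto_slope_zero.1 (hasDerivAt_density hd hs)).mono_left
      (nhdsWithin_mono 0 (fun x hx => ne_of_gt hx : Ioi (0 : ℝ) ⊆ {0}ᶜ))).neg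
    refine h1.congr fun h => ?_
    rw [smul_eq_mul]; ring
  have hev : ∀ᶠ h in 𝓝[>] (0 : ℝ), 0 < h ∧ s + h < M.θh :=
    (eventually_mem_nhdsWithin (s := Ioi (0 : ℝ))).and (hadd.eventually (gt_mem_nhds hs.2))
  refine ⟨?_, ?_, hbc⟩
  · refine tendsto_of_tendsto_of_tendsto_of_le_of_le' (hslope.const_mul s) (hadd.mul hslope) ?_ ?_
    · filter_upwards [hev] with h hh
      have := (integral_block_bounds hf hd hs.1 (by linarith [hh.1]) hh.2).1
      have := mul_le_mul_of_nonneg_left this (inv_nonneg.2 hh.1.le)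
      linarith
    · filter_upwards [hev] with h hh
      have := (integral_block_bounds hf hd hs.1 (by linarith [hh.1]) hh.2).2.1
      have := mul_le_mul_of_nonneg_left this (inv_nonneg.2 hh.1.le)
      linarith
  · refine tendsto_of_tendsto_of_tendsto_of_le_of_le' hfc tendsto_const_nhds ?_ ?_
    · filter_upwards [hev] with h hh
      have := (integral_block_bounds hf hd hs.1 (by linarith [hh.1]) hh.2).2.2.1
      rw [add_sub_cancel_left] at this
      rwa [inv_mul_eq_div, le_div_iff₀' hh.1]
    · filter_upwards [hev] with h hh
      have := (integral_block_bounds hf hd hs.1 (by linarith [hh.1]) hh.2).2.2.2.1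
      rw [add_sub_cancel_left] at this
      rwa [inv_mul_eq_div, div_le_iff₀' hh.1]

/-- Where the elasticity of the density increases, noise raises expected quality. -/
theorem antitoneOn_elasticity_of_optimal (h : M.IsOptimal M.fullyRevealing)
    (hf : AntitoneOn M.f M.types) (hd : DifferentiableOn ℝ M.f (Ioo M.θl M.θh)) (h0 : M.θl = 0) :
    AntitoneOn M.elasticity (Ioo M.θl M.θh) := by
  intro a ha b hb hab
  rcases hab.eq_or_lt with rfl | hab
  · exact le_rfl
  obtain ⟨la, la', la''⟩ := tendsto_block_integrals hf hd ha
  obtain ⟨lb, lb', lb''⟩ := tendsto_block_integrals hf hd hb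
  have hev : ∀ᶠ η in 𝓝[>] (0 : ℝ), 0 < η ∧ a + η < b ∧ b + η < M.θh := by
    have h1 : ∀ s : ℝ, Tendsto (fun η => s + η) (𝓝[>] 0) (𝓝 s) := fun s => by
      have : Tendsto (fun η => s + η) (𝓝 0) (𝓝 (s + 0)) := tendsto_id.const_add s
      rw [add_zero] at this
      exact this.mono_left nhdsWithin_le_nhds
    exact (eventually_mem_nhdsWithin (s := Ioi (0 : ℝ))).and
      (((h1 a).eventually (gt_mem_nhds hab)).and ((h1 b).eventually (gt_mem_nhds hb.2)))
  -- The covariance inequality on the two blocks `[a, a + η]` and `[b, b + η]`, divided by `η ^ 2`,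
  -- tends to a two-point covariance inequality.
  have hlim := le_of_tendsto_of_tendsto
    ((la.add lb).mul ((la'.const_mul (M.bestQ a)).add (lb'.const_mul (M.bestQ b))))
    (((la''.mul la).add (lb''.mul lb)).mul (la'.add lb')) (by
      filter_upwards [hev] with η hη
      obtain ⟨hη0, hη1, hη2⟩ := hη
      have ba := integral_block_bounds hf hd ha.1 (t := a + η) (by linarith) (by linarith)
      have bb := integral_block_bounds hf hd hb.1 (t := b + η) (by linarith) hη2
      have hsa : Icc a (a + η) ⊆ Ioo M.θl M.θh := fun θ hθ =>
        ⟨ha.1.trans_le hθ.1, by linarith [hθ.2]⟩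
      have hsb : Icc b (b + η) ⊆ Ioo M.θl M.θh := fun θ hθ =>
        ⟨hb.1.trans_le hθ.1, by linarith [hθ.2]⟩
      have hdisj : Disjoint (Icc a (a + η)) (Icc b (b + η)) :=
        Set.disjoint_left.2 fun θ h1 h2 => by linarith [h1.2, h2.1]
      have hcov := setIntegral_covariance_of_optimal h hf hd h0
        (isClosed_Icc.union isClosed_Icc) (union_subset hsa hsb) hη2
        (by rintro θ (hθ | hθ) <;> linarith [hθ.2])
      have hbc : ContinuousOn M.bestQ M.types := bestQ_continuousOn.mono M.types_subset
      have hsub : uIcc M.θl M.θh ⊆ M.types := uIcc_subset_Icc left_mem_types right_mem_types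
      have hfi := deriv_density_intervalIntegrable hf hd
      have hsplit : ∀ {g : ℝ → ℝ}, IntervalIntegrable g volume M.θl M.θh →
          ∫ θ in Icc a (a + η) ∪ Icc b (b + η), g θ =
            (∫ θ in Icc a (a + η), g θ) + ∫ θ in Icc b (b + η), g θ := fun hg => by
        rw [intervalIntegrable_iff_integrableOn_Ioo_of_le M.θl_lt_θh.le] at hg
        exact setIntegral_union hdisj measurableSet_Icc (hg.mono_set hsa) (hg.mono_set hsb)
      rw [hsplit (hfi.mul_continuousOn (g := fun θ => θ) continuousOn_id),
        hsplit (g := fun θ => M.f θ * M.bestQ θ)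
          ((M.f_cont.mul hbc).intervalIntegrable_of_Icc M.θl_lt_θh.le),
        hsplit (hfi.mul_continuousOn (g := fun θ => θ * M.bestQ θ)
          (continuousOn_id.mul (hbc.mono hsub))),
        hsplit (M.f_cont.intervalIntegrable_of_Icc M.θl_lt_θh.le)] at hcov
      have hpa := M.θl_nonneg.trans_lt ha.1
      have hpb := M.θl_nonneg.trans_lt hb.1
      have hma : a ∈ M.types := Ioo_subset_Icc_self ha
      have hmb : b ∈ M.types := Ioo_subset_Icc_self hb
      have hma' : a + η ∈ M.types := ⟨by linarith [ha.1], by linarith⟩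
      have hmb' : b + η ∈ M.types := ⟨by linarith [hb.1], hη2.le⟩
      have na : 0 ≤ ∫ θ in Icc a (a + η), -deriv M.f θ * θ :=
        (mul_nonneg hpa.le (sub_nonneg.2 (hf hma hma' (by linarith)))).trans ba.1
      have nb : 0 ≤ ∫ θ in Icc b (b + η), -deriv M.f θ * θ :=
        (mul_nonneg hpb.le (sub_nonneg.2 (hf hmb hmb' (by linarith)))).trans bb.1
      have na' : 0 ≤ ∫ θ in Icc a (a + η), M.f θ :=
        (mul_nonneg (by linarith) (M.f_pos _ hma').le).trans ba.2.2.1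
      have nb' : 0 ≤ ∫ θ in Icc b (b + η), M.f θ :=
        (mul_nonneg (by linarith) (M.f_pos _ hmb').le).trans bb.2.2.1
      obtain ⟨-, -, -, -, ba5, ba6⟩ := ba
      obtain ⟨-, -, -, -, bb5, bb6⟩ := bb
      have hfin := ((mul_le_mul_of_nonneg_left (add_le_add ba5 bb5) (add_nonneg na nb)).trans
        hcov).trans (mul_le_mul_of_nonneg_right (add_le_add ba6 bb6) (add_nonneg na' nb'))
      have hsq := mul_le_mul_of_nonneg_left hfin (mul_self_nonneg η⁻¹)
      linarith)
  have hq : M.bestQ a < M.bestQ b := bestQ_strictMonoOn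
    (M.types_subset (Ioo_subset_Icc_self ha)) (M.types_subset (Ioo_subset_Icc_self hb)) hab
  -- A two-point covariance factors into a product of differences, and the quality difference is
  -- positive.
  have hkey : (b * deriv M.f b * M.f a - a * deriv M.f a * M.f b) * (M.bestQ b - M.bestQ a) ≤ 0 := by
    linarith
  have hle := nonpos_of_mul_nonpos_left hkey (sub_pos.2 hq)
  have hfa := M.f_pos a (Ioo_subset_Icc_self ha)
  have hfb := M.f_pos b (Ioo_subset_Icc_self hb)
  unfold elasticity
  rw [div_le_div_iff₀ hfb hfa]
  linarith

end RatingModel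
end

/-! ### The main theorem -/

theorem mainTheorem7 (M : RatingModel) :
    (MonotoneOn M.f (Set.Icc M.θl M.θh) → ∃ q₀ : M.Quality, M.IsOptimal (M.passFail q₀)) ∧
    (DifferentiableOn ℝ M.f (Set.Ioo M.θl M.θh) →
      (M.IsOptimal M.fullyRevealing ↔
        AntitoneOn M.f (Set.Icc M.θl M.θh) ∧
          AntitoneOn M.elasticity (Set.Ioo M.θl M.θh) ∧ M.θl = 0)) := by
  refine ⟨RatingModel.exists_isOptimal_passFail, fun hd => ⟨fun h => ?_, fun h => ?_⟩⟩
  · have hf := RatingModel.antitoneOn_density_of_optimal h hd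
    have h0 := RatingModel.θl_eq_zero_of_optimal h
    exact ⟨hf, RatingModel.antitoneOn_elasticity_of_optimal h hf hd h0, h0⟩
  · refine RatingModel.isOptimal_fullyRevealing_iff.2 fun R A hA => ?_
    rw [A.expectedQuality_eq]
    exact hA.feasible.expected_le_bestQ h.1 hd h.2.1 h.2.2
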